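/- **Setting.** Let $Q\subset\mathbb R^3$ be a region diffeomorphic to the closed solid torus $D^2\times S^1$, $S^1=\mathbb R/2\pi\mathbb Z$; "smooth" means $C^\infty$ (up to the boundary, for objects on $Q$). Call a smooth $f:Q\to\mathbb R$ *nondegenerate* if the zero locus $\ell_f=\{x\in Q:\nabla f(x)=0\}$ is diffeomorphic to $S^1$ and the Hessian $\nabla^2 f$ along $\ell_f$ is sign-definite on the normal planes of $\ell_f$. A *nondegenerate equilibrium* on $Q$ is a smooth vector field $B$ and a smooth function $\mathsf p$ on $Q$ with $(\nabla\times B)\times B=\nabla\mathsf p$ and $\nabla\cdot B=0$ on $Q$, $B\cdot n=0$ on $\partial Q$, and $\mathsf p$ nondegenerate. Put $J=\nabla\times B$. A *volume-preserving circle action* is a family of maps $\Phi_\theta:Q\to Q$, $\theta\in\mathbb R$, smooth in $(\theta,x)$, with $\Phi_{\theta+2\pi}=\Phi_\theta$, $\Phi_0=\mathrm{id}$, $\Phi_{\theta_1+\theta_2}=\Phi_{\theta_1}\circ\Phi_{\theta_2}$, such that $\Phi_\theta(U)$ has the same volume as $U$ for each $\theta$ and each relatively open $U\subset Q$. Its infinitesimal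 generator is $u(x)=\frac{d}{d\theta}\big|_{0}\Phi_\theta(x)$. Let $\bar g=\frac1{2\pi}\int_0^{2\pi}\Phi_\theta^*g\,d\theta$ be the averaged metric ($g$ the Euclidean metric), regarded as a matrix field in Cartesian coordinates, and let $\rho=\sqrt{\det\bar g}$. The averaged operations are $$v\,\bar\cdot\,w=v^T\bar g\,w,\quad v\,\bar\times\,w=\rho\,\bar g^{-1}(v\times w),\quad \bar\nabla f=\bar g^{-1}\nabla f,\quad \bar\nabla\bar\cdot w=\rho^{-1}\nabla\cdot(\rho w),\quad \bar\nabla\bar\times w=\rho^{-1}\nabla\times(\bar g w).$$ Let $R^2=u\,\bar\cdot\,u$. **Theorem (generalized Grad-Shafranov equation).** Let $(B,\mathsf p)$ be a nondegenerate equilibrium on $Q$, and let $\Phi_\theta$ be a volume-preserving circle action on $Q$ whose infinitesimal generator $u$ is nowhere vanishing and satisfies $[u,B]=[u,J]=0$. Then there is a smooth stream function, that is, a smooth $\psi:Q\to\mathbb R$ with $u\times B=\nabla\psi$. Every such $\psi$ is constant on $\partial Q$ and satisfies $$B=(u\,\bar\cdot\,B)\,\frac{u}{R^2}+\rho\,\frac{\bar\nabla\psi\,\bar\times\,u}{R^2}.$$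 If moreover $\psi$ is nondegenerate, then there are smooth functions $C,P:\mathbb R\to\mathbb R$ with $u\,\bar\cdot\,B=C(\psi)$ and $\mathsf p=P(\psi)$ on $Q$. Consequently $$B=C(\psi)\,\frac{u}{R^2}+\rho\,\frac{\bar\nabla\psi\,\bar\times\,u}{R^2},$$ and $\psi$ solves on $Q$ the generalized Grad-Shafranov equation $$-\bar\nabla\,\bar\cdot\,\bigl(R^{-2}\rho\,\bar\nabla\psi\bigr)+C(\psi)\,\frac{u}{R^2}\,\bar\cdot\,\bar\nabla\,\bar\times\Bigl(\frac{u}{R^2}\Bigr)=\frac{P'(\psi)+R^{-2}\,C(\psi)\,C'(\psi)}{\rho}.$$ -/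

import Mathlib

open Set MeasureTheory
open scoped ContDiff Matrix

noncomputable section

namespace MHD

/-- Euclidean three-space in Cartesian coordinates; the dot product is `⬝ᵥ` and the cross
product is `⨯₃`. -/
abbrev R3 := Fin 3 → ℝ

/-! ### The plasma volume -/

/-- `Q` is a region of `ℝ³` diffeomorphic to the closed solid torus `D² × S¹`, with
`S¹ = ℝ mod 2π`: it is the image of a smooth embedding of `D² × S¹`, written as a map `F` on
`D² × ℝ` that is periodic in the second variable. -/
def IsSolidTorus (Q : Set R3) : Prop :=
  ∃ F : ℂ × ℝ → R3,
    ContDiffOn ℝ ∞ F (Metric.closedBall (0 : ℂ) 1 ×ˢ (univ : Set ℝ)) ∧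
    (∀ z ∈ Metric.closedBall (0 : ℂ) 1, ∀ s : ℝ, ∀ z' ∈ Metric.closedBall (0 : ℂ) 1, ∀ s' : ℝ,
      F (z, s) = F (z', s') ↔ z = z' ∧ ∃ k : ℤ, s' = s + k * (2 * Real.pi)) ∧
    (∀ q ∈ Metric.closedBall (0 : ℂ) 1 ×ˢ (univ : Set ℝ),
      Function.Injective
        (fderivWithin ℝ F (Metric.closedBall (0 : ℂ) 1 ×ˢ (univ : Set ℝ)) q)) ∧
    F '' (Metric.closedBall (0 : ℂ) 1 ×ˢ (univ : Set ℝ)) = Q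

/-- `n` is normal to the boundary of `Q` at `x`: it is orthogonal to every tangent vector
of `∂Q` at `x`. -/
def IsNormalToBoundary (Q : Set R3) (x n : R3) : Prop :=
  ∀ t ∈ tangentConeAt ℝ (frontier Q) x, n ⬝ᵥ t = 0

/-! ### Vector calculus on `Q` with the flat metric

Derivatives are taken within `Q`, so that they are one-sided at points of `∂Q`. -/

/-- The gradient `∇f` at `x`. -/
def grad (Q : Set R3) (f : R3 → ℝ) (x : R3) : R3 :=
  fun i => fderivWithin ℝ f Q x (Pi.single i 1)

/-- The partial derivative `∂ᵢ wⱼ` at `x`. -/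
def partialD (Q : Set R3) (w : R3 → R3) (x : R3) (i j : Fin 3) : ℝ :=
  fderivWithin ℝ w Q x (Pi.single i 1) j

/-- The divergence `∇ · w` at `x`. -/
def div (Q : Set R3) (w : R3 → R3) (x : R3) : ℝ :=
  ∑ i, partialD Q w x i i

/-- The curl `∇ × w` at `x`. -/
def curl (Q : Set R3) (w : R3 → R3) (x : R3) : R3 :=
  ![partialD Q w x 1 2 - partialD Q w x 2 1,
    partialD Q w x 2 0 - partialD Q w x 0 2,
    partialD Q w x 0 1 - partialD Q w x 1 0]

/-- The Hessian quadratic form `v · ∇²f · v` at `x`. -/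
def hess (Q : Set R3) (f : R3 → ℝ) (x v : R3) : ℝ :=
  fderivWithin ℝ (grad Q f) Q x v ⬝ᵥ v

/-! ### Nondegenerate equilibria -/

/-- The zero locus `ℓ` of `∇f` in `Q` is diffeomorphic to `S¹` (it is parametrized by a smooth
embedded closed curve `γ` of period `2π`), and the Hessian of `f` along `ℓ` is sign-definite
on the normal spaces of `ℓ`. -/
def HasNondegenerateAxis (Q : Set R3) (f : R3 → ℝ) : Prop :=
  ∃ γ : ℝ → R3,
    ContDiff ℝ ∞ γ ∧
    (∀ s s' : ℝ, γ s = γ s' ↔ ∃ k : ℤ, s' = s + k * (2 * Real.pi)) ∧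
    (∀ s, deriv γ s ≠ 0) ∧
    range γ = {x ∈ Q | grad Q f x = 0} ∧
    ∀ s, (∀ v : R3, v ≠ 0 → v ⬝ᵥ deriv γ s = 0 → 0 < hess Q f (γ s) v) ∨
         (∀ v : R3, v ≠ 0 → v ⬝ᵥ deriv γ s = 0 → hess Q f (γ s) v < 0)

/-- `(B, p)` is a nondegenerate solution of the MHD equilibrium equations on `Q`. -/
structure IsNondegenerateEquilibrium (Q : Set R3) (B : R3 → R3) (p : R3 → ℝ) : Prop where
  smooth_field : ContDiffOn ℝ ∞ B Q
  smooth_pressure : ContDiffOn ℝ ∞ p Q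
  force_balance : ∀ x ∈ Q, curl Q B x ⨯₃ B x = grad Q p x
  div_free : ∀ x ∈ Q, div Q B x = 0
  tangent : ∀ x ∈ frontier Q, ∀ n : R3, IsNormalToBoundary Q x n → B x ⬝ᵥ n = 0
  nondegenerate : HasNondegenerateAxis Q p

/-! ### Circle actions -/

/-- A circle action on `Q`, with `S¹ = ℝ mod 2π`. -/
structure IsCircleAction (Q : Set R3) (Φ : ℝ → R3 → R3) : Prop where
  mapsTo : ∀ θ, MapsTo (Φ θ) Q Q
  periodic : ∀ θ, ∀ x ∈ Q, Φ (θ + 2 * Real.pi) x = Φ θ x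
  map_zero : ∀ x ∈ Q, Φ 0 x = x
  map_add : ∀ θ₁ θ₂, ∀ x ∈ Q, Φ (θ₁ + θ₂) x = Φ θ₁ (Φ θ₂ x)
  smooth : ContDiffOn ℝ ∞ (fun q : ℝ × R3 => Φ q.1 q.2) (univ ×ˢ Q)

/-- A circle action that preserves the volume of every relatively open subset of `Q`. -/
structure IsVolumePreservingCircleAction (Q : Set R3) (Φ : ℝ → R3 → R3) : Prop
    extends IsCircleAction Q Φ where
  volume_image : ∀ θ, ∀ V : Set R3, IsOpen V → volume (Φ θ '' (V ∩ Q)) = volume (V ∩ Q)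

/-- The infinitesimal generator `u(x) = d/dθ|₀ Φ_θ(x)`. -/
def generator (Φ : ℝ → R3 → R3) (x : R3) : R3 :=
  deriv (fun θ => Φ θ x) 0

/-- The Jacobian matrix `[P(θ)]ᵢⱼ = ∂ⱼ Φ_θⁱ` at `x`. -/
def jacobian (Q : Set R3) (Φ : ℝ → R3 → R3) (θ : ℝ) (x : R3) : Matrix (Fin 3) (Fin 3) ℝ :=
  Matrix.of fun i j => fderivWithin ℝ (Φ θ) Q x (Pi.single j 1) i

/-- The matrix at `x` of the averaged metric, the mean over `θ ∈ [0, 2π]` of the pullbacks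
`Φ_θ^* g` of the flat metric. -/
def avgMetric (Q : Set R3) (Φ : ℝ → R3 → R3) (x : R3) : Matrix (Fin 3) (Fin 3) ℝ :=
  Matrix.of fun i j =>
    (2 * Real.pi)⁻¹ *
      ∫ θ in (0 : ℝ)..(2 * Real.pi), ((jacobian Q Φ θ x)ᵀ * jacobian Q Φ θ x) i j

/-! ### Vector calculus with respect to a metric `h`

A metric is given by its matrix field in Cartesian coordinates. -/

/-- The density `ρ_h = √(det h)`. -/
def density (h : Matrix (Fin 3) (Fin 3) ℝ) : ℝ := Real.sqrt h.det

/-- The dot product `h(v, w)`. -/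
def mdot (h : Matrix (Fin 3) (Fin 3) ℝ) (v w : R3) : ℝ := v ⬝ᵥ (h *ᵥ w)

/-- The cross product with respect to `h`; see `mdot_mcross`. -/
def mcross (h : Matrix (Fin 3) (Fin 3) ℝ) (v w : R3) : R3 :=
  density h • (h⁻¹ *ᵥ (v ⨯₃ w))

/-- The gradient with respect to `h`; see `mdot_mgrad`. -/
def mgrad (Q : Set R3) (h : R3 → Matrix (Fin 3) (Fin 3) ℝ) (f : R3 → ℝ) (x : R3) : R3 :=
  (h x)⁻¹ *ᵥ grad Q f x

/-- The divergence with respect to `h`, `ρ_h⁻¹ ∇ · (ρ_h w)`. -/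
def mdiv (Q : Set R3) (h : R3 → Matrix (Fin 3) (Fin 3) ℝ) (w : R3 → R3) (x : R3) : ℝ :=
  (density (h x))⁻¹ * div Q (fun y => density (h y) • w y) x

/-- The curl with respect to `h`, `ρ_h⁻¹ ∇ × (h w)`; see `mdot_mcurl`. -/
def mcurl (Q : Set R3) (h : R3 → Matrix (Fin 3) (Fin 3) ℝ) (w : R3 → R3) (x : R3) : R3 :=
  (density (h x))⁻¹ • curl Q (fun y => h y *ᵥ w y) x

theorem mdot_comm {h : Matrix (Fin 3) (Fin 3) ℝ} (hs : h.IsSymm) (v w : R3) :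
    mdot h v w = mdot h w v := by
  unfold mdot
  rw [Matrix.dotProduct_mulVec, ← Matrix.mulVec_transpose, hs.eq, dotProduct_comm]

/-- The characterization `(v ×̄ w) ·̄ z = ρ_h (v × w) · z` of the cross product. -/
theorem mdot_mcross {h : Matrix (Fin 3) (Fin 3) ℝ} (hs : h.IsSymm) (hd : 0 < h.det)
    (v w z : R3) : mdot h (mcross h v w) z = density h * ((v ⨯₃ w) ⬝ᵥ z) := by
  rw [mdot_comm hs]
  unfold mdot mcross
  rw [Matrix.mulVec_smul, Matrix.mulVec_mulVec, Matrix.mul_nonsing_inv _ hd.ne'.isUnit,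
    Matrix.one_mulVec, dotProduct_smul, smul_eq_mul, dotProduct_comm]

/-- The characterization `∇̄f ·̄ v = ∇f · v` of the gradient. -/
theorem mdot_mgrad (Q : Set R3) {h : R3 → Matrix (Fin 3) (Fin 3) ℝ} (f : R3 → ℝ) {x : R3}
    (hs : (h x).IsSymm) (hd : 0 < (h x).det) (v : R3) :
    mdot (h x) (mgrad Q h f x) v = grad Q f x ⬝ᵥ v := by
  rw [mdot_comm hs]
  unfold mdot mgrad
  rw [Matrix.mulVec_mulVec, Matrix.mul_nonsing_inv _ hd.ne'.isUnit, Matrix.one_mulVec,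
    dotProduct_comm]

theorem grad_dotProduct (Q : Set R3) (f : R3 → ℝ) (x v : R3) :
    grad Q f x ⬝ᵥ v = fderivWithin ℝ f Q x v := by
  have hv : v = ∑ i, v i • (Pi.single i (1 : ℝ) : R3) := by
    ext j; simp [Finset.sum_apply, Pi.single_apply]
  conv_rhs => rw [hv, map_sum]
  simp [grad, dotProduct, mul_comm]

/-- The characterization of the curl by the formula
`(∇̄ ×̄ w) ·̄ (v₁ ×̄ v₂) = v₁ ·̄ ∇̄(w ·̄ v₂) - v₂ ·̄ ∇̄(w ·̄ v₁) - w ·̄ [v₁, v₂]`. -/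
theorem mdot_mcurl {Q : Set R3} {h : R3 → Matrix (Fin 3) (Fin 3) ℝ} {w v₁ v₂ : R3 → R3} {x : R3}
    (hQ : UniqueDiffWithinAt ℝ Q x) (hs : ∀ y, (h y).IsSymm) (hd : 0 < (h x).det)
    (hw : DifferentiableWithinAt ℝ (fun y => h y *ᵥ w y) Q x)
    (h₁ : DifferentiableWithinAt ℝ v₁ Q x) (h₂ : DifferentiableWithinAt ℝ v₂ Q x) :
    mdot (h x) (mcurl Q h w x) (mcross (h x) (v₁ x) (v₂ x)) =
      mdot (h x) (v₁ x) (mgrad Q h (fun y => mdot (h y) (w y) (v₂ y)) x)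
      - mdot (h x) (v₂ x) (mgrad Q h (fun y => mdot (h y) (w y) (v₁ y)) x)
      - mdot (h x) (w x) (VectorField.lieBracketWithin ℝ v₁ v₂ Q x) := by
  have hρ : density (h x) ≠ 0 := (Real.sqrt_pos.2 hd).ne'
  set W : R3 → R3 := fun y => h y *ᵥ w y with hW
  have key : ∀ v : R3 → R3, DifferentiableWithinAt ℝ v Q x → ∀ z : R3,
      fderivWithin ℝ (fun y => mdot (h y) (w y) (v y)) Q x z =
        fderivWithin ℝ W Q x z ⬝ᵥ v x + W x ⬝ᵥ fderivWithin ℝ v Q x z := by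
    intro v hv z
    have e : (fun y => mdot (h y) (w y) (v y)) = fun y => ∑ i, W y i * v y i := by
      funext y
      rw [mdot_comm (hs y), mdot, dotProduct_comm]
      rfl
    have hWi : ∀ i, HasFDerivWithinAt (fun y => W y i)
        ((ContinuousLinearMap.proj i).comp (fderivWithin ℝ W Q x)) Q x := fun i =>
      (hasFDerivWithinAt_pi'.1 hw.hasFDerivWithinAt) i
    have hvi : ∀ i, HasFDerivWithinAt (fun y => v y i)
        ((ContinuousLinearMap.proj i).comp (fderivWithin ℝ v Q x)) Q x := fun i =>
      (hasFDerivWithinAt_pi'.1 hv.hasFDerivWithinAt) i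
    rw [e, (HasFDerivWithinAt.fun_sum (u := Finset.univ)
      (fun i _ => (hWi i).fun_mul (hvi i))).fderivWithin hQ]
    simp only [_root_.sum_apply, _root_.add_apply,
      _root_.smul_apply, ContinuousLinearMap.comp_apply,
      ContinuousLinearMap.proj_apply, smul_eq_mul, dotProduct, ← Finset.sum_add_distrib]
    exact Finset.sum_congr rfl fun i _ => by ring
  have lin : ∀ z : R3, ∀ j, fderivWithin ℝ W Q x z j = ∑ i, z i * partialD Q W x i j := by
    intro z j
    have hz : z = ∑ i, z i • (Pi.single i (1 : ℝ) : R3) := by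
      ext j; simp [Finset.sum_apply, Pi.single_apply]
    conv_lhs => rw [hz, map_sum]
    simp [partialD]
  have eL : mdot (h x) (mcurl Q h w x) (mcross (h x) (v₁ x) (v₂ x)) =
      curl Q W x ⬝ᵥ (v₁ x ⨯₃ v₂ x) := by
    rw [mdot_comm (hs x), mdot_mcross (hs x) hd, mcurl, dotProduct_smul, smul_eq_mul,
      mul_inv_cancel_left₀ hρ, dotProduct_comm]
  have e3 : ∀ z, mdot (h x) (w x) z = W x ⬝ᵥ z := fun z => by
    rw [mdot_comm (hs x), mdot, dotProduct_comm]
  rw [eL, mdot_comm (hs x) (v₁ x), mdot_comm (hs x) (v₂ x), mdot_mgrad _ _ (hs x) hd,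
    mdot_mgrad _ _ (hs x) hd, grad_dotProduct, grad_dotProduct, key v₂ h₂, key v₁ h₁, e3,
    VectorField.lieBracketWithin, dotProduct_sub]
  simp only [dotProduct, lin, Fin.sum_univ_three, curl, cross_apply, Matrix.cons_val_zero,
    Matrix.cons_val_one, Matrix.cons_val]
  ring

/-! ### The generalized Grad-Shafranov equation -/

/-- `R² = u ·̄ u`, where `u` is the infinitesimal generator of `Φ`. -/
def radiusSq (Q : Set R3) (Φ : ℝ → R3 → R3) (x : R3) : ℝ :=
  mdot (avgMetric Q Φ x) (generator Φ x) (generator Φ x)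

/-- `ψ` is a smooth stream function on `Q` for `B` with respect to `u`: `u × B = ∇ψ`. -/
def IsStreamFunction (Q : Set R3) (u B : R3 → R3) (ψ : R3 → ℝ) : Prop :=
  ContDiffOn ℝ ∞ ψ Q ∧ ∀ x ∈ Q, u x ⨯₃ B x = grad Q ψ x

/-- The field `f u / R² + ρ (∇̄ψ ×̄ u) / R²` at `x`, where `f` is a scalar field and the metric
is the averaged one. -/
def streamField (Q : Set R3) (Φ : ℝ → R3 → R3) (f ψ : R3 → ℝ) (x : R3) : R3 :=
  (f x / radiusSq Q Φ x) • generator Φ x +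
    (density (avgMetric Q Φ x) / radiusSq Q Φ x) •
      mcross (avgMetric Q Φ x) (mgrad Q (avgMetric Q Φ) ψ x) (generator Φ x)

/-- The generalized Grad-Shafranov equation
`-∇̄ ·̄ (R⁻² ρ ∇̄ψ) + C(ψ) (u/R²) ·̄ ∇̄ ×̄ (u/R²) = (P'(ψ) + R⁻² C(ψ) C'(ψ)) / ρ` on `Q`. -/
def SolvesGGS (Q : Set R3) (Φ : ℝ → R3 → R3) (C P : ℝ → ℝ) (ψ : R3 → ℝ) : Prop :=
  ∀ x ∈ Q,
    - mdiv Q (avgMetric Q Φ)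
        (fun y => ((radiusSq Q Φ y)⁻¹ * density (avgMetric Q Φ y)) •
          mgrad Q (avgMetric Q Φ) ψ y) x
      + C (ψ x) * mdot (avgMetric Q Φ x) ((radiusSq Q Φ x)⁻¹ • generator Φ x)
          (mcurl Q (avgMetric Q Φ) (fun y => (radiusSq Q Φ y)⁻¹ • generator Φ y) x)
    = (deriv P (ψ x) + (radiusSq Q Φ x)⁻¹ * C (ψ x) * deriv C (ψ x))
        / density (avgMetric Q Φ x)

end MHD

end

/-! Invariance under the action carries the proof. A field commuting with `u` is mapped to itself by
every `Φ_θ` (`map_eq_of_bracket`), and preservation of volume forces `det DΦ_θ = 1` (`det_eq_one`),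
hence `∇ · u = 0`. Therefore `∇ × (u × B) = -[u, B] = 0`. On a solid torus a closed one-form is
exact as soon as its circulation along one longitude vanishes (`exists_primitive`). On `∂Q` both `u`
and `B` are tangent, so `u × B` is normal there: a boundary longitude has zero circulation, and `ψ`
is constant on `∂Q`. The formula for `B` is the double cross product identity for `(u × B) × (ḡ u)`.

Since `B` is invariant, the one-form `ḡ B` is the mean of the pullbacks by `Φ_θ` of the Euclidean
dual of `B`. The exterior derivative of each pullback is the pulled back flux form of `J`, which is
invariant; so `∇ × (ḡ B) = J` (`curl_avgMetric_mulVec`), and Cartan's formula gives `∇(u ·̄ B) = u ×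
J` (`grad_mdot_generator`). As `J × B = ∇p` and `u · ∇p = 0`, this gradient is orthogonal to `u` and
to `B`, hence parallel to `∇ψ = u × B`; the same holds for `∇p`.

The hard step is to pass from a gradient parallel to `∇ψ` to a smooth function of `ψ`
(`exists_level_function`). Connectedness of the level sets is never proved. If `f y < m < f x` on a
common level `t`, the form `(f - m) b(ψ) dψ`, with `b` a bump at `t`, is closed and vanishes on the
boundary, so it has a primitive. That primitive has one value below the level and one above it, yet
it increases across the level near `x` and decreases near `y`, a contradiction
(`not_lt_of_value_eq`). Smoothness at the two extreme values of `ψ` is tested on curves through the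
axis and touching the boundary, where `ψ = const + s² k(s)`. Both signs of `s` give the same levels,
which forces all derivatives of the profile to have limits at the end value; Borel's lemma then
extends it to the line.

Where `∇ψ ≠ 0`, the relations for `u × J` and `J × B` give `J = P'(ψ) u + C'(ψ) B`, and density
gives this on `Q`. The Grad-Shafranov equation is the pairing of `∇ × (ḡ B) = J` with `ḡ u / R²`,
divided by `ρ` (`dotProduct_curl_eq`, `solvesGGS`). -/

namespace MHD

open Filter Topology

/-! ### Calculus on the solid torus through its universal cover -/

/-- The universal cover `D² × ℝ` of the solid torus. -/
abbrev solidCyl : Set (ℂ × ℝ) := Metric.closedBall (0 : ℂ) 1 ×ˢ (univ : Set ℝ)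

/-- `F` is a smooth parametrization of `Q` by `D² × ℝ`, periodic in the second variable. -/
structure IsChart (Q : Set R3) (F : ℂ × ℝ → R3) : Prop where
  smooth : ContDiffOn ℝ ∞ F solidCyl
  eq_iff : ∀ z ∈ Metric.closedBall (0 : ℂ) 1, ∀ s : ℝ, ∀ z' ∈ Metric.closedBall (0 : ℂ) 1,
    ∀ s' : ℝ, F (z, s) = F (z', s') ↔ z = z' ∧ ∃ k : ℤ, s' = s + k * (2 * Real.pi)
  immersive : ∀ q ∈ solidCyl, Function.Injective (fderivWithin ℝ F solidCyl q)
  image_eq : F '' solidCyl = Q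

theorem IsSolidTorus.exists_chart {Q : Set R3} (hQ : IsSolidTorus Q) : ∃ F, IsChart Q F :=
  let ⟨F, h1, h2, h3, h4⟩ := hQ
  ⟨F, h1, h2, h3, h4⟩

theorem convex_solidCyl : Convex ℝ solidCyl := (convex_closedBall _ _).prod convex_univ

theorem interior_solidCyl : interior solidCyl = Metric.ball (0 : ℂ) 1 ×ˢ univ := by
  rw [interior_prod_eq, interior_closedBall _ one_ne_zero, interior_univ]

theorem interior_solidCyl_nonempty : (interior solidCyl).Nonempty := by
  rw [interior_solidCyl]
  exact ⟨(0, 0), by simp⟩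

theorem uniqueDiffOn_solidCyl : UniqueDiffOn ℝ solidCyl :=
  uniqueDiffOn_convex convex_solidCyl interior_solidCyl_nonempty

theorem solidCyl_subset_closure_interior : solidCyl ⊆ closure (interior solidCyl) := by
  rw [convex_solidCyl.closure_interior_eq_closure_of_nonempty_interior interior_solidCyl_nonempty]
  exact subset_closure

namespace IsChart

variable {Q : Set R3} {F : ℂ × ℝ → R3}

theorem mem (hF : IsChart Q F) {q : ℂ × ℝ} (hq : q ∈ solidCyl) : F q ∈ Q :=
  hF.image_eq ▸ mem_image_of_mem F hq

theorem mapsTo (hF : IsChart Q F) : MapsTo F solidCyl Q := fun _ => hF.mem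

theorem exists_eq (hF : IsChart Q F) {x : R3} (hx : x ∈ Q) : ∃ q ∈ solidCyl, F q = x := by
  rw [← hF.image_eq] at hx
  exact hx

theorem continuousOn (hF : IsChart Q F) : ContinuousOn F solidCyl := hF.smooth.continuousOn

theorem differentiableOn (hF : IsChart Q F) : DifferentiableOn ℝ F solidCyl :=
  hF.smooth.differentiableOn (by simp)

theorem exists_mem_Icc (hF : IsChart Q F) (s₀ : ℝ) {x : R3} (hx : x ∈ Q) :
    ∃ q ∈ Metric.closedBall (0 : ℂ) 1 ×ˢ Icc (s₀ - Real.pi) (s₀ + Real.pi), F q = x := by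
  obtain ⟨⟨z, s⟩, hq, rfl⟩ := hF.exists_eq hx
  obtain ⟨k, hk, -⟩ := existsUnique_add_zsmul_mem_Ico Real.two_pi_pos s (s₀ - Real.pi)
  rw [zsmul_eq_mul] at hk
  refine ⟨(z, s + k * (2 * Real.pi)), ⟨hq.1, hk.1, ?_⟩, ?_⟩
  · have := hk.2.le; dsimp; linarith
  · exact ((hF.eq_iff z hq.1 s z hq.1 _).2 ⟨rfl, k, rfl⟩).symm

theorem isCompact (hF : IsChart Q F) : IsCompact Q := by
  have : Q = F '' (Metric.closedBall (0 : ℂ) 1 ×ˢ Icc (0 - Real.pi) (0 + Real.pi)) := by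
    ext x
    constructor
    · intro hx
      obtain ⟨q, hq, rfl⟩ := hF.exists_mem_Icc 0 hx
      exact mem_image_of_mem F hq
    · rintro ⟨q, hq, rfl⟩
      exact hF.mem ⟨hq.1, mem_univ _⟩
  rw [this]
  exact ((isCompact_closedBall _ _).prod isCompact_Icc).image_of_continuousOn
    (hF.continuousOn.mono (prod_mono subset_rfl (subset_univ _)))

theorem nonempty (hF : IsChart Q F) : Q.Nonempty :=
  ⟨F (0, 0), hF.mem (by simp)⟩

theorem isPreconnected (hF : IsChart Q F) : IsPreconnected Q := by
  rw [← hF.image_eq]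
  exact convex_solidCyl.isPreconnected.image F hF.continuousOn

/-- The chart is open onto `Q`. Every point of `Q` has a preimage in the compact window of one
period centred at the height of `q`; the part of the window outside a neighbourhood of `q` has
compact image, and this image misses `F q`. -/
theorem nhdsWithin_le_map (hF : IsChart Q F) {q : ℂ × ℝ} (hq : q ∈ solidCyl) :
    𝓝[Q] (F q) ≤ map F (𝓝[solidCyl] q) := by
  intro S hS
  rw [mem_map, mem_nhdsWithin] at hS
  obtain ⟨U, hU, hqU, hUS⟩ := hS
  set T : Set (ℂ × ℝ) := Metric.closedBall (0 : ℂ) 1 ×ˢ Icc (q.2 - Real.pi) (q.2 + Real.pi)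
  have hTK : T ⊆ solidCyl := prod_mono subset_rfl (subset_univ _)
  have hT : IsCompact (F '' (T \ U)) :=
    (((isCompact_closedBall _ _).prod isCompact_Icc).diff hU).image_of_continuousOn
      (hF.continuousOn.mono (sdiff_subset.trans hTK))
  have hx : F q ∉ F '' (T \ U) := by
    rintro ⟨⟨z, s⟩, ⟨hT, hnU⟩, he⟩
    obtain ⟨hz, k, hk⟩ := (hF.eq_iff z hT.1 s q.1 hq.1 q.2).1 he
    have hs := hT.2
    simp only [mem_Icc] at hs
    -- Heights in the window are within `π` of the centre, less than one period, so `k` must be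
    -- zero.
    have h1 : |(k : ℝ)| < 1 := by
      rw [abs_lt]
      constructor <;> nlinarith [Real.pi_pos, hs.1, hs.2]
    have : k = 0 := by
      rw [← Int.abs_lt_one_iff]
      exact_mod_cast h1
    subst this
    apply hnU
    convert hqU using 1
    ext1
    · exact hz
    · simp [hk]
  filter_upwards [self_mem_nhdsWithin, nhdsWithin_le_nhds (hT.isClosed.isOpen_compl.mem_nhds hx)]
    with x hxQ hxT
  obtain ⟨q', hq', rfl⟩ := hF.exists_mem_Icc q.2 hxQ
  refine hUS ⟨?_, hTK hq'⟩
  by_contra hcon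
  exact hxT ⟨q', ⟨hq', hcon⟩, rfl⟩

theorem exists_equiv (hF : IsChart Q F) {q : ℂ × ℝ} (hq : q ∈ solidCyl) :
    ∃ L : (ℂ × ℝ) ≃L[ℝ] R3, (L : ℂ × ℝ →L[ℝ] R3) = fderivWithin ℝ F solidCyl q := by
  have hdim : Module.finrank ℝ (ℂ × ℝ) = Module.finrank ℝ R3 := by
    simp [Complex.finrank_real_complex]
  refine ⟨(LinearMap.linearEquivOfInjective (fderivWithin ℝ F solidCyl q).toLinearMap
    (hF.immersive q hq) hdim).toContinuousLinearEquiv, ?_⟩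
  ext v <;> rfl

theorem hasFDerivWithinAt (hF : IsChart Q F) {q : ℂ × ℝ} (hq : q ∈ solidCyl) :
    HasFDerivWithinAt F (fderivWithin ℝ F solidCyl q) solidCyl q :=
  (hF.differentiableOn q hq).hasFDerivWithinAt

variable {V : Type*} [NormedAddCommGroup V] [NormedSpace ℝ V]

/-- Differentiability on `Q` may be checked in the chart. -/
theorem hasFDerivWithinAt_of_comp (hF : IsChart Q F) {q : ℂ × ℝ} (hq : q ∈ solidCyl)
    {G : R3 → V} {A : ℂ × ℝ →L[ℝ] V} (hG : HasFDerivWithinAt (fun q => G (F q)) A solidCyl q)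
    {A' : R3 →L[ℝ] V} (hA : A = A' ∘L fderivWithin ℝ F solidCyl q) :
    HasFDerivWithinAt G A' Q (F q) := by
  obtain ⟨L, hL⟩ := hF.exists_equiv hq
  have hd := hF.hasFDerivWithinAt hq
  rw [← hL] at hd hA
  rw [hasFDerivWithinAt_iff_isLittleO] at hd hG ⊢
  refine Asymptotics.IsLittleO.mono ?_ (hF.nhdsWithin_le_map hq)
  rw [Asymptotics.isLittleO_map]
  have hO : (fun p => p - q) =O[𝓝[solidCyl] q] fun p => F p - F q := by
    have h1 : (fun p => p - q) =O[𝓝[solidCyl] q] fun p => L (p - q) := L.isBigO_sub_rev _ _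
    have h2 : (fun p => L (p - q)) =O[𝓝[solidCyl] q] fun p => F p - F q := by
      have h3 := hd.trans_isBigO h1
      have := h3.right_isBigO_add
      simpa using this
    exact h1.trans h2
  have h1 := hG.trans_isBigO hO
  have h2 := (A'.isBigO_comp _ _).trans_isLittleO (hd.trans_isBigO hO)
  refine (h1.sub h2).congr_left fun p => ?_
  simp [hA]

theorem uniqueDiffOn (hF : IsChart Q F) : UniqueDiffOn ℝ Q := by
  intro x hx
  obtain ⟨q, hq, rfl⟩ := hF.exists_eq hx
  obtain ⟨L, hL⟩ := hF.exists_equiv hq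
  rw [← hF.image_eq]
  refine (hF.hasFDerivWithinAt hq).uniqueDiffWithinAt (uniqueDiffOn_solidCyl q hq) ?_
  rw [← hL]
  exact L.surjective.denseRange

/-- Bootstrapping on `DG = D(G ∘ F) ∘ (DF)⁻¹` read in the chart. The target space is quantified
inside the induction because the step passes from `V` to `R3 →L[ℝ] V`. -/
theorem contDiffOn_nat_of_comp (hF : IsChart Q F) (n : ℕ) :
    ∀ {V : Type*} [NormedAddCommGroup V] [NormedSpace ℝ V] {G : R3 → V},
      ContDiffOn ℝ n (fun q => G (F q)) solidCyl → ContDiffOn ℝ n G Q := by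
  induction n with
  | zero =>
    intro V _ _ G hG
    rw [Nat.cast_zero, contDiffOn_zero] at hG ⊢
    intro x hx
    obtain ⟨q, hq, rfl⟩ := hF.exists_eq hx
    exact Tendsto.mono_left (tendsto_map'_iff.2 (hG q hq)) (hF.nhdsWithin_le_map hq)
  | succ n ih =>
    intro V _ _ G hG
    rw [Nat.cast_add, Nat.cast_one, contDiffOn_succ_iff_fderivWithin uniqueDiffOn_solidCyl] at hG
    rw [Nat.cast_add, Nat.cast_one, contDiffOn_succ_iff_fderivWithin hF.uniqueDiffOn]
    have key : ∀ q ∈ solidCyl, HasFDerivWithinAt G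
        ((fderivWithin ℝ (fun q => G (F q)) solidCyl q) ∘L
          (fderivWithin ℝ F solidCyl q).inverse) Q (F q) := by
      intro q hq
      refine hF.hasFDerivWithinAt_of_comp hq (hG.1 q hq).hasFDerivWithinAt ?_
      obtain ⟨L, hL⟩ := hF.exists_equiv hq
      rw [← hL, ContinuousLinearMap.inverse_equiv]
      ext v <;> simp
    refine ⟨fun x hx => ?_, by simp, ih ?_⟩
    · obtain ⟨q, hq, rfl⟩ := hF.exists_eq hx
      exact (key q hq).differentiableWithinAt
    · have h1 : ContDiffOn ℝ n (fun q => (fderivWithin ℝ F solidCyl q).inverse) solidCyl := by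
        intro q hq
        obtain ⟨L, hL⟩ := hF.exists_equiv hq
        refine ContDiffAt.comp_contDiffWithinAt q (g := ContinuousLinearMap.inverse) ?_ ?_
        · rw [← hL]; exact contDiffAt_map_inverse L
        · exact (hF.smooth.fderivWithin uniqueDiffOn_solidCyl (m := n) (by
            exact_mod_cast le_top)) q hq
      refine (hG.2.2.clm_comp h1).congr fun q hq => ?_
      exact (key q hq).fderivWithin (hF.uniqueDiffOn _ (hF.mem hq))

theorem contDiffOn_of_comp (hF : IsChart Q F) {G : R3 → V}
    (hG : ContDiffOn ℝ ∞ (fun q => G (F q)) solidCyl) : ContDiffOn ℝ ∞ G Q :=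
  contDiffOn_infty.2 fun n => hF.contDiffOn_nat_of_comp n (contDiffOn_infty.1 hG n)

end IsChart

namespace IsChart

variable {Q : Set R3} {F : ℂ × ℝ → R3}

theorem mem_interior (hF : IsChart Q F) {q : ℂ × ℝ} (hq : q ∈ interior solidCyl) :
    F q ∈ interior Q := by
  have hqn : solidCyl ∈ 𝓝 q := mem_interior_iff_mem_nhds.1 hq
  have hqK := interior_subset hq
  obtain ⟨L, hL⟩ := hF.exists_equiv hqK
  have h1 : ContDiffAt ℝ ∞ F q := hF.smooth.contDiffAt hqn
  have h2 : HasStrictFDerivAt F (L : ℂ × ℝ →L[ℝ] R3) q := by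
    rw [hL, fderivWithin_of_mem_nhds hqn]
    exact h1.hasStrictFDerivAt (by simp)
  rw [mem_interior_iff_mem_nhds, ← h2.map_nhds_eq_of_equiv]
  filter_upwards [image_mem_map hqn] with x hx
  rw [← hF.image_eq]
  exact hx

theorem subset_closure_interior (hF : IsChart Q F) : Q ⊆ closure (interior Q) := by
  intro x hx
  obtain ⟨q, hq, rfl⟩ := hF.exists_eq hx
  have h1 : q ∈ closure (interior solidCyl) := solidCyl_subset_closure_interior hq
  have h2 : ContinuousWithinAt F (interior solidCyl) q :=
    (hF.continuousOn q hq).mono interior_subset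
  exact h2.mem_closure h1 fun p hp => hF.mem_interior hp

/-- A smooth function on `Q` which equals `1` exactly on the boundary, and has no critical point
there. -/
theorem exists_definingFunction (hF : IsChart Q F) :
    ∃ G : R3 → ℝ, ContDiffOn ℝ ∞ G Q ∧ (∀ q ∈ solidCyl, G (F q) = ‖q.1‖ ^ 2) ∧
      ∀ q ∈ solidCyl, ‖q.1‖ = 1 → fderivWithin ℝ G Q (F q) ≠ 0 := by
  classical
  choose! σ hσ using fun x (hx : x ∈ Q) => hF.exists_eq hx
  have hG : ∀ q ∈ solidCyl, ‖(σ (F q)).1‖ ^ 2 = ‖q.1‖ ^ 2 := by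
    intro q hq
    obtain ⟨h1, h2⟩ := hσ (F q) (hF.mem hq)
    rw [((hF.eq_iff _ h1.1 (σ (F q)).2 _ hq.1 q.2).1 h2).1]
  have hs : ContDiff ℝ ∞ (fun q : ℂ × ℝ => ‖q.1‖ ^ 2) := contDiff_fst.norm_sq ℝ
  refine ⟨fun x => ‖(σ x).1‖ ^ 2, ?_, hG, ?_⟩
  · exact hF.contDiffOn_of_comp (hs.contDiffOn.congr hG)
  · intro q hq hq1 h0
    have hsm : ContDiffOn ℝ ∞ (fun x => ‖(σ x).1‖ ^ 2) Q :=
      hF.contDiffOn_of_comp (hs.contDiffOn.congr hG)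
    have h1 : HasFDerivWithinAt (fun x => ‖(σ x).1‖ ^ 2) (0 : R3 →L[ℝ] ℝ) Q (F q) := by
      rw [← h0]
      exact (hsm.differentiableOn (by simp) _ (hF.mem hq)).hasFDerivWithinAt
    have h2 : HasFDerivWithinAt (fun p : ℂ × ℝ => ‖p.1‖ ^ 2) (0 : ℂ × ℝ →L[ℝ] ℝ) solidCyl q := by
      have := h1.comp q (hF.hasFDerivWithinAt hq) hF.mapsTo
      rw [ContinuousLinearMap.zero_comp] at this
      exact this.congr (fun p hp => (hG p hp).symm) (hG q hq).symm
    have h4 : fderiv ℝ (fun p : ℂ × ℝ => ‖p.1‖ ^ 2) q = 0 :=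
      ((uniqueDiffOn_solidCyl q hq).eq h2
        ((hs.differentiable (by simp)) q).hasFDerivAt.hasFDerivWithinAt).symm
    -- Radial test: along `q + t (q.1, 0)` the function is `(1 + t)²`, whose derivative at `0` is
    -- `2`, not `0`.
    have h5 : HasDerivAt (fun t : ℝ => ‖(q + t • ((q.1, 0) : ℂ × ℝ)).1‖ ^ 2) 0 0 := by
      have e1 : HasDerivAt (fun t : ℝ => q + t • ((q.1, 0) : ℂ × ℝ)) ((q.1, 0) : ℂ × ℝ) 0 := by
        simpa using ((hasDerivAt_id (0 : ℝ)).smul_const ((q.1, 0) : ℂ × ℝ)).const_add q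
      have e2 : HasFDerivAt (fun p : ℂ × ℝ => ‖p.1‖ ^ 2) (0 : ℂ × ℝ →L[ℝ] ℝ)
          (q + (0 : ℝ) • ((q.1, 0) : ℂ × ℝ)) := by
        rw [zero_smul, add_zero, ← h4]
        exact ((hs.differentiable (by simp)) q).hasFDerivAt
      exact e2.comp_hasDerivAt (0 : ℝ) e1
    have e3 : (fun t : ℝ => ‖(q + t • ((q.1, 0) : ℂ × ℝ)).1‖ ^ 2) = fun t : ℝ => (1 + t) ^ 2 := by
      funext t
      have : (q + t • ((q.1, 0) : ℂ × ℝ)).1 = (1 + t) • q.1 := by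
        simp [add_smul]
      rw [this, norm_smul, hq1, mul_one, Real.norm_eq_abs, sq_abs]
    rw [e3] at h5
    have h6 : HasDerivAt (fun t : ℝ => (1 + t) ^ 2) (2 * (1 + 0) ^ 1 * 1) 0 := by
      simpa using ((hasDerivAt_id' (0 : ℝ)).const_add 1).fun_pow 2
    have := h5.unique h6
    norm_num at this

theorem mem_frontier_iff (hF : IsChart Q F) {q : ℂ × ℝ} (hq : q ∈ solidCyl) :
    F q ∈ frontier Q ↔ ‖q.1‖ = 1 := by
  have hcl : IsClosed Q := hF.isCompact.isClosed
  rw [hcl.frontier_eq]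
  have hle : ‖q.1‖ ≤ 1 := by simpa using hq.1
  constructor
  · intro h
    by_contra hne
    refine h.2 (hF.mem_interior ?_)
    rw [interior_solidCyl]
    exact ⟨by simpa using lt_of_le_of_ne hle hne, mem_univ _⟩
  · intro h
    refine ⟨hF.mem hq, fun hint => ?_⟩
    obtain ⟨G, hGs, hG, hG'⟩ := hF.exists_definingFunction
    apply hG' q hq h
    have hn : Q ∈ 𝓝 (F q) := mem_interior_iff_mem_nhds.1 hint
    rw [fderivWithin_of_mem_nhds hn]
    -- If the point were interior to `Q`, the defining function `‖z‖² ≤ 1` would have a local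
    -- maximum there.
    apply IsLocalMax.fderiv_eq_zero
    filter_upwards [hn] with x hx
    obtain ⟨p, hp, rfl⟩ := hF.exists_eq hx
    rw [hG p hp, hG q hq, h]
    have : ‖p.1‖ ≤ 1 := by simpa using hp.1
    gcongr

theorem exists_frontier_eq (hF : IsChart Q F) {x : R3} (hx : x ∈ frontier Q) :
    ∃ q ∈ solidCyl, ‖q.1‖ = 1 ∧ F q = x := by
  have hxQ : x ∈ Q := hF.isCompact.isClosed.frontier_subset hx
  obtain ⟨q, hq, rfl⟩ := hF.exists_eq hxQ
  exact ⟨q, hq, (hF.mem_frontier_iff hq).1 hx, rfl⟩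

/-- A smooth function on `Q` whose gradient is a nonvanishing normal field along the boundary. -/
theorem exists_boundary_function (hF : IsChart Q F) :
    ∃ G : R3 → ℝ, ContDiffOn ℝ ∞ G Q ∧ (∀ x ∈ frontier Q, G x = 1) ∧
      (∀ x ∈ frontier Q, grad Q G x ≠ 0) ∧
      ∀ x ∈ frontier Q, IsNormalToBoundary Q x (grad Q G x) := by
  obtain ⟨G, hGs, hG, hG'⟩ := hF.exists_definingFunction
  have h1 : ∀ x ∈ frontier Q, G x = 1 := by
    intro x hx
    obtain ⟨q, hq, hq1, rfl⟩ := hF.exists_frontier_eq hx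
    rw [hG q hq, hq1, one_pow]
  refine ⟨G, hGs, h1, ?_, ?_⟩
  · intro x hx h0
    obtain ⟨q, hq, hq1, rfl⟩ := hF.exists_frontier_eq hx
    apply hG' q hq hq1
    ext v
    rw [← grad_dotProduct, h0]
    simp
  · intro x hx t ht
    have hxQ : x ∈ Q := hF.isCompact.isClosed.frontier_subset hx
    rw [grad_dotProduct]
    have h2 : HasFDerivWithinAt G (fderivWithin ℝ G Q x) (frontier Q) x :=
      (hGs.differentiableOn (by simp) _ hxQ).hasFDerivWithinAt.mono
        hF.isCompact.isClosed.frontier_subset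
    -- `G` is constant on the boundary, so its derivative maps tangent vectors into the tangent cone
    -- of a single point, which is zero.
    have h3 := h2.mapsTo_tangent_cone ht
    have h4 : G '' frontier Q ⊆ {G x} := by
      rintro _ ⟨y, hy, rfl⟩
      rw [h1 y hy, h1 x hx, mem_singleton_iff]
    have h5 := tangentConeAt_mono h4 h3
    have h6 : ¬ AccPt (G x) (𝓟 {G x}) := by
      rw [accPt_iff_nhds]
      push Not
      exact ⟨univ, univ_mem, by simp⟩
    simpa using tangentConeAt_subset_zero h6 h5

end IsChart

/-! ### Integrals depending smoothly on a parameter in a convex set -/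

section ParametricIntegral

/-- Convexity gives the mean value inequality on `K` intersected with a ball, so the argument is
valid one-sidedly at boundary points of `K`; compactness of the interval makes the continuity of
`f'` at `q₀` uniform in `θ`. -/
theorem hasFDerivWithinAt_intervalIntegral_of_convex {E V : Type*} [NormedAddCommGroup E]
    [NormedSpace ℝ E] [NormedAddCommGroup V] [NormedSpace ℝ V] [CompleteSpace V] {K : Set E}
    (hK : Convex ℝ K) (a b : ℝ) {f : ℝ → E → V} {f' : ℝ → E → E →L[ℝ] V}
    (hf : ContinuousOn (Function.uncurry f) (univ ×ˢ K))
    (hf' : ContinuousOn (Function.uncurry f') (univ ×ˢ K))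
    (hd : ∀ θ, ∀ q ∈ K, HasFDerivWithinAt (f θ) (f' θ q) K q) {q₀ : E} (hq₀ : q₀ ∈ K) :
    HasFDerivWithinAt (fun q => ∫ θ in a..b, f θ q) (∫ θ in a..b, f' θ q₀) K q₀ := by
  have hslice : ∀ q ∈ K, Continuous fun θ => f θ q := fun q hq =>
    hf.comp_continuous (f := fun θ => (θ, q)) (by fun_prop) fun θ => ⟨mem_univ _, hq⟩
  have hslice' : ∀ q ∈ K, Continuous fun θ => f' θ q := fun q hq =>
    hf'.comp_continuous (f := fun θ => (θ, q)) (by fun_prop) fun θ => ⟨mem_univ _, hq⟩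
  rw [hasFDerivWithinAt_iff_isLittleO, Asymptotics.isLittleO_iff]
  intro ε hε
  set ε' := ε / (|b - a| + 1)
  have hε' : 0 < ε' := by positivity
  have hunif : ∀ᶠ q in 𝓝 q₀, ∀ θ ∈ uIcc a b, q ∈ K → ‖f' θ q - f' θ q₀‖ ≤ ε' := by
    refine isCompact_uIcc.eventually_forall_of_forall_eventually
      (P := fun q θ => q ∈ K → ‖f' θ q - f' θ q₀‖ ≤ ε') fun θ _ => ?_
    have h1 : ContinuousWithinAt (fun z : E × ℝ => f' z.2 z.1 - f' z.2 q₀) (K ×ˢ univ) (q₀, θ) := by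
      refine ContinuousWithinAt.sub ?_ ?_
      · exact (hf' (θ, q₀) ⟨mem_univ _, hq₀⟩).comp (f := fun z : E × ℝ => (z.2, z.1))
          (t := univ ×ˢ K) (x := (q₀, θ)) (by fun_prop) fun z hz => ⟨mem_univ _, hz.1⟩
      · exact ((hslice' q₀ hq₀).comp continuous_snd).continuousWithinAt
    have h2 := h1.norm
    have h3 : ∀ᶠ z in 𝓝[K ×ˢ univ] (q₀, θ), ‖f' z.2 z.1 - f' z.2 q₀‖ < ε' := by
      apply h2.eventually_lt continuousWithinAt_const
      simpa using hε'
    rw [eventually_nhdsWithin_iff] at h3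
    filter_upwards [h3] with z hz hzK
    exact (hz ⟨hzK, mem_univ _⟩).le
  obtain ⟨δ, hδ, hball⟩ := Metric.eventually_nhds_iff_ball.1 hunif
  filter_upwards [self_mem_nhdsWithin, nhdsWithin_le_nhds (Metric.ball_mem_nhds q₀ hδ)] with q hq hqb
  have hmv : ∀ θ ∈ uIcc a b, ‖f θ q - f θ q₀ - f' θ q₀ (q - q₀)‖ ≤ ε' * ‖q - q₀‖ := by
    intro θ hθ
    refine Convex.norm_image_sub_le_of_norm_hasFDerivWithin_le' (s := K ∩ Metric.ball q₀ δ)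
      (f' := f' θ) (fun x hx => (hd θ x hx.1).mono inter_subset_left)
      (fun x hx => hball x hx.2 θ hθ hx.1) (hK.inter (convex_ball _ _))
      ⟨hq₀, Metric.mem_ball_self hδ⟩ ⟨hq, hqb⟩
  have hint : ∀ q ∈ K, IntervalIntegrable (fun θ => f θ q) volume a b := fun q hq =>
    (hslice q hq).intervalIntegrable _ _
  have hint' : IntervalIntegrable (fun θ => f' θ q₀) volume a b :=
    (hslice' q₀ hq₀).intervalIntegrable _ _
  have hint'' : IntervalIntegrable (fun θ => f' θ q₀ (q - q₀)) volume a b :=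
    ((hslice' q₀ hq₀).clm_apply continuous_const).intervalIntegrable _ _
  rw [ContinuousLinearMap.intervalIntegral_apply hint',
    ← intervalIntegral.integral_sub (hint q hq) (hint q₀ hq₀),
    ← intervalIntegral.integral_sub ((hint q hq).sub (hint q₀ hq₀)) hint'']
  refine (intervalIntegral.norm_integral_le_of_norm_le_const fun θ hθ =>
    hmv θ (uIoc_subset_uIcc hθ)).trans ?_
  have : ε' * |b - a| ≤ ε := by
    rw [div_mul_eq_mul_div, div_le_iff₀ (by positivity)]
    nlinarith [abs_nonneg (b - a)]
  nlinarith [norm_nonneg (q - q₀)]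

-- Differentiation under the integral sign, iterated. `E` and `V` share a universe because the
-- induction replaces `V` by `E →L[ℝ] V`.
universe v in
theorem contDiffOn_nat_intervalIntegral_of_convex {E : Type v} [NormedAddCommGroup E]
    [NormedSpace ℝ E] {K : Set E} (hK : Convex ℝ K) (hKu : UniqueDiffOn ℝ K) (a b : ℝ) (n : ℕ) :
    ∀ {V : Type v} [NormedAddCommGroup V] [NormedSpace ℝ V] [CompleteSpace V] {f : ℝ → E → V},
      ContDiffOn ℝ n (Function.uncurry f) (univ ×ˢ K) →
        ContDiffOn ℝ n (fun q => ∫ θ in a..b, f θ q) K := by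
  have hU : UniqueDiffOn ℝ ((univ : Set ℝ) ×ˢ K) := uniqueDiffOn_univ.prod hKu
  induction n with
  | zero =>
    intro V _ _ _ f hf
    rw [Nat.cast_zero, contDiffOn_zero] at hf ⊢
    rw [continuousOn_iff_continuous_domRestrict]
    refine intervalIntegral.continuous_parametric_intervalIntegral_of_continuous'
      (f := fun (q : K) θ => f θ q) ?_ a b
    exact hf.comp_continuous (f := fun z : K × ℝ => (z.2, (z.1 : E))) (by fun_prop)
      fun z => ⟨mem_univ _, z.1.2⟩
  | succ n ih =>
    intro V _ _ _ f hf
    have hf0 := hf.continuousOn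
    rw [Nat.cast_add, Nat.cast_one, contDiffOn_succ_iff_fderivWithin hU] at hf
    rw [Nat.cast_add, Nat.cast_one, contDiffOn_succ_iff_fderivWithin hKu]
    set f' : ℝ → E → E →L[ℝ] V := fun θ q =>
      (fderivWithin ℝ (Function.uncurry f) (univ ×ˢ K) (θ, q)) ∘L ContinuousLinearMap.inr ℝ ℝ E
    have hf' : ContDiffOn ℝ n (Function.uncurry f') (univ ×ˢ K) :=
      hf.2.2.clm_comp contDiffOn_const
    have key : ∀ q ∈ K, HasFDerivWithinAt (fun q => ∫ θ in a..b, f θ q)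
        (∫ θ in a..b, f' θ q) K q := by
      intro q hq
      refine hasFDerivWithinAt_intervalIntegral_of_convex hK a b hf0
        hf'.continuousOn (fun θ p hp => ?_) hq
      exact (hf.1 (θ, p) ⟨mem_univ _, hp⟩).hasFDerivWithinAt.comp p
        (hasFDerivAt_prodMk_right θ p).hasFDerivWithinAt fun x hx => ⟨mem_univ _, hx⟩
    refine ⟨fun q hq => (key q hq).differentiableWithinAt, by simp, ?_⟩
    exact (ih hf').congr fun q hq => (key q hq).fderivWithin (hKu q hq)

universe v in
theorem contDiffOn_intervalIntegral_of_convex {E V : Type v} [NormedAddCommGroup E]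
    [NormedSpace ℝ E] [NormedAddCommGroup V] [NormedSpace ℝ V] [CompleteSpace V] {K : Set E}
    (hK : Convex ℝ K) (hKu : UniqueDiffOn ℝ K) (a b : ℝ) {f : ℝ → E → V}
    (hf : ContDiffOn ℝ ∞ (Function.uncurry f) (univ ×ˢ K)) :
    ContDiffOn ℝ ∞ (fun q => ∫ θ in a..b, f θ q) K :=
  contDiffOn_infty.2 fun n => contDiffOn_nat_intervalIntegral_of_convex hK hKu a b n
    (contDiffOn_infty.1 hf n)

end ParametricIntegral

/-! ### Averages and primitives of closed one-forms on the solid torus -/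

namespace IsChart

variable {Q : Set R3} {F : ℂ × ℝ → R3} {V : Type} [NormedAddCommGroup V] [NormedSpace ℝ V]

theorem contDiffOn_intervalIntegral [CompleteSpace V] (hF : IsChart Q F) (a b : ℝ)
    {f : ℝ → R3 → V} (hf : ContDiffOn ℝ ∞ (Function.uncurry f) (univ ×ˢ Q)) :
    ContDiffOn ℝ ∞ (fun x => ∫ θ in a..b, f θ x) Q := by
  refine hF.contDiffOn_of_comp (contDiffOn_intervalIntegral_of_convex convex_solidCyl
    uniqueDiffOn_solidCyl a b (f := fun θ q => f θ (F q)) ?_)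
  refine hf.comp (f := fun z : ℝ × (ℂ × ℝ) => (z.1, F z.2)) ?_ fun z hz => ⟨hz.1, hF.mem hz.2⟩
  exact contDiffOn_fst.prodMk (hF.smooth.comp contDiffOn_snd fun z hz => hz.2)

theorem hasFDerivWithinAt_intervalIntegral [CompleteSpace V] (hF : IsChart Q F) (a b : ℝ)
    {f : ℝ → R3 → V} {f' : ℝ → R3 → R3 →L[ℝ] V}
    (hf : ContinuousOn (Function.uncurry f) (univ ×ˢ Q))
    (hf' : ContinuousOn (Function.uncurry f') (univ ×ˢ Q))
    (hd : ∀ θ, ∀ x ∈ Q, HasFDerivWithinAt (f θ) (f' θ x) Q x) {x : R3} (hx : x ∈ Q) :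
    HasFDerivWithinAt (fun x => ∫ θ in a..b, f θ x) (∫ θ in a..b, f' θ x) Q x := by
  obtain ⟨q, hq, rfl⟩ := hF.exists_eq hx
  have hc : ContinuousOn (fun z : ℝ × (ℂ × ℝ) => (z.1, F z.2)) (univ ×ˢ solidCyl) :=
    continuousOn_fst.prodMk (hF.continuousOn.comp continuousOn_snd fun z hz => hz.2)
  have hm : MapsTo (fun z : ℝ × (ℂ × ℝ) => (z.1, F z.2)) (univ ×ˢ solidCyl) (univ ×ˢ Q) :=
    fun z hz => ⟨hz.1, hF.mem hz.2⟩
  have hDF : ContinuousOn (fun q => fderivWithin ℝ F solidCyl q) solidCyl :=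
    hF.smooth.continuousOn_fderivWithin uniqueDiffOn_solidCyl (by simp)
  have h1 : HasFDerivWithinAt (fun q => ∫ θ in a..b, f θ (F q))
      (∫ θ in a..b, (f' θ (F q)) ∘L fderivWithin ℝ F solidCyl q) solidCyl q := by
    refine hasFDerivWithinAt_intervalIntegral_of_convex convex_solidCyl a b
      (f := fun θ q => f θ (F q)) (f' := fun θ q => (f' θ (F q)) ∘L fderivWithin ℝ F solidCyl q)
      (hf.comp hc hm) ?_ (fun θ p hp => ?_) hq
    · exact (hf'.comp hc hm).clm_comp (hDF.comp continuousOn_snd fun z hz => hz.2)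
    · exact (hd θ _ (hF.mem hp)).comp p (hF.hasFDerivWithinAt hp) hF.mapsTo
  refine hF.hasFDerivWithinAt_of_comp hq h1 ?_
  have hi : IntervalIntegrable (fun θ => f' θ (F q)) volume a b :=
    (hf'.comp_continuous (f := fun θ => (θ, F q)) (by fun_prop)
      fun θ => ⟨mem_univ _, hF.mem hq⟩).intervalIntegrable _ _
  exact ((ContinuousLinearMap.compL ℝ (ℂ × ℝ) R3 V).flip
    (fderivWithin ℝ F solidCyl q)).intervalIntegral_comp_comm hi

theorem map_add_period (hF : IsChart Q F) {q : ℂ × ℝ} (hq : q ∈ solidCyl) :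
    F (q + (0, 2 * Real.pi)) = F q := by
  refine ((hF.eq_iff q.1 hq.1 q.2 (q + (0, 2 * Real.pi)).1 (by simpa using hq.1)
    (q + (0, 2 * Real.pi)).2).2 ⟨by simp, 1, by simp⟩).symm

theorem fderivWithin_add_period (hF : IsChart Q F) {q : ℂ × ℝ} (hq : q ∈ solidCyl) :
    fderivWithin ℝ F solidCyl (q + (0, 2 * Real.pi)) = fderivWithin ℝ F solidCyl q := by
  have hm : q + (0, 2 * Real.pi) ∈ solidCyl := by simpa using hq
  have h1 := (hF.hasFDerivWithinAt hm).comp q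
    ((hasFDerivAt_id (𝕜 := ℝ) q).add_const ((0, 2 * Real.pi) : ℂ × ℝ)).hasFDerivWithinAt
    (s := solidCyl) fun p hp => by simpa using hp
  refine ((uniqueDiffOn_solidCyl q hq).eq (hF.hasFDerivWithinAt hq) ?_).symm
  exact h1.congr (fun p hp => (hF.map_add_period hp).symm) (hF.map_add_period hq).symm

/-- A closed `1`-form on `Q` which vanishes along a longitude of the boundary is exact. -/
theorem exists_primitive (hF : IsChart Q F) {β : R3 → R3 →L[ℝ] ℝ} (hβ : DifferentiableOn ℝ β Q)
    (hc : ∀ x ∈ Q, ∀ v w, fderivWithin ℝ β Q x v w = fderivWithin ℝ β Q x w v)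
    (hloop : ∀ s : ℝ, β (F (1, s)) (fderivWithin ℝ F solidCyl (1, s) (0, 1)) = 0) :
    ∃ H : R3 → ℝ, ∀ x ∈ Q, HasFDerivWithinAt H (β x) Q x := by
  set η : ℂ × ℝ → ℂ × ℝ →L[ℝ] ℝ := fun q => (β (F q)) ∘L fderivWithin ℝ F solidCyl q with hη
  have hDF : ContDiffOn ℝ ∞ (fun q => fderivWithin ℝ F solidCyl q) solidCyl :=
    hF.smooth.fderivWithin uniqueDiffOn_solidCyl (by simp)
  have hd : ∀ q ∈ solidCyl, HasFDerivWithinAt η _ solidCyl q := fun q hq =>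
    ((hβ _ (hF.mem hq)).hasFDerivWithinAt.comp q (hF.hasFDerivWithinAt hq)
      hF.mapsTo).clm_comp (hDF.differentiableOn (by simp) q hq).hasFDerivWithinAt
  -- The pullback `η` is closed: its derivative is symmetric because those of `β` and of `DF` are.
  -- The cylinder is convex, so the Poincaré lemma applies.
  obtain ⟨φ, hφ⟩ := convex_solidCyl.exists_forall_hasFDerivWithinAt_of_hasFDerivWithinAt_symmetric
    hd (by
      intro q hq v _ w _
      have hs := (hF.smooth q hq).isSymmSndFDerivWithinAt (by
        rw [minSmoothness_of_isRCLikeNormedField]; exact WithTop.coe_le_coe.2 (le_top : (2 : ℕ∞) ≤ ⊤)) uniqueDiffOn_solidCyl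
        (solidCyl_subset_closure_interior hq) hq v w
      have hs' := hc _ (hF.mem hq) (fderivWithin ℝ F solidCyl q v) (fderivWithin ℝ F solidCyl q w)
      simp [hs, hs'])
  have hm : ∀ q ∈ solidCyl, q + (0, 2 * Real.pi) ∈ solidCyl := fun q hq => by simpa using hq
  have hdiff : ∀ q ∈ solidCyl, HasFDerivWithinAt (fun q => φ (q + (0, 2 * Real.pi)) - φ q)
      (0 : ℂ × ℝ →L[ℝ] ℝ) solidCyl q := by
    intro q hq
    have h1 := (hφ _ (hm q hq)).comp q
      ((hasFDerivAt_id (𝕜 := ℝ) q).add_const ((0, 2 * Real.pi) : ℂ × ℝ)).hasFDerivWithinAt hm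
    have h2 := h1.sub (hφ q hq)
    refine h2.congr_fderiv ?_
    change ((β (F (q + (0, 2 * Real.pi)))) ∘L
      fderivWithin ℝ F solidCyl (q + (0, 2 * Real.pi))) ∘L _ - (β (F q)) ∘L _ = 0
    rw [hF.map_add_period hq, hF.fderivWithin_add_period hq]
    ext v <;> simp
  -- The increment of `φ` over one turn does not depend on the base point. On the longitude `z = 1`
  -- it is zero, since the form vanishes along it; hence `φ` descends to `Q`.
  have hconst : ∀ q ∈ solidCyl, φ (q + (0, 2 * Real.pi)) - φ q =
      φ ((1, 0) + (0, 2 * Real.pi)) - φ (1, 0) := by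
    intro q hq
    refine convex_solidCyl.is_const_of_fderivWithin_eq_zero (𝕜 := ℝ)
      (f := fun q => φ (q + (0, 2 * Real.pi)) - φ q)
      (fun p hp => (hdiff p hp).differentiableWithinAt)
      (fun p hp => (hdiff p hp).fderivWithin (uniqueDiffOn_solidCyl p hp)) hq (by simp)
  have hline : ∀ s : ℝ, HasDerivAt (fun s : ℝ => φ (1, s)) 0 s := by
    intro s
    have h1 : HasDerivWithinAt (fun s : ℝ => ((1, s) : ℂ × ℝ)) (0, 1) univ s :=
      ((hasDerivAt_const s (1 : ℂ)).prodMk (hasDerivAt_id s)).hasDerivWithinAt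
    have h2 := (hφ (1, s) (by simp)).comp_hasDerivWithinAt s h1 (fun t _ => by simp)
    rw [hasDerivWithinAt_univ] at h2
    exact h2.congr_deriv (hloop s)
  have hzero : φ ((1, 0) + (0, 2 * Real.pi)) - φ (1, 0) = 0 := by
    have := is_const_of_deriv_eq_zero (fun s => (hline s).differentiableAt)
      (fun s => (hline s).deriv) (2 * Real.pi) 0
    simp [this]
  have hper : ∀ z ∈ Metric.closedBall (0 : ℂ) 1,
      Function.Periodic (fun s : ℝ => φ (z, s)) (2 * Real.pi) := by
    intro z hz s
    have h1 := hconst (z, s) ⟨hz, mem_univ _⟩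
    rw [hzero, sub_eq_zero] at h1
    simpa using h1
  choose! σ hσ using fun x (hx : x ∈ Q) => hF.exists_eq hx
  have hH : ∀ q ∈ solidCyl, φ (σ (F q)) = φ q := by
    intro q hq
    obtain ⟨h1, h2⟩ := hσ (F q) (hF.mem hq)
    obtain ⟨hz, k, hk⟩ := (hF.eq_iff _ hq.1 q.2 _ h1.1 (σ (F q)).2).1 h2.symm
    have h3 := (hper q.1 hq.1).int_mul k q.2
    rw [← hk, hz] at h3
    exact h3.trans (by rw [← hz])
  refine ⟨fun x => φ (σ x), fun x hx => ?_⟩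
  obtain ⟨q, hq, rfl⟩ := hF.exists_eq hx
  exact hF.hasFDerivWithinAt_of_comp (G := fun x => φ (σ x)) hq ((hφ q hq).congr hH (hH q hq)) rfl

end IsChart

/-! ### One variable: Hadamard, Borel, and smooth extension past an endpoint -/

section OneVariable

/-- Hadamard's lemma in one variable. -/
theorem exists_contDiff_eq_mul {h : ℝ → ℝ} (hh : ContDiff ℝ ∞ h) (h0 : h 0 = 0) :
    ∃ k : ℝ → ℝ, ContDiff ℝ ∞ k ∧ ∀ s, h s = s * k s := by
  have hd : ContDiff ℝ ∞ (deriv h) := hh.deriv' 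
  refine ⟨fun s => ∫ t in (0 : ℝ)..1, deriv h (t * s), ?_, fun s => ?_⟩
  · rw [← contDiffOn_univ]
    refine contDiffOn_intervalIntegral_of_convex convex_univ uniqueDiffOn_univ 0 1
      (f := fun t s => deriv h (t * s)) (ContDiff.contDiffOn ?_)
    exact hd.comp (contDiff_fst.mul contDiff_snd)
  · have h1 : ∀ t ∈ uIcc (0 : ℝ) 1, HasDerivAt (fun t => h (t * s)) (deriv h (t * s) * s) t := by
      intro t _
      exact ((hh.differentiable (by simp)) (t * s)).hasDerivAt.comp t
        (by simpa using (hasDerivAt_id t).mul_const s)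
    have h2 := intervalIntegral.integral_eq_sub_of_hasDerivAt h1
      (Continuous.intervalIntegrable (by
        have := hd.continuous
        fun_prop) _ _)
    rw [intervalIntegral.integral_mul_const] at h2
    simp only [one_mul, zero_mul, h0, sub_zero] at h2
    rw [← h2, mul_comm]

/-- **Borel's lemma**. -/
theorem exists_contDiff_iteratedDeriv_eq (a : ℕ → ℝ) :
    ∃ b : ℝ → ℝ, ContDiff ℝ ∞ b ∧ ∀ n, iteratedDeriv n b 0 = a n := by
  let χ : ContDiffBump (0 : ℝ) := ⟨1, 2, one_pos, one_lt_two⟩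
  have hχ : ContDiff ℝ ∞ χ := χ.contDiff
  let h : ℕ → ℝ → ℝ := fun n s => (n.factorial : ℝ)⁻¹ * s ^ n * χ s
  have hh : ∀ n, ContDiff ℝ ∞ (h n) := fun n =>
    (contDiff_const.mul (contDiff_id.pow n)).mul hχ
  have hsupp : ∀ n, HasCompactSupport (h n) := fun n => χ.hasCompactSupport.mul_left
  have hbd : ∀ n k, ∃ D, ∀ s, ‖iteratedFDeriv ℝ k (h n) s‖ ≤ D := fun n k =>
    ((hh n).continuous_iteratedFDeriv (by exact_mod_cast le_top)).bounded_above_of_compact_support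
      ((hsupp n).iteratedFDeriv k)
  choose D hD using hbd
  have hD0 : ∀ n k, 0 ≤ D n k := fun n k => (norm_nonneg _).trans (hD n k 0)
  have hzero : ∀ n k, iteratedDeriv k (h n) 0 = if k = n then 1 else 0 := by
    intro n k
    have h1 : h n =ᶠ[𝓝 0] fun s => (n.factorial : ℝ)⁻¹ * s ^ n := by
      filter_upwards [χ.eventuallyEq_one] with s hs
      simp [h, hs]
    rw [h1.iteratedDeriv_eq, iteratedDeriv_const_mul_field, iteratedDeriv_fun_pow_zero]
    split_ifs with hkn
    · subst hkn
      have : (k.factorial : ℝ) ≠ 0 := by positivity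
      field_simp
    · simp
  let M : ℕ → ℝ := fun n => ∑ k ∈ Finset.range n, D n k
  have hM0 : ∀ n, 0 ≤ M n := fun n => Finset.sum_nonneg fun k _ => hD0 n k
  -- The `n`-th term is compressed by the factor `lam n ≥ 1`. For `k < n` its `k`-th derivative is
  -- then at most `|a n| M n / lam n`, which this choice makes at most `2⁻ⁿ`; for fixed `k`, only
  -- finitely many `n` remain.
  let lam : ℕ → ℝ := fun n => 1 + 2 ^ n * (|a n| * M n)
  have hlam : ∀ n, 1 ≤ lam n := fun n => by
    have := mul_nonneg (abs_nonneg (a n)) (hM0 n)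
    simp only [lam]
    have : (0 : ℝ) ≤ 2 ^ n * (|a n| * M n) := by positivity
    linarith
  let f : ℕ → ℝ → ℝ := fun n t => a n * (lam n)⁻¹ ^ n * h n (lam n * t)
  have hf : ∀ n, ContDiff ℝ ∞ (f n) := fun n =>
    contDiff_const.mul ((hh n).comp (contDiff_const.mul contDiff_id))
  have hfd : ∀ n k t, iteratedDeriv k (f n) t =
      a n * (lam n)⁻¹ ^ n * ((lam n) ^ k * iteratedDeriv k (h n) (lam n * t)) := by
    intro n k t
    simp only [f]
    rw [iteratedDeriv_const_mul_field, iteratedDeriv_comp_const_mul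
      ((hh n).of_le (by exact_mod_cast le_top))]
  have hfbd : ∀ n k t, ‖iteratedFDeriv ℝ k (f n) t‖ ≤
      |a n| * (lam n)⁻¹ ^ n * ((lam n) ^ k * D n k) := by
    intro n k t
    have h1 := hD n k (lam n * t)
    rw [norm_iteratedFDeriv_eq_norm_iteratedDeriv] at h1 ⊢
    have h0 : 0 < lam n := one_pos.trans_le (hlam n)
    rw [hfd, norm_mul, norm_mul, norm_mul, norm_pow, norm_pow, norm_inv]
    simp only [Real.norm_eq_abs] at h1 ⊢
    rw [abs_of_pos h0]
    gcongr
  let v : ℕ → ℕ → ℝ := fun k n =>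
    if k < n then (1 / 2 : ℝ) ^ n else |a n| * (lam n)⁻¹ ^ n * ((lam n) ^ k * D n k)
  have hv : ∀ k : ℕ, (k : ℕ∞) ≤ ⊤ → Summable (v k) := by
    intro k _
    refine summable_geometric_two.congr_cofinite ?_
    rw [Nat.cofinite_eq_atTop]
    filter_upwards [eventually_gt_atTop k] with n hn
    simp [v, hn]
  have hfv : ∀ (k n : ℕ) (t : ℝ), (k : ℕ∞) ≤ ⊤ → ‖iteratedFDeriv ℝ k (f n) t‖ ≤ v k n := by
    intro k n t _
    refine (hfbd n k t).trans ?_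
    simp only [v]
    split_ifs with hkn
    · have h0 : 0 < lam n := one_pos.trans_le (hlam n)
      have h1 : (lam n)⁻¹ ^ n * (lam n) ^ k ≤ (lam n)⁻¹ := by
        rw [inv_pow, inv_mul_le_iff₀ (by positivity), ← div_eq_mul_inv, le_div_iff₀ h0, ← pow_succ]
        exact pow_le_pow_right₀ (hlam n) hkn
      have h2 : D n k ≤ M n :=
        Finset.single_le_sum (f := fun k => D n k) (fun k _ => hD0 n k) (Finset.mem_range.2 hkn)
      calc |a n| * (lam n)⁻¹ ^ n * ((lam n) ^ k * D n k)
          = |a n| * ((lam n)⁻¹ ^ n * (lam n) ^ k) * D n k := by ring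
        _ ≤ |a n| * (lam n)⁻¹ * M n := by
          have := hM0 n
          have := hD0 n k
          gcongr
        _ = (|a n| * M n) / lam n := by ring
        _ ≤ (1 / 2) ^ n := by
          rw [div_le_iff₀ h0, div_pow, one_pow, div_mul_eq_mul_div, one_mul,
            le_div_iff₀ (by positivity)]
          simp only [lam]
          linarith
    · exact le_rfl
  refine ⟨fun t => ∑' n, f n t, contDiff_tsum (N := ⊤) hf hv hfv, fun k => ?_⟩
  have hs : Summable fun n => iteratedFDeriv ℝ k (f n) 0 :=
    .of_norm_bounded (hv k le_top) fun n => hfv k n 0 le_top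
  rw [iteratedDeriv, iteratedFDeriv_tsum_apply (N := ⊤) hf hv hfv le_top,
    ContinuousMultilinearMap.tsum_eval hs]
  have : ∀ n, iteratedFDeriv ℝ k (f n) 0 (fun _ => 1) = if n = k then a k else 0 := by
    intro n
    change iteratedDeriv k (f n) 0 = _
    rw [hfd, mul_zero, hzero]
    by_cases hkn : k = n
    · subst hkn
      have h0 : lam k ≠ 0 := (one_pos.trans_le (hlam k)).ne'
      simp [h0]
    · rw [if_neg hkn, if_neg (Ne.symm hkn)]
      simp
  simp_rw [this]
  exact tsum_ite_eq k _

theorem contDiffOn_iteratedDeriv {C : ℝ → ℝ} {U : Set ℝ} (hU : IsOpen U)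
    (hC : ContDiffOn ℝ ∞ C U) (n : ℕ) : ContDiffOn ℝ ∞ (iteratedDeriv n C) U := by
  induction n with
  | zero => simpa using hC
  | succ n ih =>
    rw [iteratedDeriv_succ]
    exact ih.deriv_of_isOpen hU (by simp)

/-- A function which is smooth to the right of `a`, with all derivatives converging at `a`, extends
smoothly to the left. -/
theorem exists_contDiffOn_extension {C : ℝ → ℝ} {a : ℝ} {U : Set ℝ} (hU : IsOpen U)
    (haU : U ⊆ Ioi a) (hUa : U ∈ 𝓝[>] a) (hC : ContDiffOn ℝ ∞ C U)
    (hlim : ∀ n, ∃ l, Tendsto (iteratedDeriv n C) (𝓝[>] a) (𝓝 l)) :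
    ∃ C' : ℝ → ℝ, ContDiffOn ℝ ∞ C' (Iic a ∪ U) ∧ EqOn C' C U := by
  choose l hl using hlim
  obtain ⟨b₀, hb₀, hbl₀⟩ := exists_contDiff_iteratedDeriv_eq l
  set b : ℝ → ℝ := fun t => b₀ (t - a)
  have hb : ContDiff ℝ ∞ b := hb₀.comp (contDiff_id.sub contDiff_const)
  have hbl : ∀ n, iteratedDeriv n b a = l n := by
    intro n
    simp only [b]
    rw [iteratedDeriv_comp_sub_const]
    simp [hbl₀]
  have hCd : ∀ n, ∀ t ∈ U, HasDerivAt (iteratedDeriv n C) (iteratedDeriv (n + 1) C t) t := by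
    intro n t ht
    rw [iteratedDeriv_succ]
    exact ((contDiffOn_iteratedDeriv hU hC n).contDiffAt (hU.mem_nhds ht)).differentiableAt
      (by simp) |>.hasDerivAt
  have hbd : ∀ n t, HasDerivAt (iteratedDeriv n b) (iteratedDeriv (n + 1) b t) t := by
    intro n t
    rw [iteratedDeriv_succ]
    exact (hb.differentiable_iteratedDeriv n (WithTop.coe_lt_coe.2 (ENat.natCast_lt_top n))
      t).hasDerivAt
  -- All derivatives are glued at once: each `φ n` is shown to have derivative `φ (n + 1)`, also at
  -- `a`, where the right derivative exists because the derivatives of `C` converge there.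
  let φ : ℕ → ℝ → ℝ := fun n t => if t ≤ a then iteratedDeriv n b t else iteratedDeriv n C t
  have hopen : IsOpen (Iic a ∪ U) := by
    rw [isOpen_iff_mem_nhds]
    rintro t (ht | ht)
    · rcases (mem_Iic.1 ht).lt_or_eq with h | rfl
      · exact mem_of_superset (Iic_mem_nhds h) subset_union_left
      · rw [← nhdsLE_sup_nhdsGT]
        exact union_mem_sup self_mem_nhdsWithin hUa
    · exact mem_of_superset (hU.mem_nhds ht) subset_union_right
  have hφ : ∀ n, ∀ t ∈ Iic a ∪ U, HasDerivAt (φ n) (φ (n + 1) t) t := by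
    rintro n t (ht | ht)
    · rcases (mem_Iic.1 ht).lt_or_eq with h | rfl
      · have h1 : φ n =ᶠ[𝓝 t] iteratedDeriv n b := by
          filter_upwards [Iic_mem_nhds h] with s hs using if_pos hs
        rw [h1.hasDerivAt_iff]
        simpa [φ, h.le] using hbd n t
      · have h1 : HasDerivWithinAt (φ n) (φ (n + 1) t) (Iic t) t := by
          have : φ (n + 1) t = iteratedDeriv (n + 1) b t := if_pos le_rfl
          rw [this]
          exact (hbd n t).hasDerivWithinAt.congr (fun s hs => if_pos hs) (if_pos le_rfl)
        have h2 : HasDerivWithinAt (φ n) (φ (n + 1) t) (Ici t) t := by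
          have h3 : ∀ s ∈ U, φ n =ᶠ[𝓝 s] iteratedDeriv n C := by
            intro s hs
            filter_upwards [hU.mem_nhds hs] with r hr using if_neg (not_le.2 (haU hr))
          have hval : ∀ n, φ n t = l n := fun n => (if_pos le_rfl).trans (hbl n)
          refine hasDerivWithinAt_Ici_of_tendsto_deriv (s := U)
            (fun s hs => ?_) ?_ hUa ?_
          · exact ((hCd n s hs).congr_of_eventuallyEq
              (h3 s hs)).differentiableAt.differentiableWithinAt
          · rw [ContinuousWithinAt, hval]
            refine ((hl n).mono_left (nhdsWithin_mono _ haU)).congr' ?_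
            filter_upwards [self_mem_nhdsWithin] with s hs using (h3 s hs).eq_of_nhds.symm
          · rw [hval]
            refine (hl (n + 1)).congr' ?_
            filter_upwards [hUa] with s hs
            rw [(h3 s hs).deriv_eq, (hCd n s hs).deriv]
        have h3 := h1.union h2
        rwa [Iic_union_Ici, hasDerivWithinAt_univ] at h3
    · have h1 : φ n =ᶠ[𝓝 t] iteratedDeriv n C := by
        filter_upwards [hU.mem_nhds ht] with r hr using if_neg (not_le.2 (haU hr))
      rw [h1.hasDerivAt_iff]
      simpa [φ, not_le.2 (mem_Ioi.1 (haU ht))] using hCd n t ht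
  refine ⟨φ 0, contDiffOn_infty.2 fun N => ?_, fun t ht => ?_⟩
  · suffices ∀ N n : ℕ, ContDiffOn ℝ N (φ n) (Iic a ∪ U) from this N 0
    intro N
    induction N with
    | zero =>
      intro n
      rw [Nat.cast_zero, contDiffOn_zero]
      exact fun t ht => (hφ n t ht).continuousAt.continuousWithinAt
    | succ N ih =>
      intro n
      rw [Nat.cast_add, Nat.cast_one, contDiffOn_succ_iff_deriv_of_isOpen hopen]
      exact ⟨fun t ht => (hφ n t ht).differentiableAt.differentiableWithinAt, by simp,
        (ih (n + 1)).congr fun t ht => (hφ n t ht).deriv⟩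
  · simp [φ, not_le.2 (mem_Ioi.1 (haU ht))]

/-- Hadamard's lemma twice: the first quotient vanishes at `0` because `g'` does, and the second one
takes there half the value of `g''`. -/
theorem exists_eq_add_sq_mul {g : ℝ → ℝ} (hg : ContDiff ℝ ∞ g) (h1 : deriv g 0 = 0)
    (h2 : deriv (deriv g) 0 ≠ 0) :
    ∃ k : ℝ → ℝ, ContDiff ℝ ∞ k ∧ k 0 ≠ 0 ∧ ∀ s, g s = g 0 + s ^ 2 * k s := by
  obtain ⟨h, hh, hgh⟩ := exists_contDiff_eq_mul (h := fun s => g s - g 0)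
    (hg.sub contDiff_const) (by simp)
  have hg' : ∀ s, g s = g 0 + s * h s := fun s => by rw [← hgh s]; ring
  have hder : ∀ s, HasDerivAt g (h s + s * deriv h s) s := by
    intro s
    have := (((hasDerivAt_id' s).mul ((hh.differentiable (by simp) s).hasDerivAt)).const_add (g 0))
    rw [one_mul] at this
    exact this.congr_of_eventuallyEq (.of_forall hg')
  have hh0 : h 0 = 0 := by
    have := (hder 0).deriv
    rw [h1] at this
    simpa using this.symm
  obtain ⟨k, hk, hhk⟩ := exists_contDiff_eq_mul hh hh0
  have hgk : ∀ s, g s = g 0 + s ^ 2 * k s := fun s => by rw [hg' s, hhk s]; ring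
  refine ⟨k, hk, fun hk0 => h2 ?_, hgk⟩
  have hder2 : deriv g = fun s => s * (2 * k s + s * deriv k s) := by
    funext s
    have := ((((hasDerivAt_id' s).fun_pow 2).mul
      ((hk.differentiable (by simp) s).hasDerivAt)).const_add (g 0))
    rw [(this.congr_of_eventuallyEq (.of_forall hgk)).deriv]
    push_cast
    ring
  have hd : DifferentiableAt ℝ (fun s => 2 * k s + s * deriv k s) 0 := by
    have h3 := hk.differentiable (by simp)
    have h4 : Differentiable ℝ (deriv k) := (contDiff_infty_iff_deriv.1 hk).2.differentiable (by simp)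
    fun_prop
  rw [hder2, ((hasDerivAt_id' (0 : ℝ)).fun_mul hd.hasDerivAt).deriv]
  simp [hk0]

/-- By the intermediate value theorem, values just above `a` are attained at small positive
arguments. Applied also to `s ↦ g (-s)`, this shows that they are attained on both sides of `0`. -/
theorem nhdsGT_le_map {g k : ℝ → ℝ} {a : ℝ} (hk : ContDiff ℝ ∞ k) (hk0 : 0 < k 0)
    (hg : ∀ s, g s = a + s ^ 2 * k s) : 𝓝[>] a ≤ map g (𝓝[>] 0) := by
  have hgc : Continuous g := by
    have : g = fun s => a + s ^ 2 * k s := funext hg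
    have := hk.continuous
    rw [‹g = _›]
    fun_prop
  intro S hS
  have hpos : ∀ᶠ s in 𝓝[>] (0 : ℝ), 0 < k s :=
    nhdsWithin_le_nhds (hk.continuous.continuousAt.eventually_const_lt hk0)
  obtain ⟨u, hu0, hu⟩ := mem_nhdsGT_iff_exists_Ioo_subset.1 (inter_mem (mem_map.1 hS) hpos)
  have hu0 : (0 : ℝ) < u := hu0
  have hu2 : u / 2 ∈ Ioo 0 u := ⟨by positivity, by linarith⟩
  have hga : g 0 = a := by simp [hg]
  have hgu : a < g (u / 2) := by
    rw [hg]
    have : 0 < k (u / 2) := (hu hu2).2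
    have : 0 < (u / 2) ^ 2 * k (u / 2) := by positivity
    linarith
  filter_upwards [Ioo_mem_nhdsGT hgu] with t ht
  obtain ⟨s, hs, rfl⟩ := intermediate_value_Ioo (hu2.1.le) hgc.continuousOn (by rwa [hga])
  exact (hu ⟨hs.1, hs.2.trans hu2.2⟩).1

/-- If `C ∘ g` extends smoothly across `0`, where `g` has a nondegenerate minimum at `0`, then all
derivatives of `C` have a limit at the minimal value. -/
theorem exists_tendsto_iteratedDeriv {C g k e : ℝ → ℝ} {a : ℝ} {U : Set ℝ} (hU : IsOpen U)
    (hUa : U ∈ 𝓝[>] a) (hC : ContDiffOn ℝ ∞ C U) (hk : ContDiff ℝ ∞ k) (hk0 : 0 < k 0)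
    (hg : ∀ s, g s = a + s ^ 2 * k s) (he : ContDiff ℝ ∞ e)
    (hCe : ∀ᶠ s in 𝓝[≠] 0, C (g s) = e s) (n : ℕ) :
    ∃ l, Tendsto (iteratedDeriv n C) (𝓝[>] a) (𝓝 l) := by
  have hmapR : 𝓝[>] a ≤ map g (𝓝[>] 0) := nhdsGT_le_map hk hk0 hg
  have hmapL : 𝓝[>] a ≤ map g (𝓝[<] 0) := by
    have h1 : 𝓝[>] a ≤ map (fun s => g (-s)) (𝓝[>] 0) :=
      nhdsGT_le_map (hk.comp contDiff_neg) (by simpa using hk0) (fun s => by simp [hg])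
    have h2 : map (fun s : ℝ => g (-s)) (𝓝[>] 0) = map g (map Neg.neg (𝓝[>] 0)) := by
      rw [map_map]; rfl
    rw [h2] at h1
    refine h1.trans (map_mono ?_)
    simp
  have hgs : ContDiff ℝ ∞ g := by
    rw [funext hg]
    exact contDiff_const.add ((contDiff_id.pow 2).mul hk)
  -- Here `g' = s (2k + s k')`, and the second factor is nonzero near `0`; `κ` is its reciprocal
  -- near `0`, cut off to be smooth on the whole line.
  obtain ⟨κ, hκ, hκk⟩ : ∃ κ : ℝ → ℝ, ContDiff ℝ ∞ κ ∧
      ∀ᶠ s in 𝓝 0, κ s * (2 * k s + s * deriv k s) = 1 := by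
    set m : ℝ → ℝ := fun s => 2 * k s + s * deriv k s with hm
    have hms : ContDiff ℝ ∞ m :=
      (contDiff_const.mul hk).add (contDiff_id.mul (contDiff_infty_iff_deriv.1 hk).2)
    have hm0 : m 0 ≠ 0 := by simp [hm, hk0.ne']
    obtain ⟨ε, hε, hball⟩ := Metric.eventually_nhds_iff_ball.1
      (hms.continuous.continuousAt.eventually_ne hm0)
    let χ : ContDiffBump (0 : ℝ) := ⟨ε / 3, ε / 2, by positivity, by linarith⟩
    refine ⟨fun s => χ s * (m s)⁻¹, ?_, ?_⟩
    · rw [contDiff_iff_contDiffAt]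
      intro s
      by_cases hs : m s = 0
      · have : s ∉ tsupport χ := by
          rw [χ.tsupport_eq]
          intro hs'
          refine hball s (Metric.closedBall_subset_ball ?_ hs') hs
          change ε / 2 < ε
          linarith
        refine (contDiffAt_const (c := (0 : ℝ))).congr_of_eventuallyEq ?_
        filter_upwards [notMem_tsupport_iff_eventuallyEq.1 this] with r hr
        simp [hr]
      · exact (χ.contDiffAt).mul (hms.contDiffAt.inv hs)
    · filter_upwards [χ.eventuallyEq_one, Metric.ball_mem_nhds 0 hε] with s hs hsb
      have := hball s hsb
      simp only [hs, Pi.one_apply, one_mul]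
      exact inv_mul_cancel₀ this
  have hder : ∀ s, HasDerivAt g (s * (2 * k s + s * deriv k s)) s := by
    intro s
    have := ((((hasDerivAt_id' s).fun_pow 2).fun_mul
      ((hk.differentiable (by simp) s).hasDerivAt)).const_add a)
    rw [funext hg]
    refine this.congr_deriv ?_
    push_cast
    ring
  have hgU : ∀ᶠ s in 𝓝[≠] 0, g s ∈ U := by
    have h1 : Tendsto g (𝓝[≠] 0) (𝓝[>] a) := by
      rw [tendsto_nhdsWithin_iff]
      constructor
      · have := hgs.continuous.tendsto 0
        rw [hg 0] at this
        simpa using this.mono_left nhdsWithin_le_nhds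
      · filter_upwards [self_mem_nhdsWithin, nhdsWithin_le_nhds
          (hk.continuous.continuousAt.eventually_const_lt hk0)] with s hs hks
        rw [hg]
        have : s ≠ 0 := hs
        have : 0 < s ^ 2 * k s := by positivity
        simpa using this
    exact h1 hUa
  -- Inductively, the next derivative of `C` along `g` is `e' / g'`. It is smooth at `0` because
  -- `e'` vanishes there and cancels the factor `s` of `g'`.
  have main : ∃ e : ℝ → ℝ, ContDiff ℝ ∞ e ∧
      ∀ᶠ s in 𝓝[≠] 0, iteratedDeriv n C (g s) = e s := by
    induction n with
    | zero => exact ⟨e, he, by simpa using hCe⟩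
    | succ n ih =>
      obtain ⟨e, he, hCe⟩ := ih
      have hd : ∀ᶠ s in 𝓝[≠] 0,
          iteratedDeriv (n + 1) C (g s) * (s * (2 * k s + s * deriv k s)) = deriv e s := by
        have h1 : ∀ᶠ s in 𝓝[≠] 0, ∀ᶠ r in 𝓝 s, iteratedDeriv n C (g r) = e r := by
          rw [eventually_nhdsWithin_iff] at hCe ⊢
          filter_upwards [hCe.eventually_nhds] with s hs hs0
          filter_upwards [hs, isOpen_compl_singleton.mem_nhds hs0] with r hr hr0 using hr hr0
        filter_upwards [h1, hgU] with s hs hsU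
        have h2 : HasDerivAt (iteratedDeriv n C) (iteratedDeriv (n + 1) C (g s)) (g s) := by
          rw [iteratedDeriv_succ]
          exact (((contDiffOn_iteratedDeriv hU hC n).contDiffAt
            (hU.mem_nhds hsU)).differentiableAt (by simp)).hasDerivAt
        have h3 := (h2.comp s (hder s)).congr_of_eventuallyEq
          (EventuallyEq.symm hs : e =ᶠ[𝓝 s] iteratedDeriv n C ∘ g)
        exact h3.deriv.symm
      -- Otherwise `e` would be injective near `0`; but off `0` it depends only on the value of `g`,
      -- and values just above `a` are taken at both a positive and a negative argument.
      have he0 : deriv e 0 = 0 := by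
        by_contra hne
        have hst : HasStrictDerivAt e (deriv e 0) 0 :=
          (he.contDiffAt.hasStrictDerivAt (by simp))
        have hinj := ((hst.hasStrictFDerivAt_equiv hne).toOpenPartialHomeomorph e).injOn
        have hsrc : ((hst.hasStrictFDerivAt_equiv hne).toOpenPartialHomeomorph e).source ∈ 𝓝 0 :=
          ((hst.hasStrictFDerivAt_equiv hne).toOpenPartialHomeomorph e).open_source.mem_nhds
            (hst.hasStrictFDerivAt_equiv hne).mem_toOpenPartialHomeomorph_source
        set S := ((hst.hasStrictFDerivAt_equiv hne).toOpenPartialHomeomorph e).source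
        have hR : ∀ᶠ t in 𝓝[>] a, ∃ s, (s ∈ S ∧ 0 < s ∧ iteratedDeriv n C (g s) = e s) ∧ g s = t := by
          refine hmapR (mem_map.2 ?_)
          filter_upwards [nhdsWithin_le_nhds hsrc, self_mem_nhdsWithin,
            nhdsWithin_mono 0 (fun s (hs : (0 : ℝ) < s) => (hs.ne' : s ≠ 0)) hCe]
            with s h1 h2 h3 using ⟨s, ⟨h1, h2, h3⟩, rfl⟩
        have hL : ∀ᶠ t in 𝓝[>] a, ∃ s, (s ∈ S ∧ s < 0 ∧ iteratedDeriv n C (g s) = e s) ∧ g s = t := by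
          refine hmapL (mem_map.2 ?_)
          filter_upwards [nhdsWithin_le_nhds hsrc, self_mem_nhdsWithin,
            nhdsWithin_mono 0 (fun s (hs : s < (0 : ℝ)) => (hs.ne : s ≠ 0)) hCe]
            with s h1 h2 h3 using ⟨s, ⟨h1, h2, h3⟩, rfl⟩
        obtain ⟨t, ⟨s, ⟨hs1, hs2, hs3⟩, hs4⟩, r, ⟨hr1, hr2, hr3⟩, hr4⟩ := (hR.and hL).exists
        have : s = r := by
          apply hinj hs1 hr1
          change e s = e r
          rw [← hs3, ← hr3, hs4, hr4]
        linarith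
      obtain ⟨e₁, he₁, hee₁⟩ := exists_contDiff_eq_mul (contDiff_infty_iff_deriv.1 he).2 he0
      refine ⟨fun s => κ s * e₁ s, hκ.mul he₁, ?_⟩
      filter_upwards [hd, nhdsWithin_le_nhds hκk, self_mem_nhdsWithin] with s h1 h2 h3
      have hs : s ≠ 0 := h3
      rw [hee₁] at h1
      have h4 : iteratedDeriv (n + 1) C (g s) * (2 * k s + s * deriv k s) = e₁ s := by
        apply mul_left_cancel₀ hs
        linarith
      rw [← h4]
      linear_combination (-iteratedDeriv (n + 1) C (g s)) * h2
  obtain ⟨e, he, hCe⟩ := main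
  refine ⟨e 0, Tendsto.mono_left (tendsto_map'_iff.2 ?_) hmapR⟩
  refine ((he.continuous.tendsto 0).mono_left nhdsWithin_le_nhds).congr' ?_
  filter_upwards [nhdsWithin_mono 0 (fun s (hs : (0 : ℝ) < s) => (hs.ne' : s ≠ 0)) hCe] with s hs
    using hs.symm

/-- A smooth function on `(a, c)` which becomes smooth after composition with functions having a
nondegenerate minimum of value `a`, respectively a nondegenerate maximum of value `c`, is the
restriction of a smooth function on the line. -/
theorem exists_contDiff_extension {C : ℝ → ℝ} {a c : ℝ} (hac : a < c)
    (hC : ContDiffOn ℝ ∞ C (Ioo a c))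
    {g k e : ℝ → ℝ} (hk : ContDiff ℝ ∞ k) (hk0 : 0 < k 0)
    (hg : ∀ s, g s = a + s ^ 2 * k s) (he : ContDiff ℝ ∞ e)
    (hCe : ∀ᶠ s in 𝓝[≠] 0, C (g s) = e s)
    {g' k' e' : ℝ → ℝ} (hk' : ContDiff ℝ ∞ k') (hk0' : k' 0 < 0)
    (hg' : ∀ s, g' s = c + s ^ 2 * k' s) (he' : ContDiff ℝ ∞ e')
    (hCe' : ∀ᶠ s in 𝓝[≠] 0, C (g' s) = e' s) :
    ∃ C' : ℝ → ℝ, ContDiff ℝ ∞ C' ∧ EqOn C' C (Ioo a c) := by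
  obtain ⟨C₁, hC₁, hCC₁⟩ := exists_contDiffOn_extension isOpen_Ioo (fun t ht => ht.1)
    (Ioo_mem_nhdsGT hac) hC
    (exists_tendsto_iteratedDeriv isOpen_Ioo (Ioo_mem_nhdsGT hac) hC hk hk0 hg he hCe)
  rw [Iic_union_Ioo_eq_Iio hac] at hC₁
  -- After reflection the right end `c` becomes a left end `-c`, and the maximum of `g'` becomes the
  -- minimum of `-g'`.
  set D : ℝ → ℝ := fun t => C₁ (-t) with hD
  have hDs : ContDiffOn ℝ ∞ D (Ioi (-c)) :=
    hC₁.comp contDiff_neg.contDiffOn fun t ht => by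
      have : -c < t := ht
      change -t < c
      linarith
  have hDe : ∀ᶠ s in 𝓝[≠] 0, D (-g' s) = e' s := by
    have h1 : ∀ᶠ s in 𝓝[≠] (0 : ℝ), a < g' s := by
      have : ContinuousAt g' 0 := by
        have := hk'.continuous
        rw [funext hg']
        fun_prop
      exact nhdsWithin_le_nhds (this.eventually_const_lt (by simpa [hg'] using hac))
    filter_upwards [hCe', h1, self_mem_nhdsWithin, nhdsWithin_le_nhds
      (hk'.continuous.continuousAt.eventually_lt_const hk0')] with s h2 h3 h4 h5
    have hs : s ≠ 0 := h4
    have h6 : g' s < c := by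
      rw [hg']
      have : 0 < s ^ 2 := by positivity
      nlinarith
    rw [← h2]
    simp only [hD, neg_neg]
    exact hCC₁ ⟨h3, h6⟩
  obtain ⟨C₂, hC₂, hCC₂⟩ := exists_contDiffOn_extension isOpen_Ioi subset_rfl
    self_mem_nhdsWithin hDs
    (exists_tendsto_iteratedDeriv isOpen_Ioi self_mem_nhdsWithin hDs (hk'.neg)
      (by simpa using hk0') (g := fun s => -g' s) (fun s => by simp [hg']; ring) he' hDe)
  rw [Iic_union_Ioi, contDiffOn_univ] at hC₂
  refine ⟨fun t => C₂ (-t), hC₂.comp contDiff_neg, fun t ht => ?_⟩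
  have : -t ∈ Ioi (-c) := neg_lt_neg ht.2
  rw [← hCC₁ ht]
  simpa [hD] using hCC₂ this

end OneVariable

/-! ### Curves on the boundary torus -/

theorem hasDerivAt_dotProduct {a b : ℝ → R3} {a' b' : R3} {t : ℝ} (ha : HasDerivAt a a' t)
    (hb : HasDerivAt b b' t) :
    HasDerivAt (fun t => a t ⬝ᵥ b t) (a' ⬝ᵥ b t + a t ⬝ᵥ b') t := by
  simp only [dotProduct, ← Finset.sum_add_distrib]
  exact HasDerivAt.fun_sum fun i _ => (hasDerivAt_pi.1 ha i).mul (hasDerivAt_pi.1 hb i)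

theorem hasDerivAt_comp_of_mem {Q : Set R3} {H : R3 → ℝ} {η : R3 → R3 →L[ℝ] ℝ}
    (hH : ∀ x ∈ Q, HasFDerivWithinAt H (η x) Q x) {X : ℝ → R3} (hX : ∀ t, X t ∈ Q) {X' : R3}
    {τ : ℝ} (h : HasDerivAt X X' τ) : HasDerivAt (fun t => H (X t)) (η (X τ) X') τ := by
  rw [← hasDerivWithinAt_univ]
  exact (hH _ (hX τ)).comp_hasDerivWithinAt τ h.hasDerivWithinAt fun t _ => hX t

/-- A curve on the boundary of the solid cylinder. -/
noncomputable def bdryCurve (q : ℂ × ℝ) (α β : ℝ) (τ : ℝ) : ℂ × ℝ :=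
  (q.1 * Complex.exp ((α * τ : ℝ) * Complex.I), q.2 + β * τ)

/-- A tangent vector to the boundary of the solid cylinder. -/
noncomputable def bdryTangent (q : ℂ × ℝ) (α β : ℝ) : ℂ × ℝ := (α * (Complex.I * q.1), β)

theorem norm_bdryCurve (q : ℂ × ℝ) (α β τ : ℝ) : ‖(bdryCurve q α β τ).1‖ = ‖q.1‖ := by
  simp [bdryCurve, Complex.norm_exp_ofReal_mul_I, -Complex.ofReal_mul]

theorem bdryCurve_mem {q : ℂ × ℝ} (hq : q ∈ solidCyl) (α β τ : ℝ) :
    bdryCurve q α β τ ∈ solidCyl := by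
  refine ⟨?_, mem_univ _⟩
  rw [mem_closedBall_zero_iff, norm_bdryCurve]
  simpa using hq.1

theorem bdryCurve_zero (q : ℂ × ℝ) (α β : ℝ) : bdryCurve q α β 0 = q := by
  simp [bdryCurve]

theorem hasDerivAt_bdryCurve (q : ℂ × ℝ) (α β τ : ℝ) :
    HasDerivAt (bdryCurve q α β) (bdryTangent (bdryCurve q α β τ) α β) τ := by
  refine HasDerivAt.prodMk ?_ ?_
  · have h1 : HasDerivAt (fun τ : ℝ => ((α * τ : ℝ) : ℂ) * Complex.I) (α * Complex.I) τ := by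
      have := (((hasDerivAt_id' τ).const_mul α).ofReal_comp).mul_const Complex.I
      simpa using this
    refine (h1.cexp.const_mul q.1).congr_deriv ?_
    simp only [bdryCurve]
    ring
  · simpa using ((hasDerivAt_id' τ).const_mul β).const_add q.2

theorem contDiff_bdryCurve (q : ℂ × ℝ) (α β : ℝ) : ContDiff ℝ ∞ (bdryCurve q α β) := by
  refine ContDiff.prodMk (contDiff_const.mul (ContDiff.cexp ?_)) ?_
  · exact (Complex.ofRealCLM.contDiff.comp (contDiff_const.mul contDiff_id)).mul contDiff_const
  · exact contDiff_const.add (contDiff_const.mul contDiff_id)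

namespace IsChart

variable {Q : Set R3} {F : ℂ × ℝ → R3}

theorem bdryCurve_mem_frontier (hF : IsChart Q F) {q : ℂ × ℝ} (hq : q ∈ solidCyl)
    (hq1 : ‖q.1‖ = 1) (α β τ : ℝ) : F (bdryCurve q α β τ) ∈ frontier Q :=
  (hF.mem_frontier_iff (bdryCurve_mem hq _ _ _)).2 (by rw [norm_bdryCurve, hq1])

theorem contDiff_comp_bdryCurve (hF : IsChart Q F) {q : ℂ × ℝ} (hq : q ∈ solidCyl) (α β : ℝ) :
    ContDiff ℝ ∞ fun τ => F (bdryCurve q α β τ) :=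
  hF.smooth.comp_contDiff (contDiff_bdryCurve q α β) fun τ => bdryCurve_mem hq α β τ

theorem hasDerivAt_comp_bdryCurve (hF : IsChart Q F) {q : ℂ × ℝ} (hq : q ∈ solidCyl)
    (α β τ : ℝ) :
    HasDerivAt (fun τ => F (bdryCurve q α β τ))
      (fderivWithin ℝ F solidCyl (bdryCurve q α β τ)
        (bdryTangent (bdryCurve q α β τ) α β)) τ := by
  rw [← hasDerivWithinAt_univ]
  exact (hF.hasFDerivWithinAt (bdryCurve_mem hq α β τ)).comp_hasDerivWithinAt τ
    (hasDerivAt_bdryCurve q α β τ).hasDerivWithinAt fun t _ => bdryCurve_mem hq α β t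

/-- A function whose tangential derivative along the boundary vanishes is constant there. -/
theorem exists_const_frontier (hF : IsChart Q F) {H : R3 → ℝ} {η : R3 → R3 →L[ℝ] ℝ}
    (hH : ∀ x ∈ Q, HasFDerivWithinAt H (η x) Q x)
    (hη : ∀ q ∈ solidCyl, ‖q.1‖ = 1 → ∀ α β : ℝ,
      η (F q) (fderivWithin ℝ F solidCyl q (bdryTangent q α β)) = 0) :
    ∃ c, ∀ x ∈ frontier Q, H x = c := by
  have h10 : ((1, 0) : ℂ × ℝ) ∈ solidCyl := by simp
  refine ⟨H (F (1, 0)), fun x hx => ?_⟩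
  obtain ⟨q, hq, hq1, rfl⟩ := hF.exists_frontier_eq hx
  -- The helix starting at `(1, 0)` with angular speed `arg q.1` and vertical speed `q.2` reaches
  -- `q` at time `1`.
  set α := Complex.arg q.1
  have hz : q.1 = Complex.exp (α * Complex.I) := by
    have := Complex.norm_mul_exp_arg_mul_I q.1
    rw [hq1] at this
    simpa using this.symm
  have hd : ∀ τ, HasDerivAt (fun τ => H (F (bdryCurve (1, 0) α q.2 τ))) 0 τ := by
    intro τ
    refine (hasDerivAt_comp_of_mem hH (fun t => hF.mem (bdryCurve_mem h10 α q.2 t))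
      (hF.hasDerivAt_comp_bdryCurve h10 α q.2 τ)).congr_deriv ?_
    exact hη _ (bdryCurve_mem h10 _ _ _) (by rw [norm_bdryCurve]; simp) _ _
  have h1 := is_const_of_deriv_eq_zero (fun τ => (hd τ).differentiableAt)
    (fun τ => (hd τ).deriv) 1 0
  have h2 : bdryCurve (1, 0) α q.2 1 = q := by
    ext1
    · simp [bdryCurve, hz]
    · simp [bdryCurve]
  rwa [bdryCurve_zero, h2] at h1

theorem apply_bdryTangent_eq_zero (hF : IsChart Q F) {H : R3 → ℝ} {c : ℝ}
    (hH : DifferentiableOn ℝ H Q) (hc : ∀ x ∈ frontier Q, H x = c) {q : ℂ × ℝ}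
    (hq : q ∈ solidCyl) (hq1 : ‖q.1‖ = 1) (α β : ℝ) :
    fderivWithin ℝ H Q (F q) (fderivWithin ℝ F solidCyl q (bdryTangent q α β)) = 0 := by
  have h1 := hasDerivAt_comp_of_mem (fun x hx => (hH x hx).hasFDerivWithinAt)
    (fun t => hF.mem (bdryCurve_mem hq α β t)) (hF.hasDerivAt_comp_bdryCurve hq α β 0)
  have h2 : (fun t => H (F (bdryCurve q α β t))) = fun _ => c :=
    funext fun t => hc _ (hF.bdryCurve_mem_frontier hq hq1 α β t)
  rw [h2, bdryCurve_zero] at h1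
  exact h1.unique (hasDerivAt_const 0 c)

end IsChart

/-! ### Nondegenerate axis of a function constant on the boundary -/

theorem hasFDerivWithinAt_grad {Q : Set R3} {f : R3 → ℝ} {x : R3}
    (hf : DifferentiableWithinAt ℝ (fderivWithin ℝ f Q) Q x) :
    HasFDerivWithinAt (grad Q f) (ContinuousLinearMap.pi fun i =>
      (ContinuousLinearMap.apply ℝ ℝ (Pi.single i (1 : ℝ) : R3)) ∘L
        fderivWithin ℝ (fderivWithin ℝ f Q) Q x) Q x := by
  rw [hasFDerivWithinAt_pi]
  intro i
  exact (ContinuousLinearMap.apply ℝ ℝ (Pi.single i (1 : ℝ) : R3)).hasFDerivAt.comp_hasFDerivWithinAt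
    x hf.hasFDerivWithinAt

theorem dotProduct_pi_single (A : R3 →L[ℝ] ℝ) (v : R3) :
    (fun i => A (Pi.single i 1)) ⬝ᵥ v = A v := by
  have hv : v = ∑ i, v i • (Pi.single i (1 : ℝ) : R3) := by
    ext j; simp [Finset.sum_apply, Pi.single_apply]
  conv_rhs => rw [hv, map_sum]
  simp [dotProduct, mul_comm]

theorem hess_eq {Q : Set R3} {f : R3 → ℝ} {x : R3} (hQ : UniqueDiffWithinAt ℝ Q x)
    (hf : DifferentiableWithinAt ℝ (fderivWithin ℝ f Q) Q x) (v : R3) :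
    hess Q f x v = fderivWithin ℝ (fderivWithin ℝ f Q) Q x v v := by
  rw [hess, (hasFDerivWithinAt_grad hf).fderivWithin hQ]
  exact dotProduct_pi_single (fderivWithin ℝ (fderivWithin ℝ f Q) Q x v) v

theorem grad_eq_zero_iff {Q : Set R3} {f : R3 → ℝ} {x : R3} :
    grad Q f x = 0 ↔ fderivWithin ℝ f Q x = 0 := by
  constructor
  · intro h
    ext1 v
    rw [← grad_dotProduct, h]
    simp
  · intro h
    ext i
    simp [grad, h]

/-- The data of a function on `Q`, constant equal to `c` on the boundary, whose critical points form
a curve `γ` in the interior, with value `a` and nonvanishing Hessian along it. -/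
structure AxisData (Q : Set R3) (ψ : R3 → ℝ) (γ : ℝ → R3) (a c : ℝ) : Prop where
  smooth : ContDiffOn ℝ ∞ ψ Q
  smooth_axis : ContDiff ℝ ∞ γ
  axis_mem : ∀ s, γ s ∈ interior Q
  axis_value : ∀ s, ψ (γ s) = a
  frontier_value : ∀ x ∈ frontier Q, ψ x = c
  frontier_deriv : ∀ x ∈ frontier Q, fderivWithin ℝ ψ Q x ≠ 0
  axis_deriv : ∀ s, fderivWithin ℝ ψ Q (γ s) = 0
  mem_axis : ∀ x ∈ Q, fderivWithin ℝ ψ Q x = 0 → ∃ s, γ s = x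
  axis_hess : ∀ s, ∃ v, fderivWithin ℝ (fderivWithin ℝ ψ Q) Q (γ s) v v ≠ 0

theorem exists_ne_zero_dotProduct_eq_zero (w : R3) : ∃ v : R3, v ≠ 0 ∧ v ⬝ᵥ w = 0 := by
  by_cases h : w 0 = 0
  · refine ⟨![1, 0, 0], fun h0 => ?_, ?_⟩
    · simpa using congrFun h0 0
    · simp [dotProduct, Fin.sum_univ_three, h]
  · refine ⟨![-w 1, w 0, 0], fun h0 => h ?_, ?_⟩
    · simpa using congrFun h0 1
    · simp [dotProduct, Fin.sum_univ_three]
      ring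

/-- The point is that the axis avoids the boundary. The tangent plane of `∂Q` contains a nonzero
vector orthogonal to `γ'`. Since `ψ` is constant along a boundary curve in that direction,
differentiating twice at a critical point leaves only the Hessian of this vector, which would have
to vanish, against definiteness. -/
theorem IsChart.exists_axisData {Q : Set R3} {F : ℂ × ℝ → R3} (hF : IsChart Q F) {ψ : R3 → ℝ}
    (hψ : ContDiffOn ℝ ∞ ψ Q) {c : ℝ} (hc : ∀ x ∈ frontier Q, ψ x = c)
    (hax : HasNondegenerateAxis Q ψ) : ∃ γ a, AxisData Q ψ γ a c := by
  obtain ⟨γ, hγ, -, hγ', hrange, hdef⟩ := hax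
  have hu := hF.uniqueDiffOn
  have hdψ : DifferentiableOn ℝ ψ Q := hψ.differentiableOn (by simp)
  have hd2 : ContDiffOn ℝ ∞ (fderivWithin ℝ ψ Q) Q := hψ.fderivWithin hu (by simp)
  have hd2' : DifferentiableOn ℝ (fderivWithin ℝ ψ Q) Q := hd2.differentiableOn (by simp)
  have hmem : ∀ s, γ s ∈ Q ∧ grad Q ψ (γ s) = 0 := fun s => by
    have : γ s ∈ range γ := mem_range_self s
    rwa [hrange] at this
  have hcrit : ∀ x ∈ Q, fderivWithin ℝ ψ Q x = 0 → ∃ s, γ s = x := by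
    intro x hx h0
    have : x ∈ range γ := by
      rw [hrange]
      exact ⟨hx, grad_eq_zero_iff.2 h0⟩
    exact this
  have hhess : ∀ s, ∀ v, v ≠ 0 → v ⬝ᵥ deriv γ s = 0 →
      fderivWithin ℝ (fderivWithin ℝ ψ Q) Q (γ s) v v ≠ 0 := by
    intro s v hv hvγ
    rw [← hess_eq (hu _ (hmem s).1) (hd2' _ (hmem s).1)]
    rcases hdef s with h | h
    · exact (h v hv hvγ).ne'
    · exact (h v hv hvγ).ne
  have hfront : ∀ x ∈ frontier Q, fderivWithin ℝ ψ Q x ≠ 0 := by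
    intro x hx h0
    obtain ⟨s, rfl⟩ := hcrit x (hF.isCompact.isClosed.frontier_subset hx) h0
    obtain ⟨q, hq, hq1, hqs⟩ := hF.exists_frontier_eq hx
    set A := fderivWithin ℝ F solidCyl q
    obtain ⟨α, β, hne, hperp⟩ : ∃ α β : ℝ, bdryTangent q α β ≠ 0 ∧
        A (bdryTangent q α β) ⬝ᵥ deriv γ s = 0 := by
      have hlin : ∀ α β : ℝ, bdryTangent q α β = α • bdryTangent q 1 0 + β • bdryTangent q 0 1 := by
        intro α β
        simp [bdryTangent]
      have hq0 : q.1 ≠ 0 := by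
        rw [← norm_ne_zero_iff, hq1]
        exact one_ne_zero
      have hne : ∀ α β : ℝ, (α ≠ 0 ∨ β ≠ 0) → bdryTangent q α β ≠ 0 := by
        rintro α β h h0
        simp only [bdryTangent, Prod.mk_eq_zero, mul_eq_zero, Complex.ofReal_eq_zero,
          Complex.I_ne_zero, hq0, or_false] at h0
        tauto
      by_cases h1 : A (bdryTangent q 1 0) ⬝ᵥ deriv γ s = 0
      · exact ⟨1, 0, hne _ _ (by simp), h1⟩
      · refine ⟨-(A (bdryTangent q 0 1) ⬝ᵥ deriv γ s), A (bdryTangent q 1 0) ⬝ᵥ deriv γ s,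
          hne _ _ (Or.inr h1), ?_⟩
        rw [hlin, map_add, map_smul, map_smul, add_dotProduct, smul_dotProduct, smul_dotProduct,
          smul_eq_mul, smul_eq_mul]
        ring
    have hA0 : A (bdryTangent q α β) ≠ 0 := by
      intro h
      exact hne (hF.immersive q hq (h.trans (map_zero _).symm))
    set X : ℝ → R3 := fun τ => F (bdryCurve q α β τ) with hX
    have hXs : ContDiff ℝ ∞ X := hF.contDiff_comp_bdryCurve hq α β
    have hXQ : ∀ τ, X τ ∈ Q := fun τ => hF.mem (bdryCurve_mem hq α β τ)
    have hX0 : X 0 = γ s := by simp [hX, bdryCurve_zero, hqs]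
    have hX'0 : deriv X 0 = A (bdryTangent q α β) := by
      rw [(hF.hasDerivAt_comp_bdryCurve hq α β 0).deriv, bdryCurve_zero]
    have hXd : ∀ τ, HasDerivAt X (deriv X τ) τ := fun τ =>
      (hXs.differentiable (by simp) τ).hasDerivAt
    have h1 : ∀ τ, fderivWithin ℝ ψ Q (X τ) (deriv X τ) = 0 := by
      intro τ
      rw [(hF.hasDerivAt_comp_bdryCurve hq α β τ).deriv]
      exact hF.apply_bdryTangent_eq_zero hdψ hc (bdryCurve_mem hq α β τ)
        (by rw [norm_bdryCurve, hq1]) α β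
    have h2 : HasDerivAt (fun τ => fderivWithin ℝ ψ Q (X τ))
        (fderivWithin ℝ (fderivWithin ℝ ψ Q) Q (X 0) (deriv X 0)) 0 := by
      rw [← hasDerivWithinAt_univ]
      exact (hd2' _ (hXQ 0)).hasFDerivWithinAt.comp_hasDerivWithinAt 0
        (hXd 0).hasDerivWithinAt fun t _ => hXQ t
    have h3 : HasDerivAt (deriv X) (deriv (deriv X) 0) 0 :=
      ((contDiff_infty_iff_deriv.1 hXs).2.differentiable (by simp) 0).hasDerivAt
    have h4 := h2.clm_apply h3
    rw [funext h1] at h4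
    have h5 := h4.unique (hasDerivAt_const 0 (0 : ℝ))
    rw [hX0, h0, zero_apply, add_zero, hX'0] at h5
    exact hhess s _ hA0 hperp h5
  have hint : ∀ s, γ s ∈ interior Q := by
    intro s
    by_contra h
    refine hfront (γ s) ?_ (grad_eq_zero_iff.1 (hmem s).2)
    rw [hF.isCompact.isClosed.frontier_eq]
    exact ⟨(hmem s).1, h⟩
  have hval : ∀ s, HasDerivAt (fun s => ψ (γ s)) 0 s := by
    intro s
    refine (hasDerivAt_comp_of_mem (fun x hx => (hdψ x hx).hasFDerivWithinAt)
      (fun t => (hmem t).1) (hγ.differentiable (by simp) s).hasDerivAt).congr_deriv ?_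
    rw [grad_eq_zero_iff.1 (hmem s).2]
    rfl
  refine ⟨γ, ψ (γ 0), hψ, hγ, hint, fun s => ?_, hc, hfront,
    fun s => grad_eq_zero_iff.1 (hmem s).2, hcrit, fun s => ?_⟩
  · exact is_const_of_deriv_eq_zero (fun s => (hval s).differentiableAt)
      (fun s => (hval s).deriv) s 0
  · obtain ⟨v, hv, hv'⟩ := exists_ne_zero_dotProduct_eq_zero (deriv γ s)
    exact ⟨v, hhess s v hv hv'⟩

/-- Used for the closedness of `(f - m) b(ψ) dψ`: `D` is the second derivative of `ψ`, `A` the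
derivative of the coefficient and `B` is `dψ`. -/
theorem smulRight_symm_aux {r : ℝ} {A : R3 →L[ℝ] ℝ} {D : R3 →L[ℝ] R3 →L[ℝ] ℝ}
    {B : R3 →L[ℝ] ℝ} (hD : ∀ v w, D v w = D w v) (hAB : ∀ v w, A v * B w = A w * B v) (v w : R3) :
    (r • D + A.smulRight B) v w = (r • D + A.smulRight B) w v := by
  simp [hD v w, hAB v w]

/-! ### Values of `ψ` and separation of its level sets -/

namespace AxisData

variable {Q : Set R3} {F : ℂ × ℝ → R3} {ψ : R3 → ℝ} {γ : ℝ → R3} {a c : ℝ}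

theorem neg (h : AxisData Q ψ γ a c) (hF : IsChart Q F) :
    AxisData Q (fun x => -ψ x) γ (-a) (-c) := by
  have hu := hF.uniqueDiffOn
  have h1 : ∀ x ∈ Q, fderivWithin ℝ (fun x => -ψ x) Q x = -fderivWithin ℝ ψ Q x := fun x hx =>
    fderivWithin_fun_neg (hu x hx)
  have haQ : ∀ s, γ s ∈ Q := fun s => interior_subset (h.axis_mem s)
  refine ⟨h.smooth.neg, h.smooth_axis, h.axis_mem, fun s => by rw [h.axis_value],
    fun x hx => by rw [h.frontier_value x hx], fun x hx => ?_, fun s => ?_, fun x hx hx0 => ?_,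
    fun s => ?_⟩
  · rw [h1 x (hF.isCompact.isClosed.frontier_subset hx)]
    exact neg_ne_zero.2 (h.frontier_deriv x hx)
  · rw [h1 _ (haQ s)]
    exact neg_eq_zero.2 (h.axis_deriv s)
  · rw [h1 x hx] at hx0
    exact h.mem_axis x hx (neg_eq_zero.1 hx0)
  · obtain ⟨v, hv⟩ := h.axis_hess s
    refine ⟨v, ?_⟩
    have h2 : fderivWithin ℝ (fun x => -fderivWithin ℝ ψ Q x) Q (γ s) =
        -fderivWithin ℝ (fderivWithin ℝ ψ Q) Q (γ s) := fderivWithin_fun_neg (hu _ (haQ s))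
    rw [fderivWithin_congr h1 (h1 _ (haQ s)), h2]
    simpa using hv

theorem differentiableOn (h : AxisData Q ψ γ a c) : DifferentiableOn ℝ ψ Q :=
  h.smooth.differentiableOn (by simp)

theorem contDiffOn_fderivWithin (h : AxisData Q ψ γ a c) (hF : IsChart Q F) :
    ContDiffOn ℝ ∞ (fderivWithin ℝ ψ Q) Q := h.smooth.fderivWithin hF.uniqueDiffOn (by simp)

theorem mem_interior_of_ne (h : AxisData Q ψ γ a c) {x : R3} (hx : x ∈ Q) (hxc : ψ x ≠ c) :
    x ∈ interior Q := by
  by_contra hcon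
  exact hxc (h.frontier_value x ⟨subset_closure hx, hcon⟩)

theorem frontier_nonempty (hF : IsChart Q F) : F (1, 0) ∈ frontier Q :=
  (hF.mem_frontier_iff (by simp)).2 (by simp)

theorem value_of_isExtr (h : AxisData Q ψ γ a c) {x : R3} (hx : x ∈ Q)
    (he : IsExtrOn ψ Q x) : ψ x = a ∨ ψ x = c := by
  by_cases hxc : ψ x = c
  · exact Or.inr hxc
  · left
    have hi := h.mem_interior_of_ne hx hxc
    have hn : Q ∈ 𝓝 x := mem_interior_iff_mem_nhds.1 hi
    have h0 : fderivWithin ℝ ψ Q x = 0 := by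
      rw [fderivWithin_of_mem_nhds hn]
      exact (he.isLocalExtr hn).fderiv_eq_zero
    obtain ⟨s, rfl⟩ := h.mem_axis x hx h0
    exact h.axis_value s

/-- If the two values agreed, all extreme values of `ψ` would coincide and `ψ` would be constant,
against its nonzero derivative on the boundary. -/
theorem ne (h : AxisData Q ψ γ a c) (hF : IsChart Q F) : a ≠ c := by
  rintro rfl
  obtain ⟨x, hx, hxm⟩ := hF.isCompact.exists_isMinOn hF.nonempty h.smooth.continuousOn
  obtain ⟨y, hy, hym⟩ := hF.isCompact.exists_isMaxOn hF.nonempty h.smooth.continuousOn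
  have h1 : ψ x = a := by simpa using h.value_of_isExtr hx (Or.inl hxm)
  have h2 : ψ y = a := by simpa using h.value_of_isExtr hy (Or.inr hym)
  have h3 : EqOn ψ (fun _ => a) Q := fun z hz =>
    le_antisymm (h2 ▸ hym hz) (h1 ▸ hxm hz)
  have hfr := frontier_nonempty hF
  have hfQ := hF.isCompact.isClosed.frontier_subset hfr
  apply h.frontier_deriv _ hfr
  rw [fderivWithin_congr h3 (h3 hfQ)]
  simp

theorem le_value (h : AxisData Q ψ γ a c) (hF : IsChart Q F) (hac : a < c) {x : R3} (hx : x ∈ Q) :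
    a ≤ ψ x := by
  obtain ⟨y, hy, hym⟩ := hF.isCompact.exists_isMinOn hF.nonempty h.smooth.continuousOn
  have h1 : ψ y ≤ ψ x := hym hx
  rcases h.value_of_isExtr hy (Or.inl hym) with h2 | h2 <;> linarith

theorem value_le (h : AxisData Q ψ γ a c) (hF : IsChart Q F) (hac : a < c) {x : R3} (hx : x ∈ Q) :
    ψ x ≤ c := by
  obtain ⟨y, hy, hym⟩ := hF.isCompact.exists_isMaxOn hF.nonempty h.smooth.continuousOn
  have h1 : ψ x ≤ ψ y := hym hx
  rcases h.value_of_isExtr hy (Or.inr hym) with h2 | h2 <;> linarith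

theorem mem_Ioo_of_mem_interior (h : AxisData Q ψ γ a c) (hF : IsChart Q F) (hac : a < c) {x : R3}
    (hx : x ∈ interior Q) (hx0 : fderivWithin ℝ ψ Q x ≠ 0) : ψ x ∈ Ioo a c := by
  have hxQ := interior_subset hx
  have hn : Q ∈ 𝓝 x := mem_interior_iff_mem_nhds.1 hx
  rw [fderivWithin_of_mem_nhds hn] at hx0
  refine ⟨(h.le_value hF hac hxQ).lt_of_ne fun he => hx0 ?_,
    (h.value_le hF hac hxQ).lt_of_ne fun he => hx0 ?_⟩
  · refine IsLocalMin.fderiv_eq_zero ?_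
    filter_upwards [hn] with y hy
    rw [← he]
    exact h.le_value hF hac hy
  · refine IsLocalMax.fderiv_eq_zero ?_
    filter_upwards [hn] with y hy
    rw [he]
    exact h.value_le hF hac hy

theorem deriv_ne_zero (h : AxisData Q ψ γ a c) {x : R3} (hx : x ∈ Q) (hxa : ψ x ≠ a) :
    fderivWithin ℝ ψ Q x ≠ 0 := by
  intro h0
  obtain ⟨s, rfl⟩ := h.mem_axis x hx h0
  exact hxa (h.axis_value s)

/-- The regular points of `ψ` in the interior are dense. -/
theorem subset_closure_regular (h : AxisData Q ψ γ a c) (hF : IsChart Q F) :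
    Q ⊆ closure {x ∈ interior Q | fderivWithin ℝ ψ Q x ≠ 0} := by
  refine hF.subset_closure_interior.trans (closure_minimal (fun x hx => ?_) isClosed_closure)
  by_contra hcon
  rw [mem_closure_iff_frequently, not_frequently] at hcon
  -- An open set of critical points would meet the axis at a point where the Hessian vanishes.
  have hev : ∀ᶠ y in 𝓝 x, fderivWithin ℝ ψ Q y = 0 := by
    filter_upwards [hcon, isOpen_interior.mem_nhds hx] with y hy hyi
    by_contra hne
    exact hy ⟨hyi, hne⟩
  obtain ⟨s, rfl⟩ := h.mem_axis x (interior_subset hx) hev.self_of_nhds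
  obtain ⟨v, hv⟩ := h.axis_hess s
  apply hv
  have : fderivWithin ℝ ψ Q =ᶠ[𝓝 (γ s)] fun _ => 0 := hev
  rw [(this.filter_mono nhdsWithin_le_nhds).fderivWithin_eq this.eq_of_nhds]
  simp

/-- A function which is locally constant where `ψ` is small takes the same value somewhere on the
boundary or at a critical point of `ψ`. -/
theorem exists_eq_of_locallyConst (hQ : IsCompact Q) {ψ H : R3 → ℝ} (hψ : ContinuousOn ψ Q)
    (hH : ContinuousOn H Q) {x : R3} (hx : x ∈ Q)
    (hloc : ∀ y ∈ interior Q, ψ y ≤ ψ x → ∀ᶠ z in 𝓝 y, H z = H y) :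
    ∃ y ∈ Q, ψ y ≤ ψ x ∧ H y = H x ∧ (y ∈ frontier Q ∨ fderivWithin ℝ ψ Q y = 0) := by
  set S : Set R3 := Q ∩ H ⁻¹' {H x} with hS
  have hSc : IsCompact S :=
    hQ.of_isClosed_subset (hH.preimage_isClosed_of_isClosed hQ.isClosed isClosed_singleton)
      inter_subset_left
  -- Minimize `ψ` on the level set of `H` through `x`. Near an interior minimizer `H` is constant,
  -- so all nearby points compete and the minimizer is a local minimum of `ψ`.
  obtain ⟨y, hy, hym⟩ := hSc.exists_isMinOn ⟨x, hx, rfl⟩ (hψ.mono inter_subset_left)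
  have hyx : ψ y ≤ ψ x := hym ⟨hx, rfl⟩
  refine ⟨y, hy.1, hyx, hy.2, ?_⟩
  by_cases hyi : y ∈ interior Q
  · right
    have hn : Q ∈ 𝓝 y := mem_interior_iff_mem_nhds.1 hyi
    rw [fderivWithin_of_mem_nhds hn]
    refine IsLocalMin.fderiv_eq_zero ?_
    filter_upwards [hn, hloc y hyi hyx] with z hz hzH
    exact hym ⟨hz, hzH.trans hy.2⟩
  · exact Or.inl ⟨subset_closure hy.1, hyi⟩

/-- Near a regular interior point there is a segment along which `ψ` increases. -/
theorem exists_segment (h : AxisData Q ψ γ a c) (hF : IsChart Q F) {x : R3} (hx : x ∈ interior Q)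
    (hx0 : fderivWithin ℝ ψ Q x ≠ 0) {p : R3 → Prop} (hp : ∀ᶠ y in 𝓝 x, p y) :
    ∃ (v : R3) (δ : ℝ), 0 < δ ∧ ∀ s ∈ Icc (-δ) δ, x + s • v ∈ interior Q ∧
      0 < fderivWithin ℝ ψ Q (x + s • v) v ∧ p (x + s • v) := by
  obtain ⟨v, hv⟩ : ∃ v, 0 < fderivWithin ℝ ψ Q x v := by
    by_contra! hcon
    apply hx0
    ext1 v
    have h1 := hcon v
    have h2 := hcon (-v)
    rw [map_neg] at h2
    exact le_antisymm h1 (by simpa using h2)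
  have hn : Q ∈ 𝓝 x := mem_interior_iff_mem_nhds.1 hx
  have hcd : ContinuousAt (fun y => fderivWithin ℝ ψ Q y v) x :=
    ((h.contDiffOn_fderivWithin hF).continuousOn.continuousAt hn).clm_apply continuousAt_const
  have hev : ∀ᶠ y in 𝓝 x, y ∈ interior Q ∧ 0 < fderivWithin ℝ ψ Q y v ∧ p y :=
    (show ∀ᶠ y in 𝓝 x, y ∈ interior Q from isOpen_interior.mem_nhds hx).and ((hcd.eventually_const_lt hv).and hp)
  have hcs : ContinuousAt (fun s : ℝ => x + s • v) 0 := by fun_prop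
  have hev' : ∀ᶠ s in 𝓝 (0 : ℝ), x + s • v ∈ interior Q ∧
      0 < fderivWithin ℝ ψ Q (x + s • v) v ∧ p (x + s • v) :=
    hcs.eventually (p := fun y => y ∈ interior Q ∧ 0 < fderivWithin ℝ ψ Q y v ∧ p y)
      (by dsimp only; rw [zero_smul, add_zero]; exact hev)
  obtain ⟨δ, hδ, hball⟩ := Metric.eventually_nhds_iff_ball.1 hev'
  refine ⟨v, δ / 2, by positivity, fun s hs => hball s ?_⟩
  rw [mem_ball_zero_iff, Real.norm_eq_abs, abs_lt]
  constructor <;> linarith [hs.1, hs.2]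

theorem hasDerivAt_segment (x v : R3) (s : ℝ) : HasDerivAt (fun s : ℝ => x + s • v) v s := by
  simpa using ((hasDerivAt_id' s).smul_const v).const_add x

theorem hasDerivAt_comp_segment {H : R3 → ℝ} {η : R3 → R3 →L[ℝ] ℝ}
    (hH : ∀ x ∈ Q, HasFDerivWithinAt H (η x) Q x) {x v : R3} {s : ℝ} (hs : x + s • v ∈ interior Q) :
    HasDerivAt (fun s : ℝ => H (x + s • v)) (η (x + s • v) v) s :=
  ((hH _ (interior_subset hs)).hasFDerivAt (mem_interior_iff_mem_nhds.1 hs)).comp_hasDerivAt s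
    (hasDerivAt_segment x v s)

theorem strictMonoOn_segment (h : AxisData Q ψ γ a c) {x v : R3} {δ : ℝ}
    (hs : ∀ s ∈ Icc (-δ) δ, x + s • v ∈ interior Q ∧ 0 < fderivWithin ℝ ψ Q (x + s • v) v) :
    StrictMonoOn (fun s : ℝ => ψ (x + s • v)) (Icc (-δ) δ) := by
  have hd : ∀ s ∈ Icc (-δ) δ, HasDerivAt (fun s : ℝ => ψ (x + s • v))
      (fderivWithin ℝ ψ Q (x + s • v) v) s := fun s hs' =>
    hasDerivAt_comp_segment (fun y hy => (h.differentiableOn y hy).hasFDerivWithinAt) (hs s hs').1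
  refine strictMonoOn_of_deriv_pos (convex_Icc _ _)
    (fun s hs' => (hd s hs').continuousAt.continuousWithinAt) fun s hs' => ?_
  rw [(hd s (interior_subset hs')).deriv]
  exact (hs s (interior_subset hs')).2

/-- A substitute for connectedness of level sets. With `f y < m < f x` and `b` a bump at the common
level `t`, the form `(f - m) b(ψ) dψ` has a primitive `H`, constant below the band around `t` and
constant above it. Crossing the band near `x` makes the upper value at least the lower one, crossing
near `y` at most. So they are equal, and the monotone `H` is constant along the segment at `x`,
where its derivative is positive. -/
theorem not_lt_of_value_eq (h : AxisData Q ψ γ a c) (hF : IsChart Q F) {f : R3 → ℝ}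
    (hf : ContDiffOn ℝ ∞ f Q)
    (hpar : ∀ x ∈ Q, ∀ v w, fderivWithin ℝ f Q x v * fderivWithin ℝ ψ Q x w =
      fderivWithin ℝ f Q x w * fderivWithin ℝ ψ Q x v)
    {x y : R3} (hx : x ∈ Q) (hy : y ∈ Q) (hxy : ψ x = ψ y) (hxI : ψ x ∈ Ioo a c) :
    ¬ f y < f x := by
  intro hlt
  obtain ⟨m, hym, hmx⟩ := exists_between hlt
  set t := ψ x with ht
  have hyI : ψ y ∈ Ioo a c := hxy ▸ hxI
  have hxi := h.mem_interior_of_ne hx hxI.2.ne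
  have hyi := h.mem_interior_of_ne hy hyI.2.ne
  have hfc : ∀ z ∈ interior Q, ContinuousAt f z := fun z hz =>
    hf.continuousOn.continuousAt (mem_interior_iff_mem_nhds.1 hz)
  obtain ⟨v, δ, hδ, hv⟩ := h.exists_segment hF hxi (h.deriv_ne_zero hx hxI.1.ne')
    ((hfc x hxi).eventually_const_lt hmx)
  obtain ⟨w, δ', hδ', hw⟩ := h.exists_segment hF hyi (h.deriv_ne_zero hy hyI.1.ne')
    ((hfc y hyi).eventually_lt_const hym)
  have hmonx := h.strictMonoOn_segment fun s hs => ⟨(hv s hs).1, (hv s hs).2.1⟩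
  have hmony := h.strictMonoOn_segment fun s hs => ⟨(hw s hs).1, (hw s hs).2.1⟩
  have m1 : (0 : ℝ) ∈ Icc (-δ) δ := ⟨by linarith, by linarith⟩
  have m2 : -δ ∈ Icc (-δ) δ := ⟨by linarith, by linarith⟩
  have m3 : δ ∈ Icc (-δ) δ := ⟨by linarith, by linarith⟩
  have n1 : (0 : ℝ) ∈ Icc (-δ') δ' := ⟨by linarith, by linarith⟩
  have n2 : -δ' ∈ Icc (-δ') δ' := ⟨by linarith, by linarith⟩
  have n3 : δ' ∈ Icc (-δ') δ' := ⟨by linarith, by linarith⟩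
  have ineq1 : ψ (x + (-δ) • v) < t := by
    simpa [← ht] using hmonx m2 m1 (by linarith)
  have ineq2 : t < ψ (x + δ • v) := by
    simpa [← ht] using hmonx m1 m3 (by linarith)
  have ineq3 : ψ (y + (-δ') • w) < t := by
    simpa [← hxy] using hmony n2 n1 (by linarith)
  have ineq4 : t < ψ (y + δ' • w) := by
    simpa [← hxy] using hmony n1 n3 (by linarith)
  -- The band of half-width `ε` must leave out the endpoints of both segments, the axis value `a`
  -- and the boundary value `c`.
  obtain ⟨ε, hε, hε1, hε2, hε3, hε4, hε5, hε6⟩ : ∃ ε > 0, ψ (x + (-δ) • v) < t - ε ∧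
      t + ε < ψ (x + δ • v) ∧ ψ (y + (-δ') • w) < t - ε ∧ t + ε < ψ (y + δ' • w) ∧
      a < t - ε ∧ t + ε < c := by
    have key : ∀ᶠ ε in 𝓝[>] (0 : ℝ), ψ (x + (-δ) • v) < t - ε ∧
      t + ε < ψ (x + δ • v) ∧ ψ (y + (-δ') • w) < t - ε ∧ t + ε < ψ (y + δ' • w) ∧
      a < t - ε ∧ t + ε < c := by
      have c1 : ContinuousAt (fun ε : ℝ => t - ε) 0 := by fun_prop
      have c2 : ContinuousAt (fun ε : ℝ => t + ε) 0 := by fun_prop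
      apply nhdsWithin_le_nhds
      exact (c1.eventually_const_lt (by simpa using ineq1)).and
        ((c2.eventually_lt_const (by simpa using ineq2)).and
        ((c1.eventually_const_lt (by simpa using ineq3)).and
        ((c2.eventually_lt_const (by simpa using ineq4)).and
        ((c1.eventually_const_lt (by simpa using hxI.1)).and
        (c2.eventually_lt_const (by simpa using hxI.2))))))
    obtain ⟨ε, h1, h2⟩ := (key.and self_mem_nhdsWithin).exists
    exact ⟨ε, h2, h1⟩
  let b : ContDiffBump t := ⟨ε / 2, ε, by positivity, by linarith⟩
  have hb0 : ∀ r, r < t - ε ∨ t + ε < r → b r = 0 := by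
    intro r hr
    refine b.zero_of_le_dist ?_
    change ε ≤ dist r t
    rw [Real.dist_eq]
    rcases hr with hr | hr
    · rw [abs_of_neg] <;> linarith
    · rw [abs_of_pos] <;> linarith
  have hbt : b t = 1 := b.eventuallyEq_one.eq_of_nhds
  have hdψ := h.differentiableOn
  have hdf : DifferentiableOn ℝ f Q := hf.differentiableOn (by simp)
  have hd2 : DifferentiableOn ℝ (fderivWithin ℝ ψ Q) Q :=
    (h.contDiffOn_fderivWithin hF).differentiableOn (by simp)
  set η : R3 → R3 →L[ℝ] ℝ := fun z => ((f z - m) * b (ψ z)) • fderivWithin ℝ ψ Q z with hη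
  have hbd : ∀ r, HasDerivAt b (deriv b r) r := fun r =>
    ((b.contDiff (n := 1)).differentiable (by simp) r).hasDerivAt
  have hηd : ∀ z ∈ Q, HasFDerivWithinAt η _ Q z := fun z hz =>
    (((hdf z hz).hasFDerivWithinAt.sub_const m).fun_mul
      ((hbd (ψ z)).comp_hasFDerivWithinAt z (hdψ z hz).hasFDerivWithinAt)).fun_smul
      (hd2 z hz).hasFDerivWithinAt
  have hu := hF.uniqueDiffOn
  obtain ⟨H, hH⟩ := hF.exists_primitive (β := η) (fun z hz => (hηd z hz).differentiableWithinAt)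
    (fun z hz v w => by
      rw [(hηd z hz).fderivWithin (hu z hz)]
      refine smulRight_symm_aux ?_ ?_ v w
      · exact (h.smooth z hz).isSymmSndFDerivWithinAt (by
          rw [minSmoothness_of_isRCLikeNormedField]; exact WithTop.coe_le_coe.2 le_top) hu
          (hF.subset_closure_interior hz) hz
      · intro v w
        have := hpar z hz v w
        simp only [Function.comp_apply, add_apply, smul_apply, smul_eq_mul]
        linear_combination b (ψ z) * this) (fun s => by
      have hfr : F (1, s) ∈ frontier Q := (hF.mem_frontier_iff (by simp)).2 (by simp)
      have : b (ψ (F (1, s))) = 0 := hb0 _ (Or.inr (by rwa [h.frontier_value _ hfr]))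
      simp [hη, this])
  have hHc : ContinuousOn H Q := fun z hz => (hH z hz).continuousWithinAt
  have hconst : ∀ z ∈ interior Q, (∀ᶠ r in 𝓝 z, b (ψ r) = 0) → ∀ᶠ r in 𝓝 z, H r = H z := by
    intro z hz hev
    obtain ⟨ρ, hρ, hball⟩ := Metric.eventually_nhds_iff_ball.1
      (hev.and (isOpen_interior.mem_nhds hz))
    filter_upwards [Metric.ball_mem_nhds z hρ] with r hr
    have hdH : ∀ r ∈ Metric.ball z ρ, HasFDerivAt H (0 : R3 →L[ℝ] ℝ) r := by
      intro r hr
      have h1 := (hH r (interior_subset (hball r hr).2)).hasFDerivAt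
        (mem_interior_iff_mem_nhds.1 (hball r hr).2)
      simpa [hη, (hball r hr).1] using h1
    exact (convex_ball z ρ).is_const_of_fderivWithin_eq_zero (𝕜 := ℝ)
      (fun r hr => (hdH r hr).differentiableAt.differentiableWithinAt)
      (fun r hr => by
        rw [fderivWithin_of_isOpen Metric.isOpen_ball hr, (hdH r hr).fderiv]) hr
      (Metric.mem_ball_self hρ)
  have hψc : ∀ z ∈ interior Q, ContinuousAt ψ z := fun z hz =>
    h.smooth.continuousOn.continuousAt (mem_interior_iff_mem_nhds.1 hz)
  -- Below the band `H` is locally constant, so its value is already taken at a critical point of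
  -- `ψ`, the boundary being above the band. Critical points form the axis, along which `H` is
  -- constant because `dψ` vanishes.
  have hlow : ∀ z ∈ Q, ψ z < t - ε → H z = H (γ 0) := by
    intro z hz hzt
    obtain ⟨r, hr, hrz, hHr, hor⟩ := exists_eq_of_locallyConst hF.isCompact h.smooth.continuousOn
      hHc hz (fun r hr hrz => hconst r hr (by
        filter_upwards [(hψc r hr).eventually_lt_const (hrz.trans_lt hzt)] with p hp
        exact hb0 _ (Or.inl hp)))
    rw [← hHr]
    rcases hor with hfr | h0
    · rw [h.frontier_value r hfr] at hrz
      linarith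
    · obtain ⟨s, rfl⟩ := h.mem_axis r hr h0
      have hd : ∀ s, HasDerivAt (fun s => H (γ s)) 0 s := fun s => by
        refine (hasDerivAt_comp_of_mem hH (fun s => interior_subset (h.axis_mem s))
          (h.smooth_axis.differentiable (by simp) s).hasDerivAt).congr_deriv ?_
        simp [hη, h.axis_deriv]
      exact is_const_of_deriv_eq_zero (fun s => (hd s).differentiableAt)
        (fun s => (hd s).deriv) s 0
  obtain ⟨c₁, hc₁⟩ := hF.exists_const_frontier hH (fun q hq hq1 α β => by
    have hfr : F q ∈ frontier Q := (hF.mem_frontier_iff hq).2 hq1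
    have : b (ψ (F q)) = 0 := hb0 _ (Or.inr (by rwa [h.frontier_value _ hfr]))
    simp [hη, this])
  -- The same argument for `-ψ`: above the band the value is found on the boundary, where `H` is
  -- constant because `b(ψ)` vanishes.
  have hhigh : ∀ z ∈ Q, t + ε < ψ z → H z = c₁ := by
    intro z hz hzt
    obtain ⟨r, hr, hrz, hHr, hor⟩ := exists_eq_of_locallyConst hF.isCompact (h.neg hF).smooth.continuousOn
      hHc hz (fun r hr hrz => hconst r hr (by
        have hrz' : ψ z ≤ ψ r := by linarith
        filter_upwards [(hψc r hr).eventually_const_lt (hzt.trans_le hrz')] with p hp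
        exact hb0 _ (Or.inr hp)))
    rw [← hHr]
    rcases hor with hfr | h0
    · exact hc₁ r hfr
    · obtain ⟨s, rfl⟩ := (h.neg hF).mem_axis r hr h0
      rw [h.axis_value] at hrz
      linarith [hxI.1]
  have hHx : ∀ s ∈ Icc (-δ) δ, HasDerivAt (fun s : ℝ => H (x + s • v)) (η (x + s • v) v) s :=
    fun s hs => hasDerivAt_comp_segment hH (hv s hs).1
  have hHy : ∀ s ∈ Icc (-δ') δ', HasDerivAt (fun s : ℝ => H (y + s • w)) (η (y + s • w) w) s :=
    fun s hs => hasDerivAt_comp_segment hH (hw s hs).1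
  have hmono : MonotoneOn (fun s : ℝ => H (x + s • v)) (Icc (-δ) δ) := by
    refine monotoneOn_of_deriv_nonneg (convex_Icc _ _)
      (fun s hs => (hHx s hs).continuousAt.continuousWithinAt)
      (fun s hs => (hHx s (interior_subset hs)).differentiableAt.differentiableWithinAt)
      fun s hs => ?_
    rw [(hHx s (interior_subset hs)).deriv]
    obtain ⟨-, h2, h3⟩ := hv s (interior_subset hs)
    simp only [hη, smul_apply, smul_eq_mul]
    exact mul_nonneg (mul_nonneg (by linarith) b.nonneg) h2.le
  have hanti : AntitoneOn (fun s : ℝ => H (y + s • w)) (Icc (-δ') δ') := by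
    refine antitoneOn_of_deriv_nonpos (convex_Icc _ _)
      (fun s hs => (hHy s hs).continuousAt.continuousWithinAt)
      (fun s hs => (hHy s (interior_subset hs)).differentiableAt.differentiableWithinAt)
      fun s hs => ?_
    rw [(hHy s (interior_subset hs)).deriv]
    obtain ⟨-, h2, h3⟩ := hw s (interior_subset hs)
    simp only [hη, smul_apply, smul_eq_mul]
    exact mul_nonpos_of_nonpos_of_nonneg
      (mul_nonpos_of_nonpos_of_nonneg (by linarith) b.nonneg) h2.le
  have e1 := hlow _ (interior_subset (hv _ m2).1) hε1
  have e2 := hhigh _ (interior_subset (hv _ m3).1) hε2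
  have e3 := hlow _ (interior_subset (hw _ n2).1) hε3
  have e4 := hhigh _ (interior_subset (hw _ n3).1) hε4
  have hle : c₁ ≤ H (γ 0) := by
    rw [← e3, ← e4]
    exact hanti n2 n3 (by linarith)
  have hEq : (fun s : ℝ => H (x + s • v)) =ᶠ[𝓝 0] fun _ => H (γ 0) := by
    filter_upwards [Icc_mem_nhds (show -δ < 0 by linarith) hδ] with s hs
    have i1 : H (x + (-δ) • v) ≤ H (x + s • v) := hmono m2 hs hs.1
    have i2 : H (x + s • v) ≤ H (x + δ • v) := hmono hs m3 hs.2
    rw [e1] at i1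
    rw [e2] at i2
    linarith
  have hd0 := (hHx 0 m1).deriv
  rw [hEq.deriv_eq, deriv_const] at hd0
  obtain ⟨-, h2, h3⟩ := hv 0 m1
  simp only [zero_smul, add_zero] at hd0 h2 h3
  simp only [hη, smul_apply, smul_eq_mul, ← ht, hbt, mul_one] at hd0
  have : 0 < (f x - m) * fderivWithin ℝ ψ Q x v := mul_pos (by linarith) h2
  linarith

end AxisData

/-! ### Functions with differential parallel to `dψ` are smooth functions of `ψ` -/

namespace AxisData

variable {Q : Set R3} {F : ℂ × ℝ → R3} {ψ : R3 → ℝ} {γ : ℝ → R3} {a c : ℝ}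

theorem contDiffAt_of_mem_interior {f : R3 → ℝ} (hf : ContDiffOn ℝ ∞ f Q) {x : R3}
    (hx : x ∈ interior Q) : ContDiffAt ℝ ∞ f x :=
  hf.contDiffAt (mem_interior_iff_mem_nhds.1 hx)

/-- A curve through the axis along which `ψ` has a nondegenerate critical point. -/
theorem exists_axis_curve (h : AxisData Q ψ γ a c) (hF : IsChart Q F) :
    ∃ (σ : ℝ → R3) (k : ℝ → ℝ), ContDiff ℝ ∞ σ ∧ ContDiff ℝ ∞ k ∧ (∀ s, σ s ∈ Q) ∧ k 0 ≠ 0 ∧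
      ∀ s, ψ (σ s) = a + s ^ 2 * k s := by
  obtain ⟨v, hv⟩ := h.axis_hess 0
  obtain ⟨ε, hε, hball⟩ := Metric.mem_nhds_iff.1 (isOpen_interior.mem_nhds (h.axis_mem 0))
  obtain ⟨r, hr, hrε⟩ : ∃ r : ℝ, 0 < r ∧ r * ‖v‖ < ε := by
    refine ⟨ε / (‖v‖ + 1), by positivity, ?_⟩
    rw [div_mul_eq_mul_div, div_lt_iff₀ (by positivity)]
    nlinarith [norm_nonneg v]
  -- The sine keeps the curve in a ball inside `Q` for all times, while its velocity at `0` is `r •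
  -- v`.
  set σ : ℝ → R3 := fun s => γ 0 + (r * Real.sin s) • v with hσ
  have hσs : ContDiff ℝ ∞ σ :=
    contDiff_const.add ((contDiff_const.mul Real.contDiff_sin).smul contDiff_const)
  have hσi : ∀ s, σ s ∈ interior Q := by
    intro s
    apply hball
    rw [Metric.mem_ball, dist_eq_norm]
    have h1 : ‖σ s - γ 0‖ = r * |Real.sin s| * ‖v‖ := by
      simp [hσ, norm_smul, abs_of_pos hr]
    rw [h1]
    have := Real.abs_sin_le_one s
    have h2 : r * |Real.sin s| * ‖v‖ ≤ r * 1 * ‖v‖ := by gcongr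
    linarith
  have hg : ContDiff ℝ ∞ fun s => ψ (σ s) := contDiff_iff_contDiffAt.2 fun s =>
    (contDiffAt_of_mem_interior h.smooth (hσi s)).comp s hσs.contDiffAt
  have hσd : ∀ s, HasDerivAt σ ((r * Real.cos s) • v) s := fun s =>
    ((((Real.hasDerivAt_sin s).const_mul r).smul_const v).const_add (γ 0))
  have hd1 : ∀ s, HasDerivAt (fun s => ψ (σ s))
      (fderivWithin ℝ ψ Q (σ s) ((r * Real.cos s) • v)) s := fun s =>
    hasDerivAt_comp_of_mem (fun x hx => (h.differentiableOn x hx).hasFDerivWithinAt)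
      (fun s => interior_subset (hσi s)) (hσd s)
  have hσ0 : σ 0 = γ 0 := by simp [hσ]
  have hd2 : HasDerivAt (fun s => fderivWithin ℝ ψ Q (σ s) ((r * Real.cos s) • v))
      (fderivWithin ℝ (fderivWithin ℝ ψ Q) Q (σ 0) (r • v) (r • v)) 0 := by
    have e1 : HasDerivAt (fun s => fderivWithin ℝ ψ Q (σ s))
        (fderivWithin ℝ (fderivWithin ℝ ψ Q) Q (σ 0) ((r * Real.cos 0) • v)) 0 := by
      rw [← hasDerivWithinAt_univ]
      exact (((h.contDiffOn_fderivWithin hF).differentiableOn (by simp)) _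
        (interior_subset (hσi 0))).hasFDerivWithinAt.comp_hasDerivWithinAt 0
        (hσd 0).hasDerivWithinAt fun s _ => interior_subset (hσi s)
    have e2 : HasDerivAt (fun s => (r * Real.cos s) • v) ((r * -Real.sin 0) • v) 0 :=
      ((Real.hasDerivAt_cos 0).const_mul r).smul_const v
    refine (e1.clm_apply e2).congr_deriv ?_
    simp
  obtain ⟨k, hk, hk0, hgk⟩ := exists_eq_add_sq_mul hg (by
    rw [(hd1 0).deriv, hσ0, h.axis_deriv]
    simp) (by
    rw [show deriv (fun s => ψ (σ s)) = _ from funext fun s => (hd1 s).deriv, hd2.deriv, hσ0]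
    simp only [map_smul, smul_apply, smul_eq_mul]
    exact mul_ne_zero hr.ne' (mul_ne_zero hr.ne' hv))
  exact ⟨σ, k, hσs, hk, fun s => interior_subset (hσi s), hk0, fun s => by
    rw [hgk s, hσ0, h.axis_value]⟩

/-- A curve touching the boundary along which `ψ` has a nondegenerate critical point. -/
theorem exists_frontier_curve (h : AxisData Q ψ γ a c) (hF : IsChart Q F) :
    ∃ (σ : ℝ → R3) (k : ℝ → ℝ), ContDiff ℝ ∞ σ ∧ ContDiff ℝ ∞ k ∧ (∀ s, σ s ∈ Q) ∧ k 0 ≠ 0 ∧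
      ∀ s, ψ (σ s) = c + s ^ 2 * k s := by
  -- The cosine makes the curve reach the boundary at `s = 0` and turn back; the second derivative
  -- of `ψ` along it is minus the radial derivative, which is nonzero since all tangential ones
  -- vanish.
  set q : ℝ → ℂ × ℝ := fun s => ((Real.cos s : ℂ), 0) with hq
  have hqs : ContDiff ℝ ∞ q :=
    (Complex.ofRealCLM.contDiff.comp Real.contDiff_cos).prodMk contDiff_const
  have hqm : ∀ s, q s ∈ solidCyl := fun s => by
    refine ⟨?_, mem_univ _⟩
    rw [mem_closedBall_zero_iff, Complex.norm_real]
    exact Real.abs_cos_le_one s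
  have hqd : ∀ s, HasDerivAt q ((-Real.sin s) • ((1, 0) : ℂ × ℝ)) s := fun s => by
    have h1 := (Real.hasDerivAt_cos s).ofReal_comp.prodMk (hasDerivAt_const s (0 : ℝ))
    refine h1.congr_deriv ?_
    simp
  set m : ℝ → ℝ := fun s =>
    fderivWithin ℝ ψ Q (F (q s)) (fderivWithin ℝ F solidCyl (q s) (1, 0)) with hm
  have hms : ContDiff ℝ ∞ m := by
    have e1 : ContDiff ℝ ∞ fun s => fderivWithin ℝ ψ Q (F (q s)) :=
      (h.contDiffOn_fderivWithin hF).comp_contDiff (hF.smooth.comp_contDiff hqs hqm)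
        fun s => hF.mem (hqm s)
    have e2 : ContDiff ℝ ∞ fun s => fderivWithin ℝ F solidCyl (q s) :=
      (hF.smooth.fderivWithin uniqueDiffOn_solidCyl (by simp)).comp_contDiff hqs hqm
    exact e1.clm_apply (e2.clm_apply contDiff_const)
  have hq0 : q 0 = (1, 0) := by simp [hq]
  have hm0 : m 0 ≠ 0 := by
    intro h0
    have hfr := frontier_nonempty hF
    apply h.frontier_deriv _ hfr
    obtain ⟨L, hL⟩ := hF.exists_equiv (q := (1, 0)) (by simp)
    have hz : ∀ α β : ℝ, fderivWithin ℝ ψ Q (F (1, 0)) (L (bdryTangent (1, 0) α β)) = 0 := by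
      intro α β
      have := hF.apply_bdryTangent_eq_zero h.differentiableOn h.frontier_value
        (q := (1, 0)) (by simp) (by simp) α β
      rwa [← hL] at this
    have hz' : fderivWithin ℝ ψ Q (F (1, 0)) (L (1, 0)) = 0 := by
      simp only [hm, hq0, ← hL] at h0
      exact h0
    ext1 w
    obtain ⟨⟨z, s⟩, rfl⟩ := L.surjective w
    have hdec : ((z, s) : ℂ × ℝ) = z.re • ((1, 0) : ℂ × ℝ) + bdryTangent (1, 0) z.im s := by
      ext1
      · simp only [bdryTangent, Prod.smul_mk, Prod.mk_add_mk]
        conv_lhs => rw [← Complex.re_add_im z]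
        simp
      · simp [bdryTangent]
    rw [hdec, map_add, map_add, map_smul, map_smul, hz', hz]
    simp
  have hd1 : ∀ s, HasDerivAt (fun s => ψ (F (q s))) (-Real.sin s * m s) s := by
    intro s
    have e1 : HasDerivAt (fun s => F (q s))
        (fderivWithin ℝ F solidCyl (q s) ((-Real.sin s) • ((1, 0) : ℂ × ℝ))) s := by
      rw [← hasDerivWithinAt_univ]
      exact (hF.hasFDerivWithinAt (hqm s)).comp_hasDerivWithinAt s
        (hqd s).hasDerivWithinAt fun t _ => hqm t
    refine (hasDerivAt_comp_of_mem (fun x hx => (h.differentiableOn x hx).hasFDerivWithinAt)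
      (fun s => hF.mem (hqm s)) e1).congr_deriv ?_
    rw [map_smul, map_smul, smul_eq_mul]
  have hd2 : HasDerivAt (fun s => -Real.sin s * m s) (-m 0) 0 := by
    refine ((Real.hasDerivAt_sin 0).fun_neg.fun_mul
      (hms.differentiable (by simp) 0).hasDerivAt).congr_deriv ?_
    simp
  have hg : ContDiff ℝ ∞ fun s => ψ (F (q s)) :=
    h.smooth.comp_contDiff (hF.smooth.comp_contDiff hqs hqm) fun s => hF.mem (hqm s)
  obtain ⟨k, hk, hk0, hgk⟩ := exists_eq_add_sq_mul hg (by
    rw [(hd1 0).deriv]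
    simp) (by
    rw [show deriv (fun s => ψ (F (q s))) = _ from funext fun s => (hd1 s).deriv, hd2.deriv]
    exact neg_ne_zero.2 hm0)
  refine ⟨fun s => F (q s), k, hF.smooth.comp_contDiff hqs hqm, hk, fun s => hF.mem (hqm s), hk0,
    fun s => ?_⟩
  rw [hgk s, hq0, h.frontier_value _ (frontier_nonempty hF)]

theorem nonneg_of_sq_mul_nonneg {k : ℝ → ℝ} (hk : Continuous k) (h : ∀ s, 0 ≤ s ^ 2 * k s) :
    0 ≤ k 0 := by
  have h1 : Tendsto k (𝓝[≠] 0) (𝓝 (k 0)) := (hk.tendsto 0).mono_left nhdsWithin_le_nhds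
  refine ge_of_tendsto h1 ?_
  filter_upwards [self_mem_nhdsWithin] with s hs
  have : s ≠ 0 := hs
  exact nonneg_of_mul_nonneg_right (h s) (by positivity)

/-- `C` is read off from one chosen point on each level, and strictly between `a` and `c` the choice
is immaterial. It is smooth there because `ψ` can be inverted along a segment on which it increases;
the axis curve and the boundary curve control the two ends. -/
theorem exists_level_function_of_lt (h : AxisData Q ψ γ a c) (hF : IsChart Q F) (hac : a < c)
    {f : R3 → ℝ} (hf : ContDiffOn ℝ ∞ f Q)
    (hpar : ∀ x ∈ Q, ∀ v w, fderivWithin ℝ f Q x v * fderivWithin ℝ ψ Q x w =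
      fderivWithin ℝ f Q x w * fderivWithin ℝ ψ Q x v) :
    ∃ C : ℝ → ℝ, ContDiff ℝ ∞ C ∧ ∀ x ∈ Q, f x = C (ψ x) := by
  have hex : ∀ t ∈ Icc a c, ∃ x ∈ Q, ψ x = t := by
    intro t ht
    have hfr := frontier_nonempty hF
    have := hF.isPreconnected.intermediate_value (interior_subset (h.axis_mem 0))
      (hF.isCompact.isClosed.frontier_subset hfr) h.smooth.continuousOn
    rw [h.axis_value, h.frontier_value _ hfr] at this
    exact this ht
  choose! ξ hξ using hex
  set C : ℝ → ℝ := fun t => f (ξ t) with hCdef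
  have hC : ∀ x ∈ Q, ψ x ∈ Ioo a c → C (ψ x) = f x := by
    intro x hx hxI
    obtain ⟨h1, h2⟩ := hξ _ (Ioo_subset_Icc_self hxI)
    apply le_antisymm
    · exact not_lt.1 (h.not_lt_of_value_eq hF hf hpar h1 hx h2 (by rwa [h2]))
    · exact not_lt.1 (h.not_lt_of_value_eq hF hf hpar hx h1 h2.symm hxI)
  have hCs : ContDiffOn ℝ ∞ C (Ioo a c) := by
    intro t ht
    obtain ⟨hxQ, hxt⟩ := hξ _ (Ioo_subset_Icc_self ht)
    set x := ξ t
    have hxi := h.mem_interior_of_ne hxQ (hxt ▸ ht.2.ne)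
    obtain ⟨v, δ, hδ, hv⟩ := h.exists_segment hF hxi (h.deriv_ne_zero hxQ (hxt ▸ ht.1.ne'))
      (p := fun _ => True) (by simp)
    have hv0 := hv 0 ⟨by linarith, by linarith⟩
    have hgd : ContDiffAt ℝ ∞ (fun s : ℝ => ψ (x + s • v)) 0 :=
      (contDiffAt_of_mem_interior h.smooth hv0.1).comp (0 : ℝ)
        (contDiffAt_const.add (contDiffAt_id.smul contDiffAt_const))
    have hfd : ContDiffAt ℝ ∞ (fun s : ℝ => f (x + s • v)) 0 :=
      (contDiffAt_of_mem_interior hf hv0.1).comp (0 : ℝ)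
        (contDiffAt_const.add (contDiffAt_id.smul contDiffAt_const))
    have hgs : HasStrictDerivAt (fun s : ℝ => ψ (x + s • v))
        (fderivWithin ℝ ψ Q (x + (0 : ℝ) • v) v) 0 := by
      refine hgd.hasStrictDerivAt' (hasDerivAt_comp_segment
        (fun y hy => (h.differentiableOn y hy).hasFDerivWithinAt) hv0.1) (by simp)
    have hst := hgs.hasStrictFDerivAt_equiv hv0.2.1.ne'
    have hg0 : ψ (x + (0 : ℝ) • v) = t := by simp [hxt]
    have hinv := hgd.to_localInverse hst.hasFDerivAt (by simp)
    have hright := hst.eventually_right_inverse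
    set G := hgd.localInverse hst.hasFDerivAt (by simp) with hG
    have hG0 : G (ψ (x + (0 : ℝ) • v)) = 0 := hst.localInverse_apply_image
    have hright' : ∀ᶠ r in 𝓝 (ψ (x + (0 : ℝ) • v)), ψ (x + G r • v) = r := hright
    rw [hg0] at hinv hright' hG0
    have hGc : ContinuousAt G t := hinv.continuousAt
    have hmem : ∀ᶠ r in 𝓝 t, x + G r • v ∈ Q := by
      have e1 : ContinuousAt (fun r => x + G r • v) t := by fun_prop
      refine e1.eventually (p := fun y => y ∈ Q) ?_
      dsimp only
      rw [hG0]
      exact mem_interior_iff_mem_nhds.1 hv0.1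
    have hev : C =ᶠ[𝓝 t] fun r => f (x + G r • v) := by
      filter_upwards [hright', hmem, Ioo_mem_nhds ht.1 ht.2] with r h1 h2 h3
      have := hC _ h2 (by rwa [h1])
      rwa [h1] at this
    refine ContDiffAt.contDiffWithinAt (ContDiffAt.congr_of_eventuallyEq ?_ hev)
    refine ContDiffAt.comp t (g := fun s : ℝ => f (x + s • v)) ?_ hinv
    rwa [hG0]
  obtain ⟨σ, k, hσ, hk, hσQ, hk0, hσk⟩ := h.exists_axis_curve hF
  obtain ⟨σ', k', hσ', hk', hσQ', hk0', hσk'⟩ := h.exists_frontier_curve hF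
  have hkpos : 0 < k 0 := by
    refine lt_of_le_of_ne (nonneg_of_sq_mul_nonneg hk.continuous fun s => ?_) hk0.symm
    have := h.le_value hF hac (hσQ s)
    rw [hσk] at this
    linarith
  have hkneg : k' 0 < 0 := by
    have : 0 ≤ -k' 0 := nonneg_of_sq_mul_nonneg (k := fun s => -k' s) hk'.continuous.neg fun s => by
      have := h.value_le hF hac (hσQ' s)
      rw [hσk'] at this
      linarith
    exact lt_of_le_of_ne (by linarith) hk0'
  have hψσ : Continuous fun s => ψ (σ s) := h.smooth.continuousOn.comp_continuous hσ.continuous hσQ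
  have hψσ' : Continuous fun s => ψ (σ' s) :=
    h.smooth.continuousOn.comp_continuous hσ'.continuous hσQ'
  have hCe : ∀ᶠ s in 𝓝[≠] 0, C (ψ (σ s)) = f (σ s) := by
    have h1 : ψ (σ 0) < c := by simpa [hσk] using hac
    filter_upwards [self_mem_nhdsWithin, nhdsWithin_le_nhds
      (hψσ.continuousAt.eventually_lt_const h1), nhdsWithin_le_nhds
      (hk.continuous.continuousAt.eventually_const_lt hkpos)] with s hs h2 h3
    refine hC _ (hσQ s) ⟨?_, h2⟩
    have : s ≠ 0 := hs
    have : 0 < s ^ 2 * k s := by positivity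
    rw [hσk]
    linarith
  have hCe' : ∀ᶠ s in 𝓝[≠] 0, C (ψ (σ' s)) = f (σ' s) := by
    have h1 : a < ψ (σ' 0) := by simpa [hσk'] using hac
    filter_upwards [self_mem_nhdsWithin, nhdsWithin_le_nhds
      (hψσ'.continuousAt.eventually_const_lt h1), nhdsWithin_le_nhds
      (hk'.continuous.continuousAt.eventually_lt_const hkneg)] with s hs h2 h3
    refine hC _ (hσQ' s) ⟨h2, ?_⟩
    have : s ≠ 0 := hs
    have : 0 < s ^ 2 := by positivity
    rw [hσk']
    nlinarith
  obtain ⟨C', hC's, hCC'⟩ := exists_contDiff_extension hac hCs hk hkpos hσk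
    (hf.comp_contDiff hσ hσQ) hCe hk' hkneg hσk' (hf.comp_contDiff hσ' hσQ') hCe'
  refine ⟨C', hC's, ?_⟩
  -- Regular interior points have values strictly between `a` and `c`. They are dense, so continuity
  -- gives the identity on the axis and on the boundary.
  have heq : EqOn f (fun x => C' (ψ x)) {x ∈ interior Q | fderivWithin ℝ ψ Q x ≠ 0} := by
    intro x hx
    have hxI := h.mem_Ioo_of_mem_interior hF hac hx.1 hx.2
    dsimp only
    rw [hCC' hxI, hC x (interior_subset hx.1) hxI]
  exact heq.of_subset_closure hf.continuousOn
    (hC's.continuous.comp_continuousOn h.smooth.continuousOn)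
    (fun x hx => interior_subset hx.1) (h.subset_closure_regular hF)

/-- A smooth function whose differential is everywhere parallel to that of `ψ` is a smooth function
of `ψ`. -/
theorem exists_level_function (h : AxisData Q ψ γ a c) (hF : IsChart Q F)
    {f : R3 → ℝ} (hf : ContDiffOn ℝ ∞ f Q)
    (hpar : ∀ x ∈ Q, ∀ v w, fderivWithin ℝ f Q x v * fderivWithin ℝ ψ Q x w =
      fderivWithin ℝ f Q x w * fderivWithin ℝ ψ Q x v) :
    ∃ C : ℝ → ℝ, ContDiff ℝ ∞ C ∧ ∀ x ∈ Q, f x = C (ψ x) := by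
  rcases (h.ne hF).lt_or_gt with hac | hac
  · exact h.exists_level_function_of_lt hF hac hf hpar
  · obtain ⟨C, hC, hfC⟩ := (h.neg hF).exists_level_function_of_lt hF (neg_lt_neg hac) hf (by
      intro x hx v w
      have h1 : fderivWithin ℝ (fun x => -ψ x) Q x = -fderivWithin ℝ ψ Q x :=
        fderivWithin_fun_neg (hF.uniqueDiffOn x hx)
      rw [h1]
      simp only [neg_apply]
      linear_combination -(hpar x hx v w))
    exact ⟨fun t => C (-t), hC.comp contDiff_neg, hfC⟩

end AxisData

/-! ### Circle actions and invariant fields -/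

theorem hasDerivAt_comp_of_mem' {V : Type*} [NormedAddCommGroup V] [NormedSpace ℝ V] {Q : Set R3}
    {W : R3 → V} {A : R3 →L[ℝ] V} {X : ℝ → R3} (hX : ∀ t, X t ∈ Q) {X' : R3} {τ : ℝ}
    (hW : HasFDerivWithinAt W A Q (X τ)) (h : HasDerivAt X X' τ) :
    HasDerivAt (fun t => W (X t)) (A X') τ := by
  rw [← hasDerivWithinAt_univ]
  exact hW.comp_hasDerivWithinAt τ h.hasDerivWithinAt fun t _ => hX t

/-- The differential of `Φ_θ` at `x`, as a function of `(θ, x)`. -/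
noncomputable def flowDeriv (Q : Set R3) (Φ : ℝ → R3 → R3) (q : ℝ × R3) : R3 →L[ℝ] R3 :=
  fderivWithin ℝ (Φ q.1) Q q.2

namespace IsCircleAction

variable {Q : Set R3} {F : ℂ × ℝ → R3} {Φ : ℝ → R3 → R3}

theorem uniqueDiffOn_prod (hF : IsChart Q F) : UniqueDiffOn ℝ ((univ : Set ℝ) ×ˢ Q) :=
  uniqueDiffOn_univ.prod hF.uniqueDiffOn

theorem subset_closure_interior_prod (hF : IsChart Q F) :
    (univ : Set ℝ) ×ˢ Q ⊆ closure (interior ((univ : Set ℝ) ×ˢ Q)) := by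
  rw [interior_prod_eq, interior_univ, closure_prod_eq, closure_univ]
  exact prod_mono subset_rfl hF.subset_closure_interior

theorem hasFDerivWithinAt_prod (hΦ : IsCircleAction Q Φ) (θ : ℝ) {x : R3} (hx : x ∈ Q) :
    HasFDerivWithinAt (fun q : ℝ × R3 => Φ q.1 q.2)
      (fderivWithin ℝ (fun q : ℝ × R3 => Φ q.1 q.2) (univ ×ˢ Q) (θ, x)) (univ ×ˢ Q) (θ, x) :=
  (hΦ.smooth.differentiableOn (by simp) (θ, x) ⟨mem_univ _, hx⟩).hasFDerivWithinAt

theorem hasFDerivWithinAt_slice {V : Type*} [NormedAddCommGroup V] [NormedSpace ℝ V]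
    {f : ℝ × R3 → V} {A : ℝ × R3 →L[ℝ] V} {θ : ℝ} {x : R3}
    (hf : HasFDerivWithinAt f A (univ ×ˢ Q) (θ, x)) :
    HasFDerivWithinAt (fun y => f (θ, y)) (A ∘L ContinuousLinearMap.inr ℝ ℝ R3) Q x :=
  hf.comp x (hasFDerivAt_prodMk_right θ x).hasFDerivWithinAt fun _ hy => ⟨mem_univ _, hy⟩

theorem hasDerivAt_slice {V : Type*} [NormedAddCommGroup V] [NormedSpace ℝ V]
    {f : ℝ × R3 → V} {A : ℝ × R3 →L[ℝ] V} {θ : ℝ} {x : R3} (hx : x ∈ Q)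
    (hf : HasFDerivWithinAt f A (univ ×ˢ Q) (θ, x)) :
    HasDerivAt (fun τ => f (τ, x)) (A (1, 0)) θ := by
  rw [← hasDerivWithinAt_univ]
  have hm : MapsTo (fun τ : ℝ => (τ, x)) univ (univ ×ˢ Q) := fun _ _ => ⟨mem_univ _, hx⟩
  exact hf.comp_hasDerivWithinAt θ
    ((hasDerivAt_id' θ).prodMk (hasDerivAt_const θ x)).hasDerivWithinAt hm

theorem flowDeriv_eq (hF : IsChart Q F) (hΦ : IsCircleAction Q Φ) (θ : ℝ) {x : R3} (hx : x ∈ Q) :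
    flowDeriv Q Φ (θ, x) =
      (fderivWithin ℝ (fun q : ℝ × R3 => Φ q.1 q.2) (univ ×ˢ Q) (θ, x)) ∘L
        ContinuousLinearMap.inr ℝ ℝ R3 :=
  (hasFDerivWithinAt_slice (hΦ.hasFDerivWithinAt_prod θ hx)).fderivWithin (hF.uniqueDiffOn x hx)

theorem hasFDerivWithinAt (hΦ : IsCircleAction Q Φ) (θ : ℝ) {x : R3} (hx : x ∈ Q) :
    HasFDerivWithinAt (Φ θ) (flowDeriv Q Φ (θ, x)) Q x :=
  (hasFDerivWithinAt_slice
    (hΦ.hasFDerivWithinAt_prod θ hx)).differentiableWithinAt.hasFDerivWithinAt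

theorem contDiffOn_fderiv_prod (hF : IsChart Q F) (hΦ : IsCircleAction Q Φ) :
    ContDiffOn ℝ ∞ (fderivWithin ℝ (fun q : ℝ × R3 => Φ q.1 q.2) (univ ×ˢ Q)) (univ ×ˢ Q) :=
  hΦ.smooth.fderivWithin (uniqueDiffOn_prod hF) (by simp)

theorem contDiffOn_flowDeriv (hF : IsChart Q F) (hΦ : IsCircleAction Q Φ) :
    ContDiffOn ℝ ∞ (flowDeriv Q Φ) (univ ×ˢ Q) :=
  ((hΦ.contDiffOn_fderiv_prod hF).clm_comp contDiffOn_const).congr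
    fun q hq => hΦ.flowDeriv_eq hF q.1 hq.2

theorem contDiffOn (hΦ : IsCircleAction Q Φ) (θ : ℝ) : ContDiffOn ℝ ∞ (Φ θ) Q :=
  hΦ.smooth.comp (contDiffOn_const.prodMk contDiffOn_id) fun _ hx => ⟨mem_univ _, hx⟩

theorem generator_eq (hΦ : IsCircleAction Q Φ) {x : R3} (hx : x ∈ Q) :
    generator Φ x = fderivWithin ℝ (fun q : ℝ × R3 => Φ q.1 q.2) (univ ×ˢ Q) (0, x) (1, 0) :=
  (hasDerivAt_slice hx (hΦ.hasFDerivWithinAt_prod 0 hx)).deriv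

theorem contDiffOn_generator (hF : IsChart Q F) (hΦ : IsCircleAction Q Φ) :
    ContDiffOn ℝ ∞ (generator Φ) Q := by
  have h1 : ContDiffOn ℝ ∞ (fun x => fderivWithin ℝ (fun q : ℝ × R3 => Φ q.1 q.2)
      (univ ×ˢ Q) (0, x) (1, 0)) Q :=
    ((hΦ.contDiffOn_fderiv_prod hF).comp (contDiffOn_const.prodMk contDiffOn_id)
      fun _ hx => ⟨mem_univ _, hx⟩).clm_apply contDiffOn_const
  exact h1.congr fun x hx => hΦ.generator_eq hx

theorem differentiableOn_generator (hF : IsChart Q F) (hΦ : IsCircleAction Q Φ) :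
    DifferentiableOn ℝ (generator Φ) Q :=
  (hΦ.contDiffOn_generator hF).differentiableOn (by simp)

theorem hasDerivAt_zero (hΦ : IsCircleAction Q Φ) {x : R3} (hx : x ∈ Q) :
    HasDerivAt (fun θ => Φ θ x) (generator Φ x) 0 :=
  (hasDerivAt_slice hx (hΦ.hasFDerivWithinAt_prod 0 hx)).differentiableAt.hasDerivAt

theorem map_neg_map (hΦ : IsCircleAction Q Φ) (θ : ℝ) {x : R3} (hx : x ∈ Q) :
    Φ (-θ) (Φ θ x) = x := by
  rw [← hΦ.map_add _ _ x hx, neg_add_cancel, hΦ.map_zero x hx]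

theorem flowDeriv_zero (hF : IsChart Q F) (hΦ : IsCircleAction Q Φ) {x : R3} (hx : x ∈ Q) :
    flowDeriv Q Φ (0, x) = ContinuousLinearMap.id ℝ R3 := by
  refine HasFDerivWithinAt.fderivWithin (s := Q) ?_ (hF.uniqueDiffOn x hx)
  exact (hasFDerivWithinAt_id x Q).congr (fun y hy => hΦ.map_zero y hy) (hΦ.map_zero x hx)

theorem flowDeriv_add (hF : IsChart Q F) (hΦ : IsCircleAction Q Φ) (θ τ : ℝ) {x : R3}
    (hx : x ∈ Q) :
    flowDeriv Q Φ (θ + τ, x) = flowDeriv Q Φ (θ, Φ τ x) ∘L flowDeriv Q Φ (τ, x) := by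
  refine HasFDerivWithinAt.fderivWithin (s := Q) ?_ (hF.uniqueDiffOn x hx)
  exact ((hΦ.hasFDerivWithinAt θ (hΦ.mapsTo τ hx)).comp x (hΦ.hasFDerivWithinAt τ hx)
    (hΦ.mapsTo τ)).congr (fun y hy => hΦ.map_add θ τ y hy) (hΦ.map_add θ τ x hx)

theorem flowDeriv_neg_comp (hF : IsChart Q F) (hΦ : IsCircleAction Q Φ) (θ : ℝ) {x : R3}
    (hx : x ∈ Q) :
    flowDeriv Q Φ (-θ, Φ θ x) ∘L flowDeriv Q Φ (θ, x) = ContinuousLinearMap.id ℝ R3 := by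
  rw [← hΦ.flowDeriv_add hF _ _ hx, neg_add_cancel, hΦ.flowDeriv_zero hF hx]

theorem flowDeriv_comp_neg (hF : IsChart Q F) (hΦ : IsCircleAction Q Φ) (θ : ℝ) {x : R3}
    (hx : x ∈ Q) :
    flowDeriv Q Φ (θ, x) ∘L flowDeriv Q Φ (-θ, Φ θ x) = ContinuousLinearMap.id ℝ R3 := by
  have h := hΦ.flowDeriv_add hF θ (-θ) (hΦ.mapsTo θ hx)
  rwa [add_neg_cancel, hΦ.flowDeriv_zero hF (hΦ.mapsTo θ hx), hΦ.map_neg_map θ hx, eq_comm] at h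

theorem flowDeriv_periodic (hF : IsChart Q F) (hΦ : IsCircleAction Q Φ) (θ : ℝ) {x : R3}
    (hx : x ∈ Q) : flowDeriv Q Φ (θ + 2 * Real.pi, x) = flowDeriv Q Φ (θ, x) := by
  refine HasFDerivWithinAt.fderivWithin (s := Q) ?_ (hF.uniqueDiffOn x hx)
  exact (hΦ.hasFDerivWithinAt θ hx).congr (fun y hy => hΦ.periodic θ y hy) (hΦ.periodic θ x hx)

/-- The derivative of the differential of the flow at time `0`. -/
theorem hasFDerivWithinAt_flowDeriv (hF : IsChart Q F) (hΦ : IsCircleAction Q Φ) {x : R3}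
    (hx : x ∈ Q) :
    HasFDerivWithinAt (flowDeriv Q Φ)
      ((ContinuousLinearMap.fst ℝ ℝ R3).smulRight (fderivWithin ℝ (generator Φ) Q x))
      (univ ×ˢ Q) (0, x) := by
  have hS : ((0 : ℝ), x) ∈ (univ : Set ℝ) ×ˢ Q := ⟨mem_univ _, hx⟩
  have hU := uniqueDiffOn_prod hF
  set M := fderivWithin ℝ (fun q : ℝ × R3 => Φ q.1 q.2) (univ ×ˢ Q) with hM
  have hMd : HasFDerivWithinAt M (fderivWithin ℝ M (univ ×ˢ Q) (0, x)) (univ ×ˢ Q) (0, x) :=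
    ((hΦ.contDiffOn_fderiv_prod hF).differentiableOn (by simp) _ hS).hasFDerivWithinAt
  set M' := fderivWithin ℝ M (univ ×ˢ Q) (0, x) with hM'
  -- Symmetry of the second derivative of `(θ, x) ↦ Φ_θ x` exchanges the derivatives in `θ` and `x`,
  -- which identifies the `θ`-derivative of `DΦ_θ` at `0` with `Du`.
  have hsymm : ∀ v w, M' v w = M' w v := (hΦ.smooth _ hS).isSymmSndFDerivWithinAt (by
      rw [minSmoothness_of_isRCLikeNormedField]; exact WithTop.coe_le_coe.2 le_top) hU
    (subset_closure_interior_prod hF hS) hS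
  have hN := ((hΦ.contDiffOn_flowDeriv hF).differentiableOn (by simp) _ hS).hasFDerivWithinAt
  set N' := fderivWithin ℝ (flowDeriv Q Φ) (univ ×ˢ Q) (0, x) with hN'
  have hux := hF.uniqueDiffOn x hx
  have h1 : N' ∘L ContinuousLinearMap.inr ℝ ℝ R3 = 0 := by
    refine hux.eq (hasFDerivWithinAt_slice hN) ?_
    exact (hasFDerivWithinAt_const (ContinuousLinearMap.id ℝ R3) x Q).congr
      (fun y hy => hΦ.flowDeriv_zero hF hy) (hΦ.flowDeriv_zero hF hx)
  have h2 : ∀ p, N' p = (M' p) ∘L ContinuousLinearMap.inr ℝ ℝ R3 := by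
    have e1 : HasFDerivWithinAt (flowDeriv Q Φ) _ (univ ×ˢ Q) (0, x) :=
      ((((ContinuousLinearMap.compL ℝ R3 (ℝ × R3) R3).flip
        (ContinuousLinearMap.inr ℝ ℝ R3)).hasFDerivAt.comp_hasFDerivWithinAt _ hMd).congr
        (fun q hq => hΦ.flowDeriv_eq hF q.1 hq.2) (hΦ.flowDeriv_eq hF 0 hx))
    intro p
    rw [(hU _ hS).eq hN e1]
    rfl
  have h3 : ∀ v, fderivWithin ℝ (generator Φ) Q x v = M' (0, v) (1, 0) := by
    intro v
    have e1 : HasFDerivWithinAt (generator Φ) _ Q x :=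
      ((ContinuousLinearMap.apply ℝ R3 ((1, 0) : ℝ × R3)).hasFDerivAt.comp_hasFDerivWithinAt x
        (hasFDerivWithinAt_slice hMd)).congr (fun y hy => hΦ.generator_eq hy) (hΦ.generator_eq hx)
    rw [e1.fderivWithin hux]
    rfl
  refine hN.congr_fderiv ?_
  refine ContinuousLinearMap.ext fun p => ContinuousLinearMap.ext fun v => ?_
  have hp : p = p.1 • ((1, 0) : ℝ × R3) + (0, p.2) := by ext1 <;> simp
  have h4 : N' (0, p.2) = 0 := by simpa using congrArg (fun A => A p.2) h1
  conv_lhs => rw [hp, _root_.map_add, h4, add_zero, map_smul]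
  rw [h2]
  simp only [smul_apply, ContinuousLinearMap.comp_apply,
    ContinuousLinearMap.inr_apply, ContinuousLinearMap.smulRight_apply]
  rw [hsymm, h3]
  rfl

theorem hasDerivAt_flowDeriv (hF : IsChart Q F) (hΦ : IsCircleAction Q Φ) {x : R3} (hx : x ∈ Q) :
    HasDerivAt (fun θ => flowDeriv Q Φ (θ, x)) (fderivWithin ℝ (generator Φ) Q x) 0 := by
  simpa using hasDerivAt_slice hx (hΦ.hasFDerivWithinAt_flowDeriv hF hx)

theorem hasDerivAt_flowDeriv_neg (hF : IsChart Q F) (hΦ : IsCircleAction Q Φ) {x : R3}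
    (hx : x ∈ Q) :
    HasDerivAt (fun τ => flowDeriv Q Φ (-τ, Φ τ x)) (-fderivWithin ℝ (generator Φ) Q x) 0 := by
  have h1 : HasDerivAt (fun τ => (-τ, Φ τ x)) ((-1 : ℝ), generator Φ x) 0 :=
    (hasDerivAt_neg 0).prodMk (hΦ.hasDerivAt_zero hx)
  have h2 : HasFDerivWithinAt (flowDeriv Q Φ)
      ((ContinuousLinearMap.fst ℝ ℝ R3).smulRight (fderivWithin ℝ (generator Φ) Q x))
      (univ ×ˢ Q) (-0, Φ 0 x) := by
    rw [neg_zero, hΦ.map_zero x hx]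
    exact hΦ.hasFDerivWithinAt_flowDeriv hF hx
  have hm : MapsTo (fun τ : ℝ => (-τ, Φ τ x)) univ (univ ×ˢ Q) := fun τ _ =>
    ⟨mem_univ _, hΦ.mapsTo τ hx⟩
  have h3 := h2.comp_hasDerivWithinAt (0 : ℝ) h1.hasDerivWithinAt hm
  rw [hasDerivWithinAt_univ] at h3
  refine h3.congr_deriv ?_
  simp

/-- A vector field commuting with the generator is invariant under the action. -/
theorem map_eq_of_bracket (hF : IsChart Q F) (hΦ : IsCircleAction Q Φ) {W : R3 → R3}
    (hW : DifferentiableOn ℝ W Q)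
    (hb : ∀ x ∈ Q, VectorField.lieBracketWithin ℝ (generator Φ) W Q x = 0) (θ : ℝ) {x : R3}
    (hx : x ∈ Q) : W (Φ θ x) = flowDeriv Q Φ (θ, x) (W x) := by
  -- The field pulled back along the flow has derivative `[u, W] = 0` at time `0`; the group law
  -- carries this to every time, so the pullback is constant.
  have hY : ∀ x ∈ Q, HasDerivAt (fun τ => flowDeriv Q Φ (-τ, Φ τ x) (W (Φ τ x))) 0 0 := by
    intro x hx
    have h1 : HasDerivAt (fun τ => W (Φ τ x)) (fderivWithin ℝ W Q (Φ 0 x) (generator Φ x)) 0 :=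
      hasDerivAt_comp_of_mem' (fun τ => hΦ.mapsTo τ hx)
        (hW _ (hΦ.mapsTo 0 hx)).hasFDerivWithinAt (hΦ.hasDerivAt_zero hx)
    refine ((hΦ.hasDerivAt_flowDeriv_neg hF hx).clm_apply h1).congr_deriv ?_
    have h2 := hb x hx
    rw [VectorField.lieBracketWithin, sub_eq_zero] at h2
    rw [neg_zero, hΦ.map_zero x hx, hΦ.flowDeriv_zero hF hx, h2]
    simp
  have hy : ∀ θ, HasDerivAt (fun τ => flowDeriv Q Φ (-τ, Φ τ x) (W (Φ τ x))) 0 θ := by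
    intro θ
    have h1 : HasDerivAt (fun τ => flowDeriv Q Φ (-τ, Φ τ (Φ θ x)) (W (Φ τ (Φ θ x)))) 0 (θ - θ) := by
      rw [sub_self]
      exact hY _ (hΦ.mapsTo θ hx)
    have h2 := (flowDeriv Q Φ (-θ, Φ θ x)).hasFDerivAt.comp_hasDerivAt θ (h1.comp_sub_const θ θ)
    rw [_root_.map_zero] at h2
    refine h2.congr_of_eventuallyEq (.of_forall fun τ => ?_)
    simp only [Function.comp_apply]
    have h3 : Φ (τ - θ) (Φ θ x) = Φ τ x := by rw [← hΦ.map_add _ _ x hx, sub_add_cancel]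
    have h4 : Φ (-(τ - θ)) (Φ τ x) = Φ θ x := by
      rw [← hΦ.map_add _ _ x hx]
      congr 1
      ring
    have h5 := hΦ.flowDeriv_add hF (-θ) (-(τ - θ)) (hΦ.mapsTo τ hx)
    rw [h4, show -θ + -(τ - θ) = -τ by ring] at h5
    rw [h3, h5]
    rfl
  have hc := is_const_of_deriv_eq_zero (fun τ => (hy τ).differentiableAt)
    (fun τ => (hy τ).deriv) θ 0
  simp only [neg_zero, hΦ.map_zero x hx, hΦ.flowDeriv_zero hF hx] at hc
  have h6 := congrArg (fun A => A (W (Φ θ x))) (hΦ.flowDeriv_comp_neg hF θ hx)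
  simp only [ContinuousLinearMap.comp_apply, hc, ContinuousLinearMap.id_apply] at h6
  exact h6.symm

/-- An invariant vector field commutes with the generator. -/
theorem fderivWithin_eq_of_map_eq (hF : IsChart Q F) (hΦ : IsCircleAction Q Φ) {W : R3 → R3}
    (hW : DifferentiableOn ℝ W Q) {x : R3} (hx : x ∈ Q)
    (hinv : ∀ θ, W (Φ θ x) = flowDeriv Q Φ (θ, x) (W x)) :
    fderivWithin ℝ W Q x (generator Φ x) = fderivWithin ℝ (generator Φ) Q x (W x) := by
  have h1 : HasDerivAt (fun τ => W (Φ τ x)) (fderivWithin ℝ W Q (Φ 0 x) (generator Φ x)) 0 :=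
    hasDerivAt_comp_of_mem' (fun τ => hΦ.mapsTo τ hx)
      (hW _ (hΦ.mapsTo 0 hx)).hasFDerivWithinAt (hΦ.hasDerivAt_zero hx)
  have h2 := (hΦ.hasDerivAt_flowDeriv hF hx).clm_apply (hasDerivAt_const (0 : ℝ) (W x))
  rw [funext hinv, hΦ.map_zero x hx] at h1
  have h3 := h1.unique h2
  simpa using h3

/-- An invariant one-form has vanishing Lie derivative along the generator. -/
theorem fderivWithin_dotProduct_eq_of_map_eq (hF : IsChart Q F) (hΦ : IsCircleAction Q Φ)
    {W : R3 → R3} (hW : DifferentiableOn ℝ W Q) {x : R3} (hx : x ∈ Q)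
    (hinv : ∀ θ v, W (Φ θ x) ⬝ᵥ flowDeriv Q Φ (θ, x) v = W x ⬝ᵥ v) (v : R3) :
    fderivWithin ℝ W Q x (generator Φ x) ⬝ᵥ v +
      W x ⬝ᵥ fderivWithin ℝ (generator Φ) Q x v = 0 := by
  have h1 : HasDerivAt (fun τ => W (Φ τ x)) (fderivWithin ℝ W Q (Φ 0 x) (generator Φ x)) 0 :=
    hasDerivAt_comp_of_mem' (fun τ => hΦ.mapsTo τ hx)
      (hW _ (hΦ.mapsTo 0 hx)).hasFDerivWithinAt (hΦ.hasDerivAt_zero hx)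
  have h2 := hasDerivAt_dotProduct h1
    ((hΦ.hasDerivAt_flowDeriv hF hx).clm_apply (hasDerivAt_const (0 : ℝ) v))
  rw [funext fun θ => hinv θ v] at h2
  have h3 := h2.unique (hasDerivAt_const 0 (W x ⬝ᵥ v))
  rw [hΦ.map_zero x hx, hΦ.flowDeriv_zero hF hx] at h3
  simpa using h3

theorem mem_interior (hF : IsChart Q F) (hΦ : IsCircleAction Q Φ) (θ : ℝ) {x : R3}
    (hx : x ∈ interior Q) : Φ θ x ∈ interior Q := by
  have hxQ := interior_subset hx
  have hn : Q ∈ 𝓝 x := mem_interior_iff_mem_nhds.1 hx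
  let L : R3 ≃L[ℝ] R3 := ContinuousLinearEquiv.equivOfInverse (flowDeriv Q Φ (θ, x))
    (flowDeriv Q Φ (-θ, Φ θ x))
    (fun v => congrArg (fun A => A v) (hΦ.flowDeriv_neg_comp hF θ hxQ))
    (fun v => congrArg (fun A => A v) (hΦ.flowDeriv_comp_neg hF θ hxQ))
  have h1 : ContDiffAt ℝ ∞ (Φ θ) x := (hΦ.contDiffOn θ).contDiffAt hn
  have h2 : HasStrictFDerivAt (Φ θ) (L : R3 →L[ℝ] R3) x :=
    h1.hasStrictFDerivAt' ((hΦ.hasFDerivWithinAt θ hxQ).hasFDerivAt hn) (by simp)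
  rw [mem_interior_iff_mem_nhds, ← h2.map_nhds_eq_of_equiv, mem_map]
  exact mem_of_superset hn (hΦ.mapsTo θ)

theorem mem_frontier (hF : IsChart Q F) (hΦ : IsCircleAction Q Φ) (θ : ℝ) {x : R3}
    (hx : x ∈ frontier Q) : Φ θ x ∈ frontier Q := by
  rw [hF.isCompact.isClosed.frontier_eq] at hx ⊢
  refine ⟨hΦ.mapsTo θ hx.1, fun h => hx.2 ?_⟩
  have := hΦ.mem_interior hF (-θ) h
  rwa [hΦ.map_neg_map θ hx.1] at this

/-- The generator is tangent to the boundary. -/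
theorem grad_dotProduct_generator (hF : IsChart Q F) (hΦ : IsCircleAction Q Φ) {G : R3 → ℝ}
    {c : ℝ} (hG : DifferentiableOn ℝ G Q) (hc : ∀ x ∈ frontier Q, G x = c) {x : R3}
    (hx : x ∈ frontier Q) : grad Q G x ⬝ᵥ generator Φ x = 0 := by
  have hxQ := hF.isCompact.isClosed.frontier_subset hx
  have h1 : HasDerivAt (fun τ => G (Φ τ x)) (fderivWithin ℝ G Q (Φ 0 x) (generator Φ x)) 0 :=
    hasDerivAt_comp_of_mem' (fun τ => hΦ.mapsTo τ hxQ)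
      (hG _ (hΦ.mapsTo 0 hxQ)).hasFDerivWithinAt (hΦ.hasDerivAt_zero hxQ)
  rw [show (fun τ => G (Φ τ x)) = fun _ => c from
    funext fun τ => hc _ (hΦ.mem_frontier hF τ hx), hΦ.map_zero x hxQ] at h1
  rw [grad_dotProduct]
  exact h1.unique (hasDerivAt_const 0 c)

end IsCircleAction

/-! ### Preservation of volume and the Jacobian determinant -/

theorem det_eq (A : R3 →L[ℝ] R3) :
    A.det = (Matrix.of fun i j => A (Pi.single j 1) i).det := by
  change LinearMap.det (A : R3 →ₗ[ℝ] R3) = _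
  rw [← LinearMap.det_toMatrix']
  congr 1

/-- The derivative of the determinant at the identity is the trace. -/
theorem trace_eq_zero_of_det_eq_one {N : ℝ → R3 →L[ℝ] R3} {D : R3 →L[ℝ] R3}
    (hN : HasDerivAt N D 0) (hN0 : N 0 = ContinuousLinearMap.id ℝ R3) (hdet : ∀ θ, (N θ).det = 1) :
    ∑ i, D (Pi.single i 1) i = 0 := by
  have h : ∀ i j, HasDerivAt (fun θ => N θ (Pi.single j 1) i) (D (Pi.single j 1) i) 0 := by
    intro i j
    have h1 := hN.clm_apply (hasDerivAt_const (0 : ℝ) (Pi.single j (1 : ℝ) : R3))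
    rw [_root_.map_zero, add_zero] at h1
    exact hasDerivAt_pi.1 h1 i
  have h0 : ∀ i j, N 0 (Pi.single j 1) i = (Pi.single j (1 : ℝ) : R3) i := by
    intro i j
    rw [hN0]
    rfl
  have hd : (fun θ => N θ (Pi.single 0 1) 0 * N θ (Pi.single 1 1) 1 * N θ (Pi.single 2 1) 2
      - N θ (Pi.single 0 1) 0 * N θ (Pi.single 2 1) 1 * N θ (Pi.single 1 1) 2
      - N θ (Pi.single 1 1) 0 * N θ (Pi.single 0 1) 1 * N θ (Pi.single 2 1) 2
      + N θ (Pi.single 1 1) 0 * N θ (Pi.single 2 1) 1 * N θ (Pi.single 0 1) 2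
      + N θ (Pi.single 2 1) 0 * N θ (Pi.single 0 1) 1 * N θ (Pi.single 1 1) 2
      - N θ (Pi.single 2 1) 0 * N θ (Pi.single 1 1) 1 * N θ (Pi.single 0 1) 2) = fun _ => 1 := by
    funext θ
    have := hdet θ
    rw [det_eq, Matrix.det_fin_three] at this
    simpa using this
  have h2 := ((((((((h 0 0).mul (h 1 1)).mul (h 2 2)).sub (((h 0 0).mul (h 1 2)).mul (h 2 1))).sub
    (((h 0 1).mul (h 1 0)).mul (h 2 2))).add (((h 0 1).mul (h 1 2)).mul (h 2 0))).add
    (((h 0 2).mul (h 1 0)).mul (h 2 1))).sub (((h 0 2).mul (h 1 1)).mul (h 2 0)))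
  have h3 := (h2.congr_of_eventuallyEq (f₁ := fun _ => (1 : ℝ))
    (.of_forall fun θ => (congrFun hd θ).symm)).unique (hasDerivAt_const 0 (1 : ℝ))
  simp only [Pi.mul_apply, h0] at h3
  rw [Fin.sum_univ_three]
  simp at h3
  linarith

namespace IsVolumePreservingCircleAction

variable {Q : Set R3} {F : ℂ × ℝ → R3} {Φ : ℝ → R3 → R3}

theorem continuousOn_abs_det (hF : IsChart Q F) (hΦ : IsCircleAction Q Φ) (θ : ℝ) :
    ContinuousOn (fun x => |(flowDeriv Q Φ (θ, x)).det|) Q := by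
  have h1 : ContinuousOn (fun x => flowDeriv Q Φ (θ, x)) Q :=
    (hΦ.contDiffOn_flowDeriv hF).continuousOn.comp (continuousOn_const.prodMk continuousOn_id)
      fun _ hx => ⟨mem_univ _, hx⟩
  exact (ContinuousLinearMap.continuous_det.comp_continuousOn h1).abs

theorem lintegral_abs_det (hΦ : IsVolumePreservingCircleAction Q Φ) (θ : ℝ) {V : Set R3}
    (hV : IsOpen V) (hVQ : V ⊆ Q) :
    ∫⁻ x in V, ENNReal.ofReal |(flowDeriv Q Φ (θ, x)).det| = volume V := by
  rw [lintegral_abs_det_fderiv_eq_addHaar_image volume hV.measurableSet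
    (f := Φ θ) (f' := fun x => flowDeriv Q Φ (θ, x))
    (fun x hx => (hΦ.toIsCircleAction.hasFDerivWithinAt θ (hVQ hx)).mono hVQ) ?_]
  · have := hΦ.volume_image θ V hV
    rwa [inter_eq_left.2 hVQ] at this
  · intro x hx y hy hxy
    rw [← hΦ.toIsCircleAction.map_neg_map θ (hVQ hx), hxy,
      hΦ.toIsCircleAction.map_neg_map θ (hVQ hy)]

/-- If `|det|` differed from `1` at an interior point, it would stay strictly on one side of `1` on
a small ball, and by the change of variables formula the image of that ball would have a different
volume. -/
theorem abs_det_eq_one_of_mem_interior (hF : IsChart Q F)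
    (hΦ : IsVolumePreservingCircleAction Q Φ) (θ : ℝ) {x : R3} (hx : x ∈ interior Q) :
    |(flowDeriv Q Φ (θ, x)).det| = 1 := by
  have hc : ContinuousAt (fun x => |(flowDeriv Q Φ (θ, x)).det|) x :=
    (continuousOn_abs_det hF hΦ.toIsCircleAction θ).continuousAt (mem_interior_iff_mem_nhds.1 hx)
  have hball : ∀ {p : R3 → Prop}, (∀ᶠ y in 𝓝 x, p y) → ∃ V : Set R3, IsOpen V ∧ V ⊆ Q ∧
      volume V ≠ 0 ∧ volume V ≠ ⊤ ∧ ∀ y ∈ V, p y := by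
    intro p hp
    obtain ⟨ε, hε, hb⟩ := Metric.eventually_nhds_iff_ball.1
      (hp.and (mem_interior_iff_mem_nhds.1 hx))
    exact ⟨Metric.ball x ε, Metric.isOpen_ball, fun y hy => (hb y hy).2,
      (Metric.measure_ball_pos volume x hε).ne', measure_ball_lt_top.ne, fun y hy => (hb y hy).1⟩
  rcases lt_trichotomy |(flowDeriv Q Φ (θ, x)).det| 1 with h | h | h
  · exfalso
    obtain ⟨r, hr1, hr2⟩ := exists_between h
    obtain ⟨V, hV, hVQ, h0, ht, hVr⟩ := hball (hc.eventually_lt_const hr1)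
    have h1 := hΦ.lintegral_abs_det θ hV hVQ
    have h2 : ∫⁻ x in V, ENNReal.ofReal |(flowDeriv Q Φ (θ, x)).det| ≤
        ENNReal.ofReal r * volume V := by
      rw [← setLIntegral_const]
      exact setLIntegral_mono' hV.measurableSet fun y hy => ENNReal.ofReal_le_ofReal (hVr y hy).le
    have h3 : ENNReal.ofReal r * volume V < 1 * volume V :=
      (ENNReal.mul_lt_mul_iff_left h0 ht).2 (by
        rw [← ENNReal.ofReal_one]
        exact (ENNReal.ofReal_lt_ofReal_iff one_pos).2 hr2)
    rw [h1] at h2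
    rw [one_mul] at h3
    exact absurd h2 (not_le.2 h3)
  · exact h
  · exfalso
    obtain ⟨r, hr1, hr2⟩ := exists_between h
    obtain ⟨V, hV, hVQ, h0, ht, hVr⟩ := hball (hc.eventually_const_lt hr2)
    have h1 := hΦ.lintegral_abs_det θ hV hVQ
    have h2 : ENNReal.ofReal r * volume V ≤
        ∫⁻ x in V, ENNReal.ofReal |(flowDeriv Q Φ (θ, x)).det| := by
      rw [← setLIntegral_const]
      exact setLIntegral_mono' hV.measurableSet fun y hy => ENNReal.ofReal_le_ofReal (hVr y hy).le
    have h3 : 1 * volume V < ENNReal.ofReal r * volume V :=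
      (ENNReal.mul_lt_mul_iff_left h0 ht).2 (by
        rw [← ENNReal.ofReal_one]
        exact (ENNReal.ofReal_lt_ofReal_iff (one_pos.trans hr1)).2 hr1)
    rw [h1] at h2
    rw [one_mul] at h3
    exact absurd h2 (not_le.2 h3)

theorem abs_det_eq_one (hF : IsChart Q F) (hΦ : IsVolumePreservingCircleAction Q Φ) (θ : ℝ)
    {x : R3} (hx : x ∈ Q) : |(flowDeriv Q Φ (θ, x)).det| = 1 := by
  have h1 : EqOn (fun x => |(flowDeriv Q Φ (θ, x)).det|) (fun _ => 1) (interior Q) :=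
    fun x hx => hΦ.abs_det_eq_one_of_mem_interior hF θ hx
  exact h1.of_subset_closure (continuousOn_abs_det hF hΦ.toIsCircleAction θ) continuousOn_const
    interior_subset hF.subset_closure_interior hx

/-- In `θ` the determinant is continuous, has absolute value `1` and equals `1` at `θ = 0`; it
cannot reach `-1` without vanishing. -/
theorem det_eq_one (hF : IsChart Q F) (hΦ : IsVolumePreservingCircleAction Q Φ) (θ : ℝ)
    {x : R3} (hx : x ∈ Q) : (flowDeriv Q Φ (θ, x)).det = 1 := by
  have hc : Continuous fun θ => (flowDeriv Q Φ (θ, x)).det := by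
    refine ContinuousLinearMap.continuous_det.comp ?_
    exact (hΦ.toIsCircleAction.contDiffOn_flowDeriv hF).continuousOn.comp_continuous
      (by fun_prop) fun θ => ⟨mem_univ _, hx⟩
  rcases eq_or_eq_neg_of_abs_eq (hΦ.abs_det_eq_one hF θ hx) with h | h
  · exact h
  · exfalso
    obtain ⟨τ, hτ⟩ := mem_range_of_exists_le_of_exists_ge (c := 0) hc
      ⟨θ, by rw [h]; norm_num⟩ ⟨0, by
        rw [hΦ.toIsCircleAction.flowDeriv_zero hF hx]
        simp [ContinuousLinearMap.det]⟩
    have := hΦ.abs_det_eq_one hF τ hx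
    dsimp only at hτ
    rw [hτ] at this
    norm_num at this

theorem div_generator (hF : IsChart Q F) (hΦ : IsVolumePreservingCircleAction Q Φ) {x : R3}
    (hx : x ∈ Q) : div Q (generator Φ) x = 0 :=
  trace_eq_zero_of_det_eq_one (hΦ.toIsCircleAction.hasDerivAt_flowDeriv hF hx)
    (hΦ.toIsCircleAction.flowDeriv_zero hF hx) fun θ => hΦ.det_eq_one hF θ hx

end IsVolumePreservingCircleAction

/-! ### The averaged metric: positivity, smoothness, invariance -/

theorem clm_apply_eq_mulVec (A : R3 →L[ℝ] R3) (v : R3) :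
    A v = (Matrix.of fun i j => A (Pi.single j 1) i) *ᵥ v := by
  have hv : v = ∑ i, v i • (Pi.single i (1 : ℝ) : R3) := by
    ext j; simp [Finset.sum_apply, Pi.single_apply]
  conv_lhs => rw [hv, _root_.map_sum]
  ext i
  simp [Matrix.mulVec, dotProduct, mul_comm]

theorem jacobian_mulVec (Q : Set R3) (Φ : ℝ → R3 → R3) (θ : ℝ) (x v : R3) :
    jacobian Q Φ θ x *ᵥ v = flowDeriv Q Φ (θ, x) v :=
  (clm_apply_eq_mulVec (flowDeriv Q Φ (θ, x)) v).symm

theorem transpose_mul_apply_eq_dotProduct (A : Matrix (Fin 3) (Fin 3) ℝ) (i j : Fin 3) :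
    (Aᵀ * A) i j = (A *ᵥ Pi.single i 1) ⬝ᵥ (A *ᵥ Pi.single j 1) := by
  simp [Matrix.mul_apply, dotProduct]

theorem dotProduct_transpose_mul_mulVec (A : Matrix (Fin 3) (Fin 3) ℝ) (v w : R3) :
    v ⬝ᵥ ((Aᵀ * A) *ᵥ w) = (A *ᵥ v) ⬝ᵥ (A *ᵥ w) := by
  rw [← Matrix.mulVec_mulVec, Matrix.dotProduct_mulVec, Matrix.vecMul_transpose]

theorem avgMetric_isSymm (Q : Set R3) (Φ : ℝ → R3 → R3) (x : R3) : (avgMetric Q Φ x).IsSymm := by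
  ext i j
  simp only [Matrix.transpose_apply, avgMetric, Matrix.of_apply]
  congr 2
  funext θ
  rw [transpose_mul_apply_eq_dotProduct, dotProduct_comm, ← transpose_mul_apply_eq_dotProduct]

/-- The cofactor identity `(h v) × (h w) = det h • h⁻¹ (v × w)` for symmetric `h`. -/
theorem mulVec_cross_mulVec {h : Matrix (Fin 3) (Fin 3) ℝ} (hs : h.IsSymm) (hd : h.det ≠ 0)
    (v w : R3) : (h *ᵥ v) ⨯₃ (h *ᵥ w) = h.det • (h⁻¹ *ᵥ (v ⨯₃ w)) := by
  have h1 : h *ᵥ ((h *ᵥ v) ⨯₃ (h *ᵥ w)) = h.det • (v ⨯₃ w) := by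
    have e : ∀ i j, h i j = h j i := fun i j => hs.apply j i
    ext i
    fin_cases i <;>
    simp [Matrix.mulVec, dotProduct, Fin.sum_univ_three, cross_apply, Matrix.det_fin_three,
      e 1 0, e 2 0, e 2 1] <;> ring
  rw [← Matrix.mulVec_smul, ← h1, Matrix.mulVec_mulVec, Matrix.nonsing_inv_mul _ hd.isUnit,
    Matrix.one_mulVec]

theorem contDiffOn_matrix_det {Q : Set R3} {h : R3 → Matrix (Fin 3) (Fin 3) ℝ}
    (hh : ∀ i j, ContDiffOn ℝ ∞ (fun x => h x i j) Q) : ContDiffOn ℝ ∞ (fun x => (h x).det) Q := by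
  simp only [Matrix.det_fin_three]
  fun_prop

theorem contDiffOn_mulVec {Q : Set R3} {h : R3 → Matrix (Fin 3) (Fin 3) ℝ} {w : R3 → R3}
    (hh : ∀ i j, ContDiffOn ℝ ∞ (fun x => h x i j) Q) (hw : ContDiffOn ℝ ∞ w Q) :
    ContDiffOn ℝ ∞ (fun x => h x *ᵥ w x) Q := by
  rw [contDiffOn_pi] at hw ⊢
  intro i
  simp only [Matrix.mulVec, dotProduct, Fin.sum_univ_three]
  fun_prop

theorem contDiffOn_dotProduct {Q : Set R3} {v w : R3 → R3}
    (hv : ContDiffOn ℝ ∞ v Q) (hw : ContDiffOn ℝ ∞ w Q) :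
    ContDiffOn ℝ ∞ (fun x => v x ⬝ᵥ w x) Q := by
  rw [contDiffOn_pi] at hv hw
  simp only [dotProduct, Fin.sum_univ_three]
  fun_prop

theorem contDiffOn_cross {Q : Set R3} {v w : R3 → R3}
    (hv : ContDiffOn ℝ ∞ v Q) (hw : ContDiffOn ℝ ∞ w Q) :
    ContDiffOn ℝ ∞ (fun x => v x ⨯₃ w x) Q := by
  rw [contDiffOn_pi] at hv hw ⊢
  intro i
  fin_cases i <;> simp [cross_apply] <;> fun_prop

theorem contDiffOn_matrix_inv_mulVec {Q : Set R3} {h : R3 → Matrix (Fin 3) (Fin 3) ℝ} {w : R3 → R3}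
    (hh : ∀ i j, ContDiffOn ℝ ∞ (fun x => h x i j) Q) (hd : ∀ x ∈ Q, (h x).det ≠ 0)
    (hw : ContDiffOn ℝ ∞ w Q) :
    ContDiffOn ℝ ∞ (fun x => (h x)⁻¹ *ᵥ w x) Q := by
  have e : ∀ x, (h x)⁻¹ *ᵥ w x = ((h x).det)⁻¹ • ((h x).adjugate *ᵥ w x) := fun x => by
    rw [Matrix.inv_def, Ring.inverse_eq_inv', Matrix.smul_mulVec]
  simp only [e]
  refine ((contDiffOn_matrix_det hh).inv hd).smul (contDiffOn_mulVec (fun i j => ?_) hw)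
  simp only [Matrix.adjugate_fin_three]
  fin_cases i <;> fin_cases j <;> simp <;> fun_prop

namespace IsCircleAction

variable {Q : Set R3} {F : ℂ × ℝ → R3} {Φ : ℝ → R3 → R3}

theorem continuous_flowDeriv_apply (hF : IsChart Q F) (hΦ : IsCircleAction Q Φ) {x : R3}
    (hx : x ∈ Q) (v : R3) : Continuous fun θ => flowDeriv Q Φ (θ, x) v := by
  have : Continuous fun θ => flowDeriv Q Φ (θ, x) :=
    (hΦ.contDiffOn_flowDeriv hF).continuousOn.comp_continuous (by fun_prop) fun θ => ⟨mem_univ _, hx⟩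
  fun_prop

theorem continuous_flowDeriv_dotProduct (hF : IsChart Q F) (hΦ : IsCircleAction Q Φ) {x : R3}
    (hx : x ∈ Q) (v w : R3) :
    Continuous fun θ => flowDeriv Q Φ (θ, x) v ⬝ᵥ flowDeriv Q Φ (θ, x) w :=
  (hΦ.continuous_flowDeriv_apply hF hx v).dotProduct (hΦ.continuous_flowDeriv_apply hF hx w)

theorem mdot_avgMetric (hF : IsChart Q F) (hΦ : IsCircleAction Q Φ) {x : R3}
    (hx : x ∈ Q) (v w : R3) : mdot (avgMetric Q Φ x) v w = (2 * Real.pi)⁻¹ *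
      ∫ θ in (0 : ℝ)..(2 * Real.pi), flowDeriv Q Φ (θ, x) v ⬝ᵥ flowDeriv Q Φ (θ, x) w := by
  have e : ∀ θ, flowDeriv Q Φ (θ, x) v ⬝ᵥ flowDeriv Q Φ (θ, x) w =
      ∑ i, ∑ j, v i * w j * ((jacobian Q Φ θ x)ᵀ * jacobian Q Φ θ x) i j := fun θ => by
    rw [← jacobian_mulVec, ← jacobian_mulVec, ← dotProduct_transpose_mul_mulVec]
    simp only [dotProduct, Matrix.mulVec, Finset.mul_sum]
    exact Finset.sum_congr rfl fun i _ => Finset.sum_congr rfl fun j _ => by ring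
  have hc : ∀ i j, Continuous fun θ => v i * w j *
      ((jacobian Q Φ θ x)ᵀ * jacobian Q Φ θ x) i j := fun i j => by
    simp only [transpose_mul_apply_eq_dotProduct, jacobian_mulVec]
    exact continuous_const.mul (hΦ.continuous_flowDeriv_dotProduct hF hx _ _)
  simp only [e]
  rw [intervalIntegral.integral_finsetSum fun i _ =>
    (continuous_finsetSum _ fun j _ => hc i j).intervalIntegrable _ _]
  simp only [mdot, dotProduct, Matrix.mulVec, avgMetric, Matrix.of_apply, Finset.mul_sum]
  refine Finset.sum_congr rfl fun i _ => ?_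
  rw [intervalIntegral.integral_finsetSum fun j _ => (hc i j).intervalIntegrable _ _,
    Finset.mul_sum]
  refine Finset.sum_congr rfl fun j _ => ?_
  rw [intervalIntegral.integral_const_mul]
  ring

/-- Pulling back by `Φ_τ` only shifts the averaging variable by `τ`, and the integrand has period
`2π`. -/
theorem mdot_avgMetric_map (hF : IsChart Q F) (hΦ : IsCircleAction Q Φ) (τ : ℝ) {x : R3}
    (hx : x ∈ Q) (v w : R3) :
    mdot (avgMetric Q Φ (Φ τ x)) (flowDeriv Q Φ (τ, x) v) (flowDeriv Q Φ (τ, x) w) =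
      mdot (avgMetric Q Φ x) v w := by
  rw [hΦ.mdot_avgMetric hF (hΦ.mapsTo τ hx), hΦ.mdot_avgMetric hF hx]
  congr 1
  have e : ∀ θ v, flowDeriv Q Φ (θ, Φ τ x) (flowDeriv Q Φ (τ, x) v) =
      flowDeriv Q Φ (θ + τ, x) v := fun θ v => by
    rw [hΦ.flowDeriv_add hF θ τ hx]
    rfl
  simp only [e]
  rw [intervalIntegral.integral_comp_add_right
    (fun θ => flowDeriv Q Φ (θ, x) v ⬝ᵥ flowDeriv Q Φ (θ, x) w)]
  have hp : Function.Periodic (fun θ => flowDeriv Q Φ (θ, x) v ⬝ᵥ flowDeriv Q Φ (θ, x) w)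
      (2 * Real.pi) := fun θ => by
    dsimp only
    rw [hΦ.flowDeriv_periodic hF θ hx]
  have := hp.intervalIntegral_add_eq τ 0
  rw [zero_add, add_comm τ] at this
  rwa [zero_add]

theorem mdot_avgMetric_self_pos (hF : IsChart Q F) (hΦ : IsCircleAction Q Φ) {x : R3}
    (hx : x ∈ Q) {v : R3} (hv : v ≠ 0) : 0 < mdot (avgMetric Q Φ x) v v := by
  rw [hΦ.mdot_avgMetric hF hx]
  refine mul_pos (by positivity) ?_
  refine intervalIntegral.intervalIntegral_pos_of_pos
    ((hΦ.continuous_flowDeriv_dotProduct hF hx v v).intervalIntegrable _ _) (fun θ => ?_)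
    (by positivity)
  have h0 : flowDeriv Q Φ (θ, x) v ≠ 0 := fun h => hv (by
    have := congrArg (fun A : R3 →L[ℝ] R3 => A v) (hΦ.flowDeriv_neg_comp hF θ hx)
    simpa [h] using this.symm)
  exact lt_of_le_of_ne (Finset.sum_nonneg fun i _ => mul_self_nonneg _)
    fun h => h0 (dotProduct_self_eq_zero.1 h.symm)

theorem avgMetric_det_pos (hF : IsChart Q F) (hΦ : IsCircleAction Q Φ) {x : R3}
    (hx : x ∈ Q) : 0 < (avgMetric Q Φ x).det := by
  refine Matrix.PosDef.det_pos (Matrix.PosDef.of_dotProduct_mulVec_pos ?_ ?_)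
  · rw [Matrix.IsHermitian, Matrix.conjTranspose_eq_transpose_of_trivial]
    exact avgMetric_isSymm Q Φ x
  · intro v hv
    rw [star_trivial]
    exact hΦ.mdot_avgMetric_self_pos hF hx hv

theorem contDiffOn_avgMetric (hF : IsChart Q F) (hΦ : IsCircleAction Q Φ) (i j : Fin 3) :
    ContDiffOn ℝ ∞ (fun x => avgMetric Q Φ x i j) Q := by
  simp only [avgMetric, Matrix.of_apply]
  refine contDiffOn_const.mul (hF.contDiffOn_intervalIntegral 0 (2 * Real.pi) ?_)
  have h1 : ∀ v : R3, ContDiffOn ℝ ∞ (fun q => flowDeriv Q Φ q v) (univ ×ˢ Q) := fun v =>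
    (hΦ.contDiffOn_flowDeriv hF).clm_apply contDiffOn_const
  have h2 := contDiffOn_pi.1 (h1 (Pi.single i 1))
  have h3 := contDiffOn_pi.1 (h1 (Pi.single j 1))
  simp only [transpose_mul_apply_eq_dotProduct, jacobian_mulVec, dotProduct]
  refine ContDiffOn.sum fun k _ => ?_
  exact (h2 k).mul (h3 k)

theorem contDiffOn_density (hF : IsChart Q F) (hΦ : IsCircleAction Q Φ) :
    ContDiffOn ℝ ∞ (fun x => density (avgMetric Q Φ x)) Q :=
  (contDiffOn_matrix_det (hΦ.contDiffOn_avgMetric hF)).sqrt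
    fun _ hx => (hΦ.avgMetric_det_pos hF hx).ne'

theorem contDiffOn_mdot (hF : IsChart Q F) (hΦ : IsCircleAction Q Φ) {v w : R3 → R3}
    (hv : ContDiffOn ℝ ∞ v Q) (hw : ContDiffOn ℝ ∞ w Q) :
    ContDiffOn ℝ ∞ (fun x => mdot (avgMetric Q Φ x) (v x) (w x)) Q :=
  contDiffOn_dotProduct hv (contDiffOn_mulVec (hΦ.contDiffOn_avgMetric hF) hw)

theorem contDiffOn_radiusSq (hF : IsChart Q F) (hΦ : IsCircleAction Q Φ) :
    ContDiffOn ℝ ∞ (radiusSq Q Φ) Q :=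
  hΦ.contDiffOn_mdot hF (hΦ.contDiffOn_generator hF) (hΦ.contDiffOn_generator hF)

/-- The generator is invariant under the action. -/
theorem generator_map (hF : IsChart Q F) (hΦ : IsCircleAction Q Φ) (θ : ℝ) {x : R3}
    (hx : x ∈ Q) : generator Φ (Φ θ x) = flowDeriv Q Φ (θ, x) (generator Φ x) :=
  hΦ.map_eq_of_bracket hF (hΦ.differentiableOn_generator hF)
    (fun x _ => by simp [VectorField.lieBracketWithin]) θ hx

theorem radiusSq_map (hF : IsChart Q F) (hΦ : IsCircleAction Q Φ) (θ : ℝ) {x : R3}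
    (hx : x ∈ Q) : radiusSq Q Φ (Φ θ x) = radiusSq Q Φ x := by
  rw [radiusSq, hΦ.generator_map hF θ hx, hΦ.mdot_avgMetric_map hF θ hx, radiusSq]

/-- The averaged metric is invariant, as a matrix identity. -/
theorem transpose_mul_avgMetric_mul (hF : IsChart Q F) (hΦ : IsCircleAction Q Φ) (θ : ℝ) {x : R3}
    (hx : x ∈ Q) :
    (jacobian Q Φ θ x)ᵀ * avgMetric Q Φ (Φ θ x) * jacobian Q Φ θ x = avgMetric Q Φ x := by
  have h1 : ∀ v w, v ⬝ᵥ (((jacobian Q Φ θ x)ᵀ * avgMetric Q Φ (Φ θ x) * jacobian Q Φ θ x) *ᵥ w) =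
      v ⬝ᵥ (avgMetric Q Φ x *ᵥ w) := fun v w => by
    rw [← Matrix.mulVec_mulVec, ← Matrix.mulVec_mulVec, Matrix.dotProduct_mulVec,
      Matrix.vecMul_transpose, jacobian_mulVec, jacobian_mulVec]
    exact hΦ.mdot_avgMetric_map hF θ hx v w
  ext i j
  simpa using h1 (Pi.single i 1) (Pi.single j 1)

end IsCircleAction

theorem IsVolumePreservingCircleAction.density_map {Q : Set R3} {F : ℂ × ℝ → R3} {Φ : ℝ → R3 → R3}
    (hF : IsChart Q F) (hΦ : IsVolumePreservingCircleAction Q Φ) (θ : ℝ) {x : R3}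
    (hx : x ∈ Q) : density (avgMetric Q Φ (Φ θ x)) = density (avgMetric Q Φ x) := by
  have h1 : (jacobian Q Φ θ x).det = 1 := by
    rw [← hΦ.det_eq_one hF θ hx, det_eq]
    rfl
  rw [density, density, ← hΦ.toIsCircleAction.transpose_mul_avgMetric_mul hF θ hx, Matrix.det_mul,
    Matrix.det_mul, Matrix.det_transpose, h1, one_mul, mul_one]

/-! ### Vector calculus identities -/

/-- The vector product as a continuous bilinear map. -/
noncomputable def crossCLM : R3 →L[ℝ] R3 →L[ℝ] R3 :=
  LinearMap.toContinuousBilinearMap (crossProduct (R := ℝ))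

@[simp]
theorem crossCLM_apply (v w : R3) : crossCLM v w = v ⨯₃ w := rfl

/-- The scalar product as a continuous bilinear map. -/
noncomputable def dotCLM : R3 →L[ℝ] R3 →L[ℝ] ℝ :=
  LinearMap.toContinuousBilinearMap (dotProductBilin ℝ ℝ)

@[simp]
theorem dotCLM_apply (v w : R3) : dotCLM v w = v ⬝ᵥ w := rfl

theorem fderivWithin_cross_apply {Q : Set R3} {u v : R3 → R3} {x : R3}
    (hQ : UniqueDiffWithinAt ℝ Q x) (hu : DifferentiableWithinAt ℝ u Q x)
    (hv : DifferentiableWithinAt ℝ v Q x) (z : R3) :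
    fderivWithin ℝ (fun y => u y ⨯₃ v y) Q x z =
      fderivWithin ℝ u Q x z ⨯₃ v x + u x ⨯₃ fderivWithin ℝ v Q x z := by
  have h := crossCLM.hasFDerivWithinAt_of_bilinear hu.hasFDerivWithinAt hv.hasFDerivWithinAt
  have h' := h.fderivWithin hQ
  change fderivWithin ℝ (fun y => crossCLM (u y) (v y)) Q x z = _
  rw [h']
  simp [add_comm]

theorem fderivWithin_dotProduct_apply {Q : Set R3} {u v : R3 → R3} {x : R3}
    (hQ : UniqueDiffWithinAt ℝ Q x) (hu : DifferentiableWithinAt ℝ u Q x)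
    (hv : DifferentiableWithinAt ℝ v Q x) (z : R3) :
    fderivWithin ℝ (fun y => u y ⬝ᵥ v y) Q x z =
      fderivWithin ℝ u Q x z ⬝ᵥ v x + u x ⬝ᵥ fderivWithin ℝ v Q x z := by
  have h := dotCLM.hasFDerivWithinAt_of_bilinear hu.hasFDerivWithinAt hv.hasFDerivWithinAt
  have h' := h.fderivWithin hQ
  change fderivWithin ℝ (fun y => dotCLM (u y) (v y)) Q x z = _
  rw [h']
  simp [add_comm]

theorem fderivWithin_apply_eq_partialD (Q : Set R3) (w : R3 → R3) (x z : R3) (j : Fin 3) :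
    fderivWithin ℝ w Q x z j = ∑ i, z i * partialD Q w x i j := by
  rw [clm_apply_eq_mulVec]
  simp only [Matrix.mulVec, dotProduct, Matrix.of_apply, partialD]
  exact Finset.sum_congr rfl fun i _ => mul_comm _ _

/-- The curl is the antisymmetric part of the derivative. -/
theorem curl_dotProduct_cross (Q : Set R3) (w : R3 → R3) (x a b : R3) :
    curl Q w x ⬝ᵥ (a ⨯₃ b) = fderivWithin ℝ w Q x a ⬝ᵥ b - fderivWithin ℝ w Q x b ⬝ᵥ a := by
  simp only [dotProduct, fderivWithin_apply_eq_partialD, Fin.sum_univ_three, curl, cross_apply,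
    Matrix.cons_val_zero, Matrix.cons_val_one, Matrix.cons_val]
  ring

theorem eq_of_forall_dotProduct_cross {c d : R3}
    (h : ∀ a b : R3, c ⬝ᵥ (a ⨯₃ b) = d ⬝ᵥ (a ⨯₃ b)) : c = d := by
  have h0 := h ![0, 1, 0] ![0, 0, 1]
  have h1 := h ![0, 0, 1] ![1, 0, 0]
  have h2 := h ![1, 0, 0] ![0, 1, 0]
  simp [cross_apply, dotProduct, Fin.sum_univ_three] at h0 h1 h2
  ext i
  fin_cases i
  exacts [h0, h1, h2]

theorem curl_cross {Q : Set R3} {u v : R3 → R3} {x : R3}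
    (hQ : UniqueDiffWithinAt ℝ Q x) (hu : DifferentiableWithinAt ℝ u Q x)
    (hv : DifferentiableWithinAt ℝ v Q x) :
    curl Q (fun y => u y ⨯₃ v y) x = div Q v x • u x - div Q u x • v x +
      fderivWithin ℝ u Q x (v x) - fderivWithin ℝ v Q x (u x) := by
  refine eq_of_forall_dotProduct_cross fun a b => ?_
  rw [curl_dotProduct_cross, fderivWithin_cross_apply hQ hu hv, fderivWithin_cross_apply hQ hu hv]
  simp only [dotProduct, fderivWithin_apply_eq_partialD, Fin.sum_univ_three, div, cross_apply,
    Matrix.cons_val_zero, Matrix.cons_val_one, Matrix.cons_val, Pi.add_apply, Pi.sub_apply,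
    Pi.smul_apply, smul_eq_mul]
  ring

/-- The remaining term of the product rule, `∇f × w`, is orthogonal to `w`. -/
theorem dotProduct_curl_smul {Q : Set R3} {f : R3 → ℝ} {w : R3 → R3} {x : R3}
    (hQ : UniqueDiffWithinAt ℝ Q x) (hf : DifferentiableWithinAt ℝ f Q x)
    (hw : DifferentiableWithinAt ℝ w Q x) :
    w x ⬝ᵥ curl Q (fun y => f y • w y) x = f x * (w x ⬝ᵥ curl Q w x) := by
  have h := (hf.hasFDerivWithinAt.fun_smul hw.hasFDerivWithinAt).fderivWithin hQ
  have e : ∀ i j, partialD Q (fun y => f y • w y) x i j =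
      f x * partialD Q w x i j + grad Q f x i * w x j := fun i j => by
    simp [partialD, h, grad]
  simp only [dotProduct, Fin.sum_univ_three, curl, e, Matrix.cons_val_zero, Matrix.cons_val_one,
    Matrix.cons_val]
  ring

theorem curl_add {Q : Set R3} {v w : R3 → R3} {x : R3}
    (hQ : UniqueDiffWithinAt ℝ Q x) (hv : DifferentiableWithinAt ℝ v Q x)
    (hw : DifferentiableWithinAt ℝ w Q x) :
    curl Q (fun y => v y + w y) x = curl Q v x + curl Q w x := by
  refine eq_of_forall_dotProduct_cross fun a b => ?_
  rw [add_dotProduct]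
  simp only [curl_dotProduct_cross]
  rw [fderivWithin_fun_add hQ hv hw]
  simp only [_root_.add_apply, add_dotProduct]
  ring

theorem curl_congr {Q : Set R3} {v w : R3 → R3} (h : EqOn v w Q) {x : R3} (hx : x ∈ Q) :
    curl Q v x = curl Q w x := by
  simp only [curl, partialD, fderivWithin_congr h (h hx)]

theorem contDiffOn_curl {Q : Set R3} (hQ : UniqueDiffOn ℝ Q) {w : R3 → R3}
    (hw : ContDiffOn ℝ ∞ w Q) : ContDiffOn ℝ ∞ (curl Q w) Q := by
  have h : ∀ i j, ContDiffOn ℝ ∞ (fun x => partialD Q w x i j) Q := fun i j =>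
    contDiffOn_pi.1 ((hw.fderivWithin hQ (m := ∞) (by simp)).clm_apply contDiffOn_const) j
  rw [contDiffOn_pi]
  intro i
  fin_cases i <;> exact (h _ _).sub (h _ _)

theorem contDiffOn_grad {Q : Set R3} (hQ : UniqueDiffOn ℝ Q) {f : R3 → ℝ}
    (hf : ContDiffOn ℝ ∞ f Q) : ContDiffOn ℝ ∞ (grad Q f) Q :=
  contDiffOn_pi.2 fun _ => (hf.fderivWithin hQ (m := ∞) (by simp)).clm_apply contDiffOn_const

theorem clm_cross_dotProduct (A : R3 →L[ℝ] R3) (a b c : R3) :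
    (A a ⨯₃ A b) ⬝ᵥ A c = A.det * ((a ⨯₃ b) ⬝ᵥ c) := by
  rw [det_eq, Matrix.det_fin_three]
  simp only [clm_apply_eq_mulVec A a, clm_apply_eq_mulVec A b, clm_apply_eq_mulVec A c,
    Matrix.mulVec, dotProduct, Fin.sum_univ_three, cross_apply,
    Matrix.cons_val_zero, Matrix.cons_val_one, Matrix.cons_val, Matrix.of_apply]
  ring

theorem IsChart.eq_of_fderivWithin_eq_zero {Q : Set R3} {F : ℂ × ℝ → R3} (hF : IsChart Q F)
    {f : R3 → ℝ} (hf : ∀ x ∈ Q, HasFDerivWithinAt f (0 : R3 →L[ℝ] ℝ) Q x) {x y : R3}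
    (hx : x ∈ Q) (hy : y ∈ Q) : f x = f y := by
  obtain ⟨q, hq, rfl⟩ := hF.exists_eq hx
  obtain ⟨r, hr, rfl⟩ := hF.exists_eq hy
  have h : ∀ z ∈ solidCyl, HasFDerivWithinAt (f ∘ F) (0 : ℂ × ℝ →L[ℝ] ℝ) solidCyl z :=
    fun z hz => by
      simpa using (hf _ (hF.mem hz)).comp z (hF.hasFDerivWithinAt hz) hF.mapsTo
  exact convex_solidCyl.is_const_of_fderivWithin_eq_zero
    (fun z hz => (h z hz).differentiableWithinAt)
    (fun z hz => (h z hz).fderivWithin (uniqueDiffOn_solidCyl z hz)) hq hr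

/-! ### Invariant functions and the stream function -/

/-- A function constant along the orbits of the action has gradient orthogonal to the generator. -/
theorem IsCircleAction.fderivWithin_generator_eq_zero {Q : Set R3} {Φ : ℝ → R3 → R3}
    (hΦ : IsCircleAction Q Φ) {f : R3 → ℝ} (hf : DifferentiableOn ℝ f Q) {x : R3} (hx : x ∈ Q)
    (hinv : ∀ θ, f (Φ θ x) = f x) : fderivWithin ℝ f Q x (generator Φ x) = 0 := by
  have h1 : HasDerivAt (fun τ => f (Φ τ x)) (fderivWithin ℝ f Q (Φ 0 x) (generator Φ x)) 0 :=
    hasDerivAt_comp_of_mem' (fun τ => hΦ.mapsTo τ hx)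
      (hf _ (hΦ.mapsTo 0 hx)).hasFDerivWithinAt (hΦ.hasDerivAt_zero hx)
  rw [funext hinv, hΦ.map_zero x hx] at h1
  exact h1.unique (hasDerivAt_const 0 _)

namespace IsVolumePreservingCircleAction

variable {Q : Set R3} {F : ℂ × ℝ → R3} {Φ : ℝ → R3 → R3}

/-- A function whose gradient is the vector product of two invariant fields is invariant. -/
theorem map_eq_of_grad_eq_cross (hF : IsChart Q F) (hΦ : IsVolumePreservingCircleAction Q Φ)
    {f : R3 → ℝ} (hf : DifferentiableOn ℝ f Q) {v w : R3 → R3}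
    (hg : ∀ x ∈ Q, v x ⨯₃ w x = grad Q f x)
    (hv : ∀ θ, ∀ x ∈ Q, v (Φ θ x) = flowDeriv Q Φ (θ, x) (v x))
    (hw : ∀ θ, ∀ x ∈ Q, w (Φ θ x) = flowDeriv Q Φ (θ, x) (w x)) (θ : ℝ) {x : R3} (hx : x ∈ Q) :
    f (Φ θ x) = f x := by
  have hΦ' := hΦ.toIsCircleAction
  have hd : ∀ y ∈ Q, HasFDerivWithinAt (fun y => f (Φ θ y) - f y) (0 : R3 →L[ℝ] ℝ) Q y := by
    intro y hy
    have h1 := ((hf _ (hΦ'.mapsTo θ hy)).hasFDerivWithinAt.comp y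
      (hΦ'.hasFDerivWithinAt θ hy) (hΦ'.mapsTo θ)).fun_sub (hf y hy).hasFDerivWithinAt
    refine h1.congr_fderiv ?_
    ext1 z
    simp only [_root_.sub_apply, ContinuousLinearMap.comp_apply, _root_.zero_apply]
    rw [← grad_dotProduct, ← grad_dotProduct, ← hg _ (hΦ'.mapsTo θ hy), ← hg y hy, hv θ y hy,
      hw θ y hy, clm_cross_dotProduct, hΦ.det_eq_one hF θ hy, one_mul, sub_self]
  -- `f ∘ Φ_θ - f` is constant; it is nonpositive where `f` is largest and nonnegative where `f` is
  -- smallest, so it is zero.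
  have hconst : ∀ y ∈ Q, f (Φ θ x) - f x = f (Φ θ y) - f y := fun y hy =>
    hF.eq_of_fderivWithin_eq_zero hd hx hy
  obtain ⟨y, hy, hmax⟩ := hF.isCompact.exists_isMaxOn ⟨x, hx⟩ hf.continuousOn
  obtain ⟨z, hz, hmin⟩ := hF.isCompact.exists_isMinOn ⟨x, hx⟩ hf.continuousOn
  have h1 : f (Φ θ y) ≤ f y := hmax (hΦ'.mapsTo θ hy)
  have h2 : f z ≤ f (Φ θ z) := hmin (hΦ'.mapsTo θ hz)
  linarith [hconst y hy, hconst z hz]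

end IsVolumePreservingCircleAction

/-- Three vectors orthogonal to a nonzero vector have vanishing triple product. -/
theorem cross_dotProduct_eq_zero {n u B t : R3} (hn : n ≠ 0) (hu : n ⬝ᵥ u = 0) (hB : n ⬝ᵥ B = 0)
    (ht : n ⬝ᵥ t = 0) : (u ⨯₃ B) ⬝ᵥ t = 0 := by
  have h : ((u ⨯₃ B) ⬝ᵥ t) • n =
      (n ⬝ᵥ u) • (B ⨯₃ t) + (n ⬝ᵥ B) • (t ⨯₃ u) + (n ⬝ᵥ t) • (u ⨯₃ B) := by
    ext i
    fin_cases i <;> simp [dotProduct, Fin.sum_univ_three, cross_apply] <;> ring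
  rw [hu, hB, ht, zero_smul, zero_smul, zero_smul, add_zero, add_zero] at h
  exact (smul_eq_zero.1 h).resolve_right hn

/-- `u`, `B` and the boundary tangent are all orthogonal to the nonzero gradient of a function
constant on `∂Q`, so the three are coplanar. -/
theorem IsChart.cross_dotProduct_bdryTangent {Q : Set R3} {F : ℂ × ℝ → R3} (hF : IsChart Q F)
    {Φ : ℝ → R3 → R3} (hΦ : IsCircleAction Q Φ) {B : R3 → R3}
    (hB : ∀ x ∈ frontier Q, ∀ n : R3, IsNormalToBoundary Q x n → B x ⬝ᵥ n = 0) {q : ℂ × ℝ}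
    (hq : q ∈ solidCyl) (hq1 : ‖q.1‖ = 1) (α β : ℝ) :
    (generator Φ (F q) ⨯₃ B (F q)) ⬝ᵥ fderivWithin ℝ F solidCyl q (bdryTangent q α β) = 0 := by
  obtain ⟨G, hG, hG1, hG0, hGn⟩ := hF.exists_boundary_function
  have hfr : F q ∈ frontier Q := (hF.mem_frontier_iff hq).2 hq1
  have hGd : DifferentiableOn ℝ G Q := hG.differentiableOn (by simp)
  refine cross_dotProduct_eq_zero (hG0 _ hfr) (hΦ.grad_dotProduct_generator hF hGd hG1 hfr) ?_ ?_
  · rw [dotProduct_comm]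
    exact hB _ hfr _ (hGn _ hfr)
  · rw [grad_dotProduct]
    exact hF.apply_bdryTangent_eq_zero hGd hG1 hq hq1 α β

theorem hasFDerivWithinAt_of_grad_eq {Q : Set R3} {f : R3 → ℝ} {x g : R3}
    (hf : DifferentiableWithinAt ℝ f Q x) (hg : g = grad Q f x) :
    HasFDerivWithinAt f (dotCLM g) Q x := by
  refine hf.hasFDerivWithinAt.congr_fderiv ?_
  ext1 z
  rw [dotCLM_apply, hg, grad_dotProduct]

/-- As `u` and `B` are divergence free, the curl of `u × B` is `-[u, B] = 0`. The circulation along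
the longitude `z = 1` vanishes because `u × B` is normal to the boundary. -/
theorem IsVolumePreservingCircleAction.exists_isStreamFunction {Q : Set R3} {F : ℂ × ℝ → R3}
    {Φ : ℝ → R3 → R3} (hF : IsChart Q F) (hΦ : IsVolumePreservingCircleAction Q Φ) {B : R3 → R3}
    (hBs : ContDiffOn ℝ ∞ B Q) (hdiv : ∀ x ∈ Q, div Q B x = 0)
    (hB : ∀ x ∈ frontier Q, ∀ n : R3, IsNormalToBoundary Q x n → B x ⬝ᵥ n = 0)
    (hb : ∀ x ∈ Q, VectorField.lieBracketWithin ℝ (generator Φ) B Q x = 0) :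
    ∃ ψ : R3 → ℝ, IsStreamFunction Q (generator Φ) B ψ := by
  have hΦ' := hΦ.toIsCircleAction
  have hus := hΦ'.contDiffOn_generator hF
  have hu := hΦ'.differentiableOn_generator hF
  have hBd : DifferentiableOn ℝ B Q := hBs.differentiableOn (by simp)
  set E : R3 → R3 := fun x => generator Φ x ⨯₃ B x with hE
  have hEs : ContDiffOn ℝ ∞ E Q := contDiffOn_cross hus hBs
  have hEd : DifferentiableOn ℝ E Q := hEs.differentiableOn (by simp)
  have hcurl : ∀ x ∈ Q, curl Q E x = 0 := fun x hx => by
    have := hb x hx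
    rw [VectorField.lieBracketWithin] at this
    rw [hE, curl_cross (hF.uniqueDiffOn x hx) (hu x hx) (hBd x hx), hdiv x hx,
      hΦ.div_generator hF hx, zero_smul, zero_smul, sub_zero, zero_add, ← neg_sub, this, neg_zero]
  have hβs : ContDiffOn ℝ ∞ (fun x => dotCLM (E x)) Q := dotCLM.contDiff.comp_contDiffOn hEs
  obtain ⟨ψ, hψ⟩ := hF.exists_primitive (β := fun x => dotCLM (E x))
    (hβs.differentiableOn (by simp)) (by
      intro x hx v w
      have h1 : HasFDerivWithinAt (fun x => dotCLM (E x)) (dotCLM ∘L fderivWithin ℝ E Q x) Q x :=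
        dotCLM.hasFDerivAt.comp_hasFDerivWithinAt x (hEd x hx).hasFDerivWithinAt
      rw [h1.fderivWithin (hF.uniqueDiffOn x hx)]
      have h2 := curl_dotProduct_cross Q E x v w
      rw [hcurl x hx, zero_dotProduct] at h2
      exact (sub_eq_zero.1 h2.symm)) (by
      intro s
      have h1 := hF.cross_dotProduct_bdryTangent hΦ' hB (q := (1, s)) (by simp) (by simp) 0 1
      have h2 : bdryTangent ((1, s) : ℂ × ℝ) 0 1 = (0, 1) := by simp [bdryTangent]
      rwa [h2] at h1)
  have hψ' : ∀ x ∈ Q, fderivWithin ℝ ψ Q x = dotCLM (E x) := fun x hx =>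
    (hψ x hx).fderivWithin (hF.uniqueDiffOn x hx)
  refine ⟨ψ, ?_, fun x hx => ?_⟩
  · rw [contDiffOn_infty_iff_fderivWithin hF.uniqueDiffOn]
    exact ⟨fun x hx => (hψ x hx).differentiableWithinAt, hβs.congr hψ'⟩
  · ext i
    simp [grad, hψ' x hx, hE]

theorem IsStreamFunction.exists_const_frontier {Q : Set R3} {F : ℂ × ℝ → R3}
    {Φ : ℝ → R3 → R3} {B : R3 → R3} {ψ : R3 → ℝ} (hψ : IsStreamFunction Q (generator Φ) B ψ)
    (hF : IsChart Q F) (hΦ : IsCircleAction Q Φ)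
    (hB : ∀ x ∈ frontier Q, ∀ n : R3, IsNormalToBoundary Q x n → B x ⬝ᵥ n = 0) :
    ∃ c, ∀ x ∈ frontier Q, ψ x = c :=
  hF.exists_const_frontier (η := fun x => dotCLM (generator Φ x ⨯₃ B x))
    (fun x hx => hasFDerivWithinAt_of_grad_eq (hψ.1.differentiableOn (by simp) x hx) (hψ.2 x hx))
    fun _ hq hq1 α β => hF.cross_dotProduct_bdryTangent hΦ hB hq hq1 α β

theorem dotProduct_mulVec_comm {h : Matrix (Fin 3) (Fin 3) ℝ} (hs : h.IsSymm) (v w : R3) :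
    (h *ᵥ v) ⬝ᵥ w = v ⬝ᵥ (h *ᵥ w) := by
  rw [dotProduct_comm]
  exact mdot_comm hs w v

/-! ### The averaged one-form of an invariant field -/

namespace IsVolumePreservingCircleAction

variable {Q : Set R3} {F : ℂ × ℝ → R3} {Φ : ℝ → R3 → R3} {B : R3 → R3}

/-- The pullback of the one-form dual to `B` by `Φ_θ`. -/
theorem exists_fderiv_pullback (hF : IsChart Q F) (hΦ : IsVolumePreservingCircleAction Q Φ)
    (hBs : ContDiffOn ℝ ∞ B Q)
    (hJ : ∀ θ, ∀ x ∈ Q, curl Q B (Φ θ x) = flowDeriv Q Φ (θ, x) (curl Q B x)) :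
    ∃ (f : ℝ → R3 → R3) (f' : ℝ → R3 → R3 →L[ℝ] R3),
      (∀ θ x v, f θ x ⬝ᵥ v = flowDeriv Q Φ (θ, x) v ⬝ᵥ B (Φ θ x)) ∧
      ContinuousOn (Function.uncurry f) (univ ×ˢ Q) ∧
      ContinuousOn (Function.uncurry f') (univ ×ˢ Q) ∧
      (∀ θ, ∀ x ∈ Q, HasFDerivWithinAt (f θ) (f' θ x) Q x) ∧
      ∀ θ, ∀ x ∈ Q, ∀ a b, f' θ x a ⬝ᵥ b - f' θ x b ⬝ᵥ a = curl Q B x ⬝ᵥ (a ⨯₃ b) := by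
  have hΦ' := hΦ.toIsCircleAction
  set f : ℝ → R3 → R3 := fun θ x i => flowDeriv Q Φ (θ, x) (Pi.single i 1) ⬝ᵥ B (Φ θ x) with hf
  have hfv : ∀ θ x v, f θ x ⬝ᵥ v = flowDeriv Q Φ (θ, x) v ⬝ᵥ B (Φ θ x) := by
    intro θ x v
    have hv : v = ∑ i, v i • (Pi.single i (1 : ℝ) : R3) := by
      ext j; simp [Finset.sum_apply, Pi.single_apply]
    conv_rhs => rw [hv, _root_.map_sum, sum_dotProduct]
    simp only [hf, dotProduct, _root_.map_smul, Pi.smul_apply, smul_eq_mul, Finset.sum_mul]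
    exact Finset.sum_congr rfl fun i _ => Finset.sum_congr rfl fun j _ => by ring
  have hN := hΦ'.contDiffOn_flowDeriv hF
  have hBΦ : ContDiffOn ℝ ∞ (fun q : ℝ × R3 => B (Φ q.1 q.2)) (univ ×ˢ Q) :=
    hBs.comp hΦ'.smooth fun q hq => hΦ'.mapsTo q.1 hq.2
  have hfs : ContDiffOn ℝ ∞ (Function.uncurry f) (univ ×ˢ Q) :=
    contDiffOn_pi.2 fun i =>
      (dotCLM.contDiff.comp_contDiffOn (hN.clm_apply contDiffOn_const)).clm_apply hBΦ
  have hU := IsCircleAction.uniqueDiffOn_prod hF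
  set f' : ℝ → R3 → R3 →L[ℝ] R3 := fun θ x =>
    fderivWithin ℝ (Function.uncurry f) (univ ×ˢ Q) (θ, x) ∘L ContinuousLinearMap.inr ℝ ℝ R3
    with hf'
  have hff' : ∀ θ, ∀ x ∈ Q, HasFDerivWithinAt (f θ) (f' θ x) Q x := fun θ x hx =>
    IsCircleAction.hasFDerivWithinAt_slice
      (hfs.differentiableOn (by simp) (θ, x) ⟨mem_univ _, hx⟩).hasFDerivWithinAt
  refine ⟨f, f', hfv, hfs.continuousOn, ?_, hff', ?_⟩
  · exact (((hfs.fderivWithin hU (m := ∞) (by simp)).clm_comp contDiffOn_const).continuousOn)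
  · intro θ x hx a b
    have hux := hF.uniqueDiffOn x hx
    have hNd : DifferentiableWithinAt ℝ (fderivWithin ℝ (Φ θ) Q) Q x :=
      ((hΦ'.contDiffOn θ).fderivWithin hF.uniqueDiffOn (m := ∞) (by simp)).differentiableOn
        (by simp) x hx
    have hBd : HasFDerivWithinAt (fun y => B (Φ θ y))
        (fderivWithin ℝ B Q (Φ θ x) ∘L flowDeriv Q Φ (θ, x)) Q x :=
      (hBs.differentiableOn (by simp) _ (hΦ'.mapsTo θ hx)).hasFDerivWithinAt.comp x
        (hΦ'.hasFDerivWithinAt θ hx) (hΦ'.mapsTo θ)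
    have hsymm : ∀ v w, fderivWithin ℝ (fderivWithin ℝ (Φ θ) Q) Q x v w =
        fderivWithin ℝ (fderivWithin ℝ (Φ θ) Q) Q x w v :=
      ((hΦ'.contDiffOn θ) x hx).isSymmSndFDerivWithinAt (by
        rw [minSmoothness_of_isRCLikeNormedField]; exact WithTop.coe_le_coe.2 le_top)
        hF.uniqueDiffOn (hF.subset_closure_interior hx) hx
    -- The term with the second derivative of `Φ_θ` is symmetric and drops out of the antisymmetric
    -- part. What is left is the curl of `B` at `Φ_θ x` paired with `DΦ_θ a × DΦ_θ b`; invariance of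
    -- the curl and `det DΦ_θ = 1` bring it back to `x`.
    have key : ∀ a b, f' θ x a ⬝ᵥ b =
        fderivWithin ℝ (fderivWithin ℝ (Φ θ) Q) Q x a b ⬝ᵥ B (Φ θ x) +
        flowDeriv Q Φ (θ, x) b ⬝ᵥ fderivWithin ℝ B Q (Φ θ x) (flowDeriv Q Φ (θ, x) a) := by
      intro a b
      have h1 : fderivWithin ℝ (fun y => f θ y ⬝ᵥ b) Q x a = f' θ x a ⬝ᵥ b := by
        rw [fderivWithin_dotProduct_apply hux (hff' θ x hx).differentiableWithinAt
          (differentiableWithinAt_const b), (hff' θ x hx).fderivWithin hux]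
        simp
      have hNb : HasFDerivWithinAt (fun y => flowDeriv Q Φ (θ, y) b)
          ((fderivWithin ℝ (fderivWithin ℝ (Φ θ) Q) Q x).flip b) Q x := by
        have := hNd.hasFDerivWithinAt.clm_apply (hasFDerivWithinAt_const b x Q)
        simpa [flowDeriv] using this
      rw [← h1, funext fun y => hfv θ y b, fderivWithin_dotProduct_apply hux
        hNb.differentiableWithinAt hBd.differentiableWithinAt, hNb.fderivWithin hux,
        hBd.fderivWithin hux]
      rfl
    rw [key, key, hsymm a b, add_sub_add_left_eq_sub, dotProduct_comm,
      dotProduct_comm (flowDeriv Q Φ (θ, x) a), ← curl_dotProduct_cross, hJ θ x hx,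
      dotProduct_comm, clm_cross_dotProduct, hΦ.det_eq_one hF θ hx, one_mul, dotProduct_comm]

/-- The averaged one-form dual to an invariant field `B` has the same curl as `B`. -/
theorem curl_avgMetric_mulVec (hF : IsChart Q F) (hΦ : IsVolumePreservingCircleAction Q Φ)
    (hBs : ContDiffOn ℝ ∞ B Q)
    (hB : ∀ θ, ∀ x ∈ Q, B (Φ θ x) = flowDeriv Q Φ (θ, x) (B x))
    (hJ : ∀ θ, ∀ x ∈ Q, curl Q B (Φ θ x) = flowDeriv Q Φ (θ, x) (curl Q B x)) {x : R3}
    (hx : x ∈ Q) : curl Q (fun y => avgMetric Q Φ y *ᵥ B y) x = curl Q B x := by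
  obtain ⟨f, f', hfv, hfc, hfc', hff', hanti⟩ := hΦ.exists_fderiv_pullback hF hBs hJ
  have hΦ' := hΦ.toIsCircleAction
  have hslice : ∀ y ∈ Q, Continuous fun θ => f θ y := fun y hy =>
    hfc.comp_continuous (f := fun θ => (θ, y)) (by fun_prop) fun θ => ⟨mem_univ _, hy⟩
  have hslice' : ∀ y ∈ Q, Continuous fun θ => f' θ y := fun y hy =>
    hfc'.comp_continuous (f := fun θ => (θ, y)) (by fun_prop) fun θ => ⟨mem_univ _, hy⟩
  -- By invariance `DΦ_θ B` is `B` at `Φ_θ`, so the integrand defining `ḡ B` is the pullback of the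
  -- Euclidean one-form of `B`.
  have heq : EqOn (fun y => avgMetric Q Φ y *ᵥ B y)
      (fun y => (2 * Real.pi)⁻¹ • ∫ θ in (0 : ℝ)..(2 * Real.pi), f θ y) Q := by
    intro y hy
    refine dotProduct_eq _ _ fun v => ?_
    dsimp only
    rw [dotProduct_comm]
    change mdot (avgMetric Q Φ y) v (B y) = _
    rw [hΦ'.mdot_avgMetric hF hy, smul_dotProduct, smul_eq_mul]
    congr 1
    have h1 := (dotCLM.flip v).intervalIntegral_comp_comm
      ((hslice y hy).intervalIntegrable (μ := volume) 0 (2 * Real.pi))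
    simp only [ContinuousLinearMap.flip_apply, dotCLM_apply, hfv] at h1
    rw [← h1]
    simp only [hB _ y hy]
  rw [curl_congr heq hx]
  refine eq_of_forall_dotProduct_cross fun a b => ?_
  have hd := (hF.hasFDerivWithinAt_intervalIntegral 0 (2 * Real.pi) hfc hfc' hff' hx).const_smul
    (2 * Real.pi)⁻¹
  have hd' : fderivWithin ℝ (fun y => (2 * Real.pi)⁻¹ • ∫ θ in (0 : ℝ)..(2 * Real.pi), f θ y) Q x
      = _ := hd.fderivWithin (hF.uniqueDiffOn x hx)
  rw [curl_dotProduct_cross, hd']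
  -- `L` extracts the antisymmetric part. It commutes with the integral, and on the integrand its
  -- value does not depend on `θ`.
  set L : (R3 →L[ℝ] R3) →L[ℝ] ℝ :=
    (dotCLM.flip b) ∘L (ContinuousLinearMap.apply ℝ R3 a) -
      (dotCLM.flip a) ∘L (ContinuousLinearMap.apply ℝ R3 b) with hL
  have hLA : ∀ A, L A = A a ⬝ᵥ b - A b ⬝ᵥ a := fun A => rfl
  have h2 := L.intervalIntegral_comp_comm
    ((hslice' x hx).intervalIntegrable (μ := volume) 0 (2 * Real.pi))
  have h3 : ∀ θ, L (f' θ x) = curl Q B x ⬝ᵥ (a ⨯₃ b) := fun θ => hanti θ x hx a b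
  simp only [h3, intervalIntegral.integral_const, sub_zero, smul_eq_mul] at h2
  rw [← hLA, _root_.map_smul, ← h2, smul_eq_mul, inv_mul_cancel_left₀ (by positivity)]

/-- The gradient of the averaged product `u ·̄ B` is `u × J`. -/
theorem grad_mdot_generator (hF : IsChart Q F) (hΦ : IsVolumePreservingCircleAction Q Φ)
    (hBs : ContDiffOn ℝ ∞ B Q)
    (hB : ∀ θ, ∀ x ∈ Q, B (Φ θ x) = flowDeriv Q Φ (θ, x) (B x))
    (hJ : ∀ θ, ∀ x ∈ Q, curl Q B (Φ θ x) = flowDeriv Q Φ (θ, x) (curl Q B x)) {x : R3}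
    (hx : x ∈ Q) : generator Φ x ⨯₃ curl Q B x =
      grad Q (fun y => mdot (avgMetric Q Φ y) (generator Φ y) (B y)) x := by
  have hΦ' := hΦ.toIsCircleAction
  set w : R3 → R3 := fun y => avgMetric Q Φ y *ᵥ B y with hw
  have hws : DifferentiableOn ℝ w Q :=
    (contDiffOn_mulVec (hΦ'.contDiffOn_avgMetric hF) hBs).differentiableOn (by simp)
  have hsymm := avgMetric_isSymm Q Φ
  -- Cartan's formula: the Lie derivative along `u` of the invariant one-form `ḡ B` is zero, so the
  -- differential of its pairing with `u` is minus the contraction of its exterior derivative with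
  -- `u`.
  have hinv : ∀ θ v, w (Φ θ x) ⬝ᵥ flowDeriv Q Φ (θ, x) v = w x ⬝ᵥ v := fun θ v => by
    rw [dotProduct_comm, dotProduct_comm (w x), hw]
    dsimp only
    rw [hB θ x hx]
    exact hΦ'.mdot_avgMetric_map hF θ hx v (B x)
  refine dotProduct_eq _ _ fun v => ?_
  have h1 := hΦ'.fderivWithin_dotProduct_eq_of_map_eq hF hws hx hinv v
  have h2 : grad Q (fun y => mdot (avgMetric Q Φ y) (generator Φ y) (B y)) x ⬝ᵥ v =
      fderivWithin ℝ (generator Φ) Q x v ⬝ᵥ w x + generator Φ x ⬝ᵥ fderivWithin ℝ w Q x v := by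
    rw [grad_dotProduct]
    exact fderivWithin_dotProduct_apply (hF.uniqueDiffOn x hx)
      (hΦ'.differentiableOn_generator hF x hx) (hws x hx) v
  have h3 := curl_dotProduct_cross Q w x v (generator Φ x)
  rw [hΦ.curl_avgMetric_mulVec hF hBs hB hJ hx] at h3
  have h4 : (generator Φ x ⨯₃ curl Q B x) ⬝ᵥ v = curl Q B x ⬝ᵥ (v ⨯₃ generator Φ x) := by
    simp [dotProduct, Fin.sum_univ_three, cross_apply]
    ring
  rw [h2, h4, h3, dotProduct_comm _ (w x), dotProduct_comm (generator Φ x)]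
  linarith

end IsVolumePreservingCircleAction

/-! ### Decomposition of `B` and the generalized Grad-Shafranov equation -/

/-- The representation of `B` through `u ·̄ B` and `∇ψ = u × B`. -/
theorem eq_smul_add_mcross {h : Matrix (Fin 3) (Fin 3) ℝ} (hs : h.IsSymm) (hd : 0 < h.det)
    {u B g : R3} (hR : mdot h u u ≠ 0) (hg : u ⨯₃ B = g) :
    B = (mdot h u B / mdot h u u) • u + (density h / mdot h u u) • mcross h (h⁻¹ *ᵥ g) u := by
  have h1 : density h • mcross h (h⁻¹ *ᵥ g) u = g ⨯₃ (h *ᵥ u) := by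
    have h2 := mulVec_cross_mulVec hs hd.ne' (h⁻¹ *ᵥ g) u
    rw [Matrix.mulVec_mulVec, Matrix.mul_nonsing_inv _ hd.ne'.isUnit, Matrix.one_mulVec] at h2
    rw [h2, mcross, smul_smul, density, Real.mul_self_sqrt hd.le]
  -- The identity `(u × B) × z = (z · u) B - (z · B) u` with `z = h u`.
  have h3 : mdot h u u • B = mdot h u B • u + g ⨯₃ (h *ᵥ u) := by
    rw [mdot_comm hs u B, ← hg, mdot, mdot]
    generalize h *ᵥ u = z
    ext i
    fin_cases i <;> simp [dotProduct, Fin.sum_univ_three, cross_apply] <;> ring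
  rw [div_eq_inv_mul, div_eq_inv_mul, mul_smul, mul_smul, ← smul_add, h1, ← h3, smul_smul,
    inv_mul_cancel₀ hR, one_smul]

theorem cross_cross_eq_zero {u B a c : R3} (hc : u ⨯₃ B = c) (hu : a ⬝ᵥ u = 0)
    (hB : a ⬝ᵥ B = 0) : a ⨯₃ c = 0 := by
  have h : a ⨯₃ (u ⨯₃ B) = (a ⬝ᵥ B) • u - (a ⬝ᵥ u) • B := by
    ext i
    fin_cases i <;> simp [dotProduct, Fin.sum_univ_three, cross_apply] <;> ring
  rw [← hc, h, hu, hB, zero_smul, zero_smul, sub_zero]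

theorem fderivWithin_mul_comm_of_cross_eq_zero {Q : Set R3} {f g : R3 → ℝ} {x : R3}
    (h : grad Q f x ⨯₃ grad Q g x = 0) (v w : R3) :
    fderivWithin ℝ f Q x v * fderivWithin ℝ g Q x w =
      fderivWithin ℝ f Q x w * fderivWithin ℝ g Q x v := by
  have h1 : (grad Q f x ⨯₃ grad Q g x) ⬝ᵥ (v ⨯₃ w) =
      (grad Q f x ⬝ᵥ v) * (grad Q g x ⬝ᵥ w) - (grad Q f x ⬝ᵥ w) * (grad Q g x ⬝ᵥ v) := by
    simp [dotProduct, Fin.sum_univ_three, cross_apply]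
    ring
  rw [h, zero_dotProduct] at h1
  simp only [grad_dotProduct] at h1
  linarith

theorem grad_comp {Q : Set R3} {f ψ : R3 → ℝ} {C : ℝ → ℝ} {x : R3}
    (hQ : UniqueDiffWithinAt ℝ Q x) (hx : x ∈ Q) (hψ : DifferentiableWithinAt ℝ ψ Q x)
    (hC : DifferentiableAt ℝ C (ψ x)) (h : ∀ y ∈ Q, f y = C (ψ y)) :
    grad Q f x = deriv C (ψ x) • grad Q ψ x := by
  have h1 := (hC.hasDerivAt.comp_hasFDerivWithinAt x hψ.hasFDerivWithinAt).congr h (h x hx)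
  ext i
  simp [grad, h1.fderivWithin hQ]

/-- The difference of the two sides has zero cross product with `u` and with `B`, and these are
linearly independent. -/
theorem eq_smul_add_smul_of_cross_eq {u B J : R3} {α β : ℝ} (h0 : u ⨯₃ B ≠ 0)
    (hu : u ⨯₃ J = α • (u ⨯₃ B)) (hB : J ⨯₃ B = β • (u ⨯₃ B)) : J = β • u + α • B := by
  set D := J - (β • u + α • B) with hD
  have h1 : u ⨯₃ D = 0 := by
    rw [hD, map_sub, hu, map_add, _root_.map_smul, _root_.map_smul, cross_self]
    simp
  have h2 : D ⨯₃ B = 0 := by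
    rw [hD, map_sub, LinearMap.sub_apply, hB, map_add, LinearMap.add_apply, _root_.map_smul,
      _root_.map_smul, LinearMap.smul_apply, LinearMap.smul_apply, cross_self]
    simp
  have h3 : ((u ⨯₃ B) ⬝ᵥ (u ⨯₃ B)) • D = ((D ⨯₃ B) ⬝ᵥ (u ⨯₃ B)) • u +
      ((u ⨯₃ D) ⬝ᵥ (u ⨯₃ B)) • B - ((u ⨯₃ D) ⬝ᵥ B) • (u ⨯₃ B) := by
    generalize D = D
    ext i
    fin_cases i <;> simp [dotProduct, Fin.sum_univ_three, cross_apply] <;> ring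
  rw [h1, h2, zero_dotProduct, zero_dotProduct, zero_smul, zero_smul, zero_smul, add_zero,
    sub_zero] at h3
  exact sub_eq_zero.1 ((smul_eq_zero.1 h3).resolve_left (dotProduct_self_eq_zero.not.2 h0))

namespace IsVolumePreservingCircleAction

variable {Q : Set R3} {F : ℂ × ℝ → R3} {Φ : ℝ → R3 → R3} {B : R3 → R3} {ψ : R3 → ℝ}

/-- The averaged gradient of a stream function is an invariant field. -/
theorem mgrad_map (hF : IsChart Q F) (hΦ : IsVolumePreservingCircleAction Q Φ)
    (hB : ∀ θ, ∀ x ∈ Q, B (Φ θ x) = flowDeriv Q Φ (θ, x) (B x))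
    (hg : ∀ x ∈ Q, generator Φ x ⨯₃ B x = grad Q ψ x) (θ : ℝ) {x : R3} (hx : x ∈ Q) :
    mgrad Q (avgMetric Q Φ) ψ (Φ θ x) =
      flowDeriv Q Φ (θ, x) (mgrad Q (avgMetric Q Φ) ψ x) := by
  have hΦ' := hΦ.toIsCircleAction
  have hy := hΦ'.mapsTo θ hx
  have hdy := hΦ'.avgMetric_det_pos hF hy
  have h1 : avgMetric Q Φ (Φ θ x) *ᵥ flowDeriv Q Φ (θ, x) (mgrad Q (avgMetric Q Φ) ψ x) =
      grad Q ψ (Φ θ x) := by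
    refine dotProduct_eq _ _ fun v => ?_
    have hv : v = flowDeriv Q Φ (θ, x) (flowDeriv Q Φ (-θ, Φ θ x) v) :=
      (congrArg (fun A : R3 →L[ℝ] R3 => A v) (hΦ'.flowDeriv_comp_neg hF θ hx)).symm
    rw [hv]
    generalize flowDeriv Q Φ (-θ, Φ θ x) v = w
    rw [dotProduct_comm]
    refine (hΦ'.mdot_avgMetric_map hF θ hx w _).trans ?_
    rw [mdot_comm (avgMetric_isSymm Q Φ x),
      mdot_mgrad Q ψ (avgMetric_isSymm Q Φ x) (hΦ'.avgMetric_det_pos hF hx), ← hg x hx, ← hg _ hy,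
      hΦ'.generator_map hF θ hx, hB θ x hx, clm_cross_dotProduct, hΦ.det_eq_one hF θ hx, one_mul]
  rw [mgrad, ← h1, Matrix.mulVec_mulVec, Matrix.nonsing_inv_mul _ hdy.ne'.isUnit,
    Matrix.one_mulVec]

/-- The generalized Grad-Shafranov equation before the current is expressed through `ψ`. -/
theorem dotProduct_curl_eq (hF : IsChart Q F) (hΦ : IsVolumePreservingCircleAction Q Φ)
    (hu : ∀ x ∈ Q, generator Φ x ≠ 0) (hBs : ContDiffOn ℝ ∞ B Q)
    (hB : ∀ θ, ∀ x ∈ Q, B (Φ θ x) = flowDeriv Q Φ (θ, x) (B x))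
    (hJ : ∀ θ, ∀ x ∈ Q, curl Q B (Φ θ x) = flowDeriv Q Φ (θ, x) (curl Q B x))
    (hψ : IsStreamFunction Q (generator Φ) B ψ) {x : R3} (hx : x ∈ Q) :
    (avgMetric Q Φ x *ᵥ ((radiusSq Q Φ x)⁻¹ • generator Φ x)) ⬝ᵥ curl Q B x =
      mdot (avgMetric Q Φ x) (generator Φ x) (B x) *
        ((avgMetric Q Φ x *ᵥ ((radiusSq Q Φ x)⁻¹ • generator Φ x)) ⬝ᵥ
          curl Q (fun y => avgMetric Q Φ y *ᵥ ((radiusSq Q Φ y)⁻¹ • generator Φ y)) x) -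
      div Q (fun y => density (avgMetric Q Φ y) • (((radiusSq Q Φ y)⁻¹ *
        density (avgMetric Q Φ y)) • mgrad Q (avgMetric Q Φ) ψ y)) x := by
  have hΦ' := hΦ.toIsCircleAction
  have hR : ∀ y ∈ Q, radiusSq Q Φ y ≠ 0 := fun y hy =>
    (hΦ'.mdot_avgMetric_self_pos hF hy (hu y hy)).ne'
  have hh := hΦ'.contDiffOn_avgMetric hF
  have hus := hΦ'.contDiffOn_generator hF
  have hρs := hΦ'.contDiffOn_density hF
  have hRs : ContDiffOn ℝ ∞ (fun y => (radiusSq Q Φ y)⁻¹) Q := (hΦ'.contDiffOn_radiusSq hF).inv hR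
  have hux := hF.uniqueDiffOn x hx
  set f : R3 → ℝ := fun y => mdot (avgMetric Q Φ y) (generator Φ y) (B y) with hf
  set η : R3 → R3 := fun y => avgMetric Q Φ y *ᵥ ((radiusSq Q Φ y)⁻¹ • generator Φ y) with hη
  set V : R3 → R3 := fun y => density (avgMetric Q Φ y) • (((radiusSq Q Φ y)⁻¹ *
    density (avgMetric Q Φ y)) • mgrad Q (avgMetric Q Φ) ψ y) with hV
  have hfs : ContDiffOn ℝ ∞ f Q := hΦ'.contDiffOn_mdot hF hus hBs
  have hηs : ContDiffOn ℝ ∞ η Q := contDiffOn_mulVec hh (hRs.smul hus)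
  have hVs : ContDiffOn ℝ ∞ V Q :=
    hρs.smul ((hRs.mul hρs).smul (contDiffOn_matrix_inv_mulVec hh
      (fun y hy => (hΦ'.avgMetric_det_pos hF hy).ne') (contDiffOn_grad hF.uniqueDiffOn hψ.1)))
  have hfd := hfs.differentiableOn (by simp) x hx
  have hηd := hηs.differentiableOn (by simp) x hx
  have hVd := hVs.differentiableOn (by simp)
  have hud := hΦ'.differentiableOn_generator hF x hx
  -- Applying `ḡ` to the representation of `B` turns the averaged cross product into the flat one.
  -- In `V`, one factor `ρ` comes from the averaged cross product and the other from the coefficient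
  -- in the representation.
  have hdec : EqOn (fun y => avgMetric Q Φ y *ᵥ B y)
      (fun y => f y • η y + V y ⨯₃ generator Φ y) Q := by
    intro y hy
    have hd := hΦ'.avgMetric_det_pos hF hy
    have h1 := eq_smul_add_mcross (avgMetric_isSymm Q Φ y) hd (hR y hy) (hψ.2 y hy)
    have h2 : avgMetric Q Φ y *ᵥ B y = avgMetric Q Φ y *ᵥ _ := congrArg _ h1
    dsimp only
    rw [h2, Matrix.mulVec_add, Matrix.mulVec_smul, Matrix.mulVec_smul, mcross, Matrix.mulVec_smul,
      Matrix.mulVec_mulVec, Matrix.mul_nonsing_inv _ hd.ne'.isUnit, Matrix.one_mulVec, hη, hV]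
    simp only [Matrix.mulVec_smul, _root_.map_smul, LinearMap.smul_apply, smul_smul, mgrad]
    rw [radiusSq]
    congr 2
    ring
  have hVmap : ∀ θ, V (Φ θ x) = flowDeriv Q Φ (θ, x) (V x) := fun θ => by
    rw [hV]
    dsimp only
    rw [hΦ.density_map hF θ hx, hΦ'.radiusSq_map hF θ hx, hΦ.mgrad_map hF hB hψ.2 θ hx,
      _root_.map_smul, _root_.map_smul]
  have hηu : η x ⬝ᵥ generator Φ x = 1 := by
    rw [hη]
    dsimp only
    rw [dotProduct_mulVec_comm (avgMetric_isSymm Q Φ x), smul_dotProduct, smul_eq_mul]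
    exact inv_mul_cancel₀ (hR x hx)
  -- Since `u` is divergence free and `V`, being invariant, commutes with `u`, the curl of `V × u`
  -- reduces to `-(∇ · V) u`; moreover `η · u = 1`.
  have hcurl : curl Q B x = curl Q (fun y => f y • η y) x - div Q V x • generator Φ x := by
    rw [← hΦ.curl_avgMetric_mulVec hF hBs hB hJ hx, curl_congr hdec hx,
      curl_add hux (hfd.fun_smul hηd) (((contDiffOn_cross hVs hus).differentiableOn (by simp)) x hx),
      curl_cross hux (hVd x hx) hud, hΦ.div_generator hF hx,
      hΦ'.fderivWithin_eq_of_map_eq hF hVd hx hVmap]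
    simp [sub_eq_add_neg]
  rw [hcurl, dotProduct_sub, dotProduct_curl_smul hux hfd hηd, dotProduct_smul, hηu, smul_eq_mul,
    mul_one]

/-- The generalized Grad-Shafranov equation, when the current is `P'(ψ) u + C'(ψ) B`. -/
theorem solvesGGS (hF : IsChart Q F) (hΦ : IsVolumePreservingCircleAction Q Φ)
    (hu : ∀ x ∈ Q, generator Φ x ≠ 0) (hBs : ContDiffOn ℝ ∞ B Q)
    (hB : ∀ θ, ∀ x ∈ Q, B (Φ θ x) = flowDeriv Q Φ (θ, x) (B x))
    (hJ : ∀ θ, ∀ x ∈ Q, curl Q B (Φ θ x) = flowDeriv Q Φ (θ, x) (curl Q B x))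
    (hψ : IsStreamFunction Q (generator Φ) B ψ) {C P : ℝ → ℝ}
    (hC : ∀ x ∈ Q, mdot (avgMetric Q Φ x) (generator Φ x) (B x) = C (ψ x))
    (hcur : ∀ x ∈ Q, curl Q B x = deriv P (ψ x) • generator Φ x + deriv C (ψ x) • B x) :
    SolvesGGS Q Φ C P ψ := by
  intro x hx
  have hΦ' := hΦ.toIsCircleAction
  have hsymm := avgMetric_isSymm Q Φ x
  have hR : radiusSq Q Φ x ≠ 0 := (hΦ'.mdot_avgMetric_self_pos hF hx (hu x hx)).ne'
  have h1 := hΦ.dotProduct_curl_eq hF hu hBs hB hJ hψ hx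
  -- Pairing the current with `ḡ u / R²` gives `1` on `u` and `C(ψ) / R²` on `B`.
  have h2 : (avgMetric Q Φ x *ᵥ ((radiusSq Q Φ x)⁻¹ • generator Φ x)) ⬝ᵥ curl Q B x =
      deriv P (ψ x) + (radiusSq Q Φ x)⁻¹ * C (ψ x) * deriv C (ψ x) := by
    rw [hcur x hx, dotProduct_mulVec_comm hsymm, Matrix.mulVec_add, Matrix.mulVec_smul,
      Matrix.mulVec_smul, smul_dotProduct, dotProduct_add, dotProduct_smul, dotProduct_smul]
    change (radiusSq Q Φ x)⁻¹ * (deriv P (ψ x) * radiusSq Q Φ x +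
      deriv C (ψ x) * mdot (avgMetric Q Φ x) (generator Φ x) (B x)) = _
    rw [hC x hx]
    field_simp
  have h3 : mdot (avgMetric Q Φ x) ((radiusSq Q Φ x)⁻¹ • generator Φ x)
      (mcurl Q (avgMetric Q Φ) (fun y => (radiusSq Q Φ y)⁻¹ • generator Φ y) x) =
      (density (avgMetric Q Φ x))⁻¹ *
      ((avgMetric Q Φ x *ᵥ ((radiusSq Q Φ x)⁻¹ • generator Φ x)) ⬝ᵥ
          curl Q (fun y => avgMetric Q Φ y *ᵥ ((radiusSq Q Φ y)⁻¹ • generator Φ y)) x) := by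
    rw [mcurl, mdot, Matrix.mulVec_smul, dotProduct_smul, smul_eq_mul,
      dotProduct_mulVec_comm hsymm]
  rw [← h2, h1, h3, mdiv, hC x hx]
  ring

end IsVolumePreservingCircleAction

end MHD

/-! ### Assembly of the theorem -/

theorem mainTheorem2 (Q : Set MHD.R3) (hQ : MHD.IsSolidTorus Q)
    (B : MHD.R3 → MHD.R3) (p : MHD.R3 → ℝ) (hBp : MHD.IsNondegenerateEquilibrium Q B p)
    (Φ : ℝ → MHD.R3 → MHD.R3) (hΦ : MHD.IsVolumePreservingCircleAction Q Φ)
    (hu : ∀ x ∈ Q, MHD.generator Φ x ≠ 0)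
    (huB : ∀ x ∈ Q, VectorField.lieBracketWithin ℝ (MHD.generator Φ) B Q x = 0)
    (huJ : ∀ x ∈ Q,
      VectorField.lieBracketWithin ℝ (MHD.generator Φ) (MHD.curl Q B) Q x = 0) :
    (∃ ψ : MHD.R3 → ℝ, MHD.IsStreamFunction Q (MHD.generator Φ) B ψ) ∧
    ∀ ψ : MHD.R3 → ℝ, MHD.IsStreamFunction Q (MHD.generator Φ) B ψ →
      (∃ c : ℝ, ∀ x ∈ frontier Q, ψ x = c) ∧
      (∀ x ∈ Q, B x = MHD.streamField Q Φ
        (fun y => MHD.mdot (MHD.avgMetric Q Φ y) (MHD.generator Φ y) (B y)) ψ x) ∧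
      (MHD.HasNondegenerateAxis Q ψ →
        ∃ C P : ℝ → ℝ, ContDiff ℝ ∞ C ∧ ContDiff ℝ ∞ P ∧
          (∀ x ∈ Q, C (ψ x) = MHD.mdot (MHD.avgMetric Q Φ x) (MHD.generator Φ x) (B x)) ∧
          (∀ x ∈ Q, p x = P (ψ x)) ∧
          (∀ x ∈ Q, B x = MHD.streamField Q Φ (fun y => C (ψ y)) ψ x) ∧
          MHD.SolvesGGS Q Φ C P ψ) := by
  obtain ⟨F, hF⟩ := hQ.exists_chart
  have hΦ' := hΦ.toIsCircleAction
  have hBs := hBp.smooth_field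
  have hus := hΦ'.contDiffOn_generator hF
  have hJs := MHD.contDiffOn_curl hF.uniqueDiffOn hBs
  have hBmap : ∀ θ, ∀ x ∈ Q, B (Φ θ x) = MHD.flowDeriv Q Φ (θ, x) (B x) := fun θ x hx =>
    hΦ'.map_eq_of_bracket hF (hBs.differentiableOn (by simp)) huB θ hx
  have hJmap : ∀ θ, ∀ x ∈ Q,
      MHD.curl Q B (Φ θ x) = MHD.flowDeriv Q Φ (θ, x) (MHD.curl Q B x) := fun θ x hx =>
    hΦ'.map_eq_of_bracket hF (hJs.differentiableOn (by simp)) huJ θ hx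
  refine ⟨hΦ.exists_isStreamFunction hF hBs hBp.div_free hBp.tangent huB, fun ψ hψ => ?_⟩
  obtain ⟨c, hc⟩ := hψ.exists_const_frontier hF hΦ' hBp.tangent
  set f : MHD.R3 → ℝ := fun y => MHD.mdot (MHD.avgMetric Q Φ y) (MHD.generator Φ y) (B y) with hf
  have hBf : ∀ x ∈ Q, B x = MHD.streamField Q Φ f ψ x := fun x hx =>
    MHD.eq_smul_add_mcross (MHD.avgMetric_isSymm Q Φ x) (hΦ'.avgMetric_det_pos hF hx)
      (hΦ'.mdot_avgMetric_self_pos hF hx (hu x hx)).ne' (hψ.2 x hx)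
  refine ⟨⟨c, hc⟩, hBf, fun hax => ?_⟩
  obtain ⟨γ, a, hA⟩ := hF.exists_axisData hψ.1 hc hax
  have hfs : ContDiffOn ℝ ∞ f Q := hΦ'.contDiffOn_mdot hF hus hBs
  have hps := hBp.smooth_pressure
  have hpd : DifferentiableOn ℝ p Q := hps.differentiableOn (by simp)
  have hψd : DifferentiableOn ℝ ψ Q := hψ.1.differentiableOn (by simp)
  have hgf : ∀ x ∈ Q, MHD.generator Φ x ⨯₃ MHD.curl Q B x = MHD.grad Q f x := fun x hx =>
    hΦ.grad_mdot_generator hF hBs hBmap hJmap hx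
  -- The pressure is invariant because its gradient is the cross product of the invariant fields `J`
  -- and `B`.
  have hup : ∀ x ∈ Q, MHD.grad Q p x ⬝ᵥ MHD.generator Φ x = 0 := fun x hx => by
    rw [MHD.grad_dotProduct]
    exact hΦ'.fderivWithin_generator_eq_zero hpd hx fun θ =>
      hΦ.map_eq_of_grad_eq_cross hF hpd hBp.force_balance hJmap hBmap θ hx
  -- The gradient `u × J` of `u ·̄ B` is orthogonal to `u`, and its product with `B` is `u · (J × B)
  -- = u · ∇p = 0`; so it is parallel to `u × B`.
  obtain ⟨C, hCs, hC⟩ := hA.exists_level_function hF hfs fun x hx v w =>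
    MHD.fderivWithin_mul_comm_of_cross_eq_zero (MHD.cross_cross_eq_zero (hψ.2 x hx)
      (by rw [← hgf x hx, dotProduct_comm, dot_self_cross])
      (by
        rw [← hgf x hx, dotProduct_comm, triple_product_permutation, dotProduct_comm,
          hBp.force_balance x hx, hup x hx] )) v w
  obtain ⟨P, hPs, hP⟩ := hA.exists_level_function hF hps fun x hx v w =>
    MHD.fderivWithin_mul_comm_of_cross_eq_zero (MHD.cross_cross_eq_zero (hψ.2 x hx) (hup x hx)
      (by rw [← hBp.force_balance x hx, dotProduct_comm, dot_cross_self])) v w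
  -- At regular points `u` and `B` are independent, and `J` is determined by `u × J = C'(ψ) u × B`
  -- and `J × B = P'(ψ) u × B`. Both sides are continuous and regular points are dense.
  have hcur : Set.EqOn (MHD.curl Q B)
      (fun x => deriv P (ψ x) • MHD.generator Φ x + deriv C (ψ x) • B x) Q := by
    have h1 : Set.EqOn (MHD.curl Q B)
        (fun x => deriv P (ψ x) • MHD.generator Φ x + deriv C (ψ x) • B x)
        {x ∈ interior Q | fderivWithin ℝ ψ Q x ≠ 0} := by
      intro x hx
      have hxQ := interior_subset hx.1
      have hux := hF.uniqueDiffOn x hxQ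
      refine MHD.eq_smul_add_smul_of_cross_eq ?_ ?_ ?_
      · rw [hψ.2 x hxQ, Ne, MHD.grad_eq_zero_iff]
        exact hx.2
      · rw [hgf x hxQ, hψ.2 x hxQ]
        exact MHD.grad_comp hux hxQ (hψd x hxQ) (hCs.differentiable (by simp) _) hC
      · rw [hBp.force_balance x hxQ, hψ.2 x hxQ]
        exact MHD.grad_comp hux hxQ (hψd x hxQ) (hPs.differentiable (by simp) _) hP
    refine h1.of_subset_closure hJs.continuousOn ?_
      (fun x hx => interior_subset hx.1) (hA.subset_closure_regular hF)
    have hψc := hψ.1.continuousOn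
    exact (((hPs.continuous_deriv (by simp)).comp_continuousOn hψc).smul hus.continuousOn).add
      (((hCs.continuous_deriv (by simp)).comp_continuousOn hψc).smul hBs.continuousOn)
  refine ⟨C, P, hCs, hPs, fun x hx => (hC x hx).symm, hP, fun x hx => ?_,
    hΦ.solvesGGS hF hu hBs hBmap hJmap hψ hC fun x hx => hcur hx⟩
  rw [MHD.streamField, ← hC x hx]
  exact hBf x hx
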